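/- Let $(\{0,1\},p_X)$ be a binary memoryless source with entropy $H(X)$ (in bits), and let $\beta\in\,]0,1/2[$. For $n\in\mathbb N$ put $N=2^n$ and $\delta_N=2^{-N^\beta}$, let $X^N$ be the first $N$ symbols of the source, let $G_N=\left[\begin{smallmatrix}1&0\\1&1\end{smallmatrix}\right]^{\otimes n}$ over $\mathbb F_2$, and let $A^N=X^NG_N$. Define $$\mathcal V_X=\{i: H(A_i\mid A^{i-1})>1-\delta_N\},\qquad \mathcal H_X=\{i: H(A_i\mid A^{i-1})>\delta_N\}.$$ The polar-based uniform compression code of length $N$ uses a seed $U$ of $d_N=|\mathcal H_X\setminus\mathcal V_X|$ uniformly distributed bits, which is independent of $X^N$ and shared by encoder and decoder. Its encoder is $$\phi_N(X^N,U)=\big[A^N[\mathcal V_X],\;A^N[\mathcal H_X\setminus\mathcal V_X]\oplus U\big],$$ so that it has $M_N=2^{|\mathcal V_X|+d_N}$ messages. Its decoder $\psi_N$ recovers $A^N[\mathcal H_X]$ from the message and the seed, estimates the other bits $A_i$ in increasing order of $i$ by successive cancellation (the more likely value of $A_i$ under $p_X$ given the previously determined bits, and $0$ in case of a tie), and multiplies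 the result by $G_N^{-1}$. (1) Every rate $R>H(X)$ is achieved by these codes as $n\to\infty$: $\lim \frac1N\log_2 M_N$ exists and is at most $R$; $\lim d_N/N=0$, i.e. the seed length $|\mathcal H_X\setminus\mathcal V_X|$ is $o(N)$; $\lim\mathbb P[X^N\ne\psi_N(\phi_N(X^N,U),U)]=0$; and $\lim\sum_m\big|\mathbb P[\phi_N(X^N,U)=m]-1/M_N\big|=0$. (2) Encoding and decoding have complexity $O(N\log N)$: there are two programs for a unit-cost random access machine with exact real arithmetic (integer addition, subtraction and comparison, real addition, multiplication and comparison, indirect addressing, integers of size $O(N)$) which, given $n$, $N$, the index sets $\mathcal V_X$ and $\mathcal H_X\setminus\mathcal V_X$, the two source probabilities, the seed, and the source word (respectively the message), compute $\phi_N$ (respectively $\psi_N$) in at most $K\,N\log_2 N$ steps for all $n\ge1$ and all inputs. The programs and the constant $K$ do not depend on $n$, $p_X$ or $\beta$. -/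

import Mathlib

noncomputable section

namespace UniformCompression

open Finset Matrix Filter Topology

/-! ### Finite probability and entropy (in bits) -/

/-- The law of the random variable `f` when the outcome `a` has probability `q a`. -/
def lawOf {α β : Type*} [Fintype α] [DecidableEq β] (q : α → ℝ) (f : α → β) (b : β) : ℝ :=
  ∑ a with f a = b, q a

/-- The entropy `H(X)`, in bits, of a random variable with probability mass function `p`. -/
def entropy {α : Type*} [Fintype α] (p : PMF α) : ℝ :=
  ∑ a, Real.negMulLog (p a).toReal / Real.log 2

/-- The conditional entropy `H(Y | Z) = - ∑ P(y,z) log₂ (P(y,z) / P(z))`, in bits, of the random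
variables `Y` and `Z` when the outcome `a` has probability `q a`. -/
def condEntropy {α β γ : Type*} [Fintype α] [Fintype β] [Fintype γ] [DecidableEq β] [DecidableEq γ]
    (q : α → ℝ) (Y : α → β) (Z : α → γ) : ℝ :=
  - ∑ y, ∑ z, lawOf q (fun a => (Y a, Z a)) (y, z) *
      Real.logb 2 (lawOf q (fun a => (Y a, Z a)) (y, z) / lawOf q Z z)

/-- The law of the first `N` symbols of the memoryless source with symbol distribution `p`. -/
def sourceLaw {𝒳 : Type*} (p : PMF 𝒳) (N : ℕ) (x : Fin N → 𝒳) : ℝ :=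
  ∏ i, (p (x i)).toReal

/-! ### Uniform compression codes -/

/-- A uniform compression code of length `N` for a source with alphabet `𝒳`: a finite message set, a
finite set of seeds that has `2 ^ seedLength` elements, an encoder, and a decoder that knows the
seed. -/
structure Code (𝒳 : Type) (N : ℕ) where
  Msg : Type
  Seed : Type
  [fintypeMsg : Fintype Msg]
  [decEqMsg : DecidableEq Msg]
  [fintypeSeed : Fintype Seed]
  seedLength : ℕ
  card_seed : Fintype.card Seed = 2 ^ seedLength
  enc : (Fin N → 𝒳) → Seed → Msg
  dec : Msg → Seed → (Fin N → 𝒳)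

attribute [instance] Code.fintypeMsg Code.decEqMsg Code.fintypeSeed

namespace Code

variable {𝒳 : Type} [Fintype 𝒳] [DecidableEq 𝒳] {N : ℕ}

/-- The number of messages. -/
def numMsg (C : Code 𝒳 N) : ℕ := Fintype.card C.Msg

/-- The joint law of the source word and of the seed, which is uniform and independent of it. -/
def jointLaw (C : Code 𝒳 N) (p : PMF 𝒳) (w : (Fin N → 𝒳) × C.Seed) : ℝ :=
  sourceLaw p N w.1 * (1 / (Fintype.card C.Seed : ℝ))

/-- The average probability of error `P[X ≠ ψ(φ(X, U), U)]`. -/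
def errorProb (C : Code 𝒳 N) (p : PMF 𝒳) : ℝ :=
  ∑ w with w.1 ≠ C.dec (C.enc w.1 w.2) w.2, C.jointLaw p w

/-- The variational distance `∑ |P(φ(X, U) = m) - 1 / M|` between the encoder output and a uniform
message. -/
def uniformity (C : Code 𝒳 N) (p : PMF 𝒳) : ℝ :=
  ∑ m, |lawOf (C.jointLaw p) (fun w => C.enc w.1 w.2) m - 1 / (C.numMsg : ℝ)|

end Code

/-- The sequence of codes `C`, of lengths `N 0, N 1, …`, achieves the rate `R` for the memoryless
source with symbol distribution `p`. -/
def AchievesRate {𝒳 : Type} [Fintype 𝒳] [DecidableEq 𝒳] (p : PMF 𝒳) (R : ℝ) (N : ℕ → ℕ)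
    (C : ∀ n, Code 𝒳 (N n)) : Prop :=
  Tendsto N atTop atTop ∧
  (∃ L ≤ R, Tendsto (fun n => Real.logb 2 ((C n).numMsg : ℝ) / (N n : ℝ)) atTop (𝓝 L)) ∧
  Tendsto (fun n => ((C n).seedLength : ℝ) / (N n : ℝ)) atTop (𝓝 0) ∧
  Tendsto (fun n => (C n).errorProb p) atTop (𝓝 0) ∧
  Tendsto (fun n => (C n).uniformity p) atTop (𝓝 0)

/-! ### Polar-based uniform compression codes -/

/-- The source polarization transform: the `n`-th Kronecker power of `[1 0; 1 1]`. -/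
def polarMatrix : (n : ℕ) → Matrix (Fin (2 ^ n)) (Fin (2 ^ n)) (ZMod 2)
  | 0 => 1
  | n + 1 =>
    Matrix.reindex
      (finProdFinEquiv.trans (finCongr (pow_succ' 2 n).symm))
      (finProdFinEquiv.trans (finCongr (pow_succ' 2 n).symm))
      (Matrix.kronecker !![1, 0; 1, 1] (polarMatrix n))

/-- `A = X G`. -/
def polarTransform {n : ℕ} (x : Fin (2 ^ n) → ZMod 2) : Fin (2 ^ n) → ZMod 2 :=
  x ᵥ* polarMatrix n

/-- `H(A_i | A_j, j < i)`. -/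
def polarEntropy (p : PMF (ZMod 2)) {n : ℕ} (i : Fin (2 ^ n)) : ℝ :=
  condEntropy (sourceLaw p (2 ^ n)) (fun x => polarTransform x i)
    (fun x (j : {j : Fin (2 ^ n) // j < i}) => polarTransform x j)

/-- `δ_N = 2 ^ (-N ^ β)` for `N = 2 ^ n`. -/
def polarDelta (β : ℝ) (n : ℕ) : ℝ := (2 : ℝ) ^ (-(((2 : ℝ) ^ n) ^ β))

open Classical in
/-- The set `𝒱_X` of the indices `i` with `H(A_i | A_j, j < i) > 1 - δ_N`. -/
def veryHighSet (p : PMF (ZMod 2)) (β : ℝ) (n : ℕ) : Finset (Fin (2 ^ n)) :=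
  {i | 1 - polarDelta β n < polarEntropy p i}

open Classical in
/-- The set `ℋ_X` of the indices `i` with `H(A_i | A_j, j < i) > δ_N`. -/
def highSet (p : PMF (ZMod 2)) (β : ℝ) (n : ℕ) : Finset (Fin (2 ^ n)) :=
  {i | polarDelta β n < polarEntropy p i}

/-- The set `ℋ_X \ 𝒱_X`. -/
def padSet (p : PMF (ZMod 2)) (β : ℝ) (n : ℕ) : Finset (Fin (2 ^ n)) :=
  highSet p β n \ veryHighSet p β n

/-- A vector of bits indexed by a set of indices. -/
abbrev BitsOn {N : ℕ} (S : Finset (Fin N)) : Type := S → ZMod 2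

/-- Messages: a vector of bits indexed by `𝒱_X`, then one indexed by `ℋ_X \ 𝒱_X`. -/
abbrev PolarMsg (p : PMF (ZMod 2)) (β : ℝ) (n : ℕ) : Type :=
  BitsOn (veryHighSet p β n) × BitsOn (padSet p β n)

/-- The encoder: `(X, U) ↦ [A[𝒱_X], A[ℋ_X \ 𝒱_X] ⊕ U]`. -/
def polarEnc (p : PMF (ZMod 2)) (β : ℝ) (n : ℕ) (x : Fin (2 ^ n) → ZMod 2)
    (u : BitsOn (padSet p β n)) : PolarMsg p β n :=
  (fun i => polarTransform x i, fun i => polarTransform x i + u i)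

/-- The joint probability `P[A_j = a_j for j < i, A_i = b]`. -/
def pastProb (p : PMF (ZMod 2)) {n : ℕ} (i : Fin (2 ^ n))
    (a : {j : Fin (2 ^ n) // j < i} → ZMod 2) (b : ZMod 2) : ℝ :=
  lawOf (sourceLaw p (2 ^ n))
    (fun x => ((fun j : {j : Fin (2 ^ n) // j < i} => polarTransform x j), polarTransform x i))
    (a, b)

open Classical in
/-- Successive cancellation: `known i` is the value of `A_i` if this is available to the receiver;
the other bits are estimated in increasing order of `i`, each by its more likely value given the
preceding ones (and `0` in case of a tie). -/
def successiveCancellation (p : PMF (ZMod 2)) {n : ℕ} (known : Fin (2 ^ n) → Option (ZMod 2))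
    (i : Fin (2 ^ n)) : ZMod 2 :=
  match known i with
  | some b => b
  | none =>
    if pastProb p i (fun j => successiveCancellation p known j.1) 0 <
        pastProb p i (fun j => successiveCancellation p known j.1) 1
    then 1 else 0
termination_by i.val
decreasing_by all_goals exact j.2

/-- The values of `A_i`, `i ∈ ℋ_X`, that the receiver recovers from the message and the seed. -/
def receivedBits (p : PMF (ZMod 2)) (β : ℝ) (n : ℕ) (m : PolarMsg p β n)
    (u : BitsOn (padSet p β n)) (i : Fin (2 ^ n)) : Option (ZMod 2) :=
  if h : i ∈ veryHighSet p β n then some (m.1 ⟨i, h⟩)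
  else if h : i ∈ padSet p β n then some (m.2 ⟨i, h⟩ + u ⟨i, h⟩)
  else none

/-- The successive cancellation decoder. -/
def polarDec (p : PMF (ZMod 2)) (β : ℝ) (n : ℕ) (m : PolarMsg p β n)
    (u : BitsOn (padSet p β n)) : Fin (2 ^ n) → ZMod 2 :=
  successiveCancellation p (receivedBits p β n m u) ᵥ* (polarMatrix n)⁻¹

/-- The polar-based uniform compression code of length `2 ^ n`. -/
def polarCode (p : PMF (ZMod 2)) (β : ℝ) (n : ℕ) : Code (ZMod 2) (2 ^ n) where
  Msg := PolarMsg p β n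
  Seed := BitsOn (padSet p β n)
  seedLength := #(padSet p β n)
  card_seed := by simp [ZMod.card]
  enc := polarEnc p β n
  dec := polarDec p β n

/-! ### The machine model

A unit-cost random access machine with exact real arithmetic.  A program has finitely many integer
registers, integer arrays, real registers and real arrays.  On integers it can add, subtract
(truncated at `0`) and compare; on reals it can add, multiply and compare.  Every instruction and
every evaluated test costs one step.  Integers have to stay below a given bound. -/

/-- The contents of the registers and of the arrays. -/
structure State where
  reg : ℕ → ℕ
  arr : ℕ → ℕ → ℕ
  rreg : ℕ → ℝ
  rarr : ℕ → ℕ → ℝ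

/-- An integer register or a constant of the program. -/
inductive Operand where
  | reg (r : ℕ)
  | const (c : ℕ)

/-- The value of an operand. -/
def Operand.eval (s : State) : Operand → ℕ
  | .reg r => s.reg r
  | .const c => c

/-- Instructions; the first argument of an instruction is the place that it writes to. -/
inductive Instr where
  | set (r : ℕ) (e : Operand)
  | add (r : ℕ) (e₁ e₂ : Operand)
  | sub (r : ℕ) (e₁ e₂ : Operand)
  | load (r : ℕ) (a : ℕ) (idx : Operand)
  | store (a : ℕ) (idx : Operand) (e : Operand)
  | radd (r : ℕ) (r₁ r₂ : ℕ)
  | rmul (r : ℕ) (r₁ r₂ : ℕ)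
  | rload (r : ℕ) (a : ℕ) (idx : Operand)
  | rstore (a : ℕ) (idx : Operand) (r : ℕ)

/-- The effect of an instruction. -/
def Instr.exec (s : State) : Instr → State
  | .set r e => { s with reg := Function.update s.reg r (e.eval s) }
  | .add r e₁ e₂ => { s with reg := Function.update s.reg r (e₁.eval s + e₂.eval s) }
  | .sub r e₁ e₂ => { s with reg := Function.update s.reg r (e₁.eval s - e₂.eval s) }
  | .load r a idx => { s with reg := Function.update s.reg r (s.arr a (idx.eval s)) }
  | .store a idx e =>
      { s with arr := Function.update s.arr a
                        (Function.update (s.arr a) (idx.eval s) (e.eval s)) }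
  | .radd r r₁ r₂ => { s with rreg := Function.update s.rreg r (s.rreg r₁ + s.rreg r₂) }
  | .rmul r r₁ r₂ => { s with rreg := Function.update s.rreg r (s.rreg r₁ * s.rreg r₂) }
  | .rload r a idx => { s with rreg := Function.update s.rreg r (s.rarr a (idx.eval s)) }
  | .rstore a idx r =>
      { s with rarr := Function.update s.rarr a
                        (Function.update (s.rarr a) (idx.eval s) (s.rreg r)) }

/-- All integers in the registers and arrays are at most `B`. -/
def State.BoundedBy (B : ℕ) (s : State) : Prop :=
  (∀ r, s.reg r ≤ B) ∧ ∀ a i, s.arr a i ≤ B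

/-- Tests. -/
inductive Test where
  | lt (e₁ e₂ : Operand)
  | rlt (r₁ r₂ : ℕ)

/-- The truth value of a test. -/
def Test.holds (s : State) : Test → Prop
  | .lt e₁ e₂ => e₁.eval s < e₂.eval s
  | .rlt r₁ r₂ => s.rreg r₁ < s.rreg r₂

/-- Programs. -/
inductive Prog where
  | instr (i : Instr)
  | seq (P Q : Prog)
  | branch (c : Test) (P Q : Prog)
  | loop (c : Test) (P : Prog)

/-- `Exec B P s t s'`: the program `P`, started in the state `s`, stops in the state `s'` after
exactly `t` steps, and each of its instructions leaves all integers at most `B`. -/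
inductive Exec (B : ℕ) : Prog → State → ℕ → State → Prop
  | instr (i : Instr) (s : State) (h : (i.exec s).BoundedBy B) :
      Exec B (.instr i) s 1 (i.exec s)
  | seq {P Q : Prog} {s s' s'' : State} {t t' : ℕ} (h₁ : Exec B P s t s')
      (h₂ : Exec B Q s' t' s'') : Exec B (.seq P Q) s (t + t') s''
  | branch_true {c : Test} {P Q : Prog} {s s' : State} {t : ℕ} (hc : c.holds s)
      (h : Exec B P s t s') : Exec B (.branch c P Q) s (1 + t) s'
  | branch_false {c : Test} {P Q : Prog} {s s' : State} {t : ℕ} (hc : ¬ c.holds s)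
      (h : Exec B Q s t s') : Exec B (.branch c P Q) s (1 + t) s'
  | loop_done {c : Test} {P : Prog} {s : State} (hc : ¬ c.holds s) :
      Exec B (.loop c P) s 1 s
  | loop_step {c : Test} {P : Prog} {s s' s'' : State} {t t' : ℕ} (hc : c.holds s)
      (h₁ : Exec B P s t s') (h₂ : Exec B (.loop c P) s' t' s'') :
      Exec B (.loop c P) s (1 + t + t') s''

/-! ### Encoding and decoding as computational tasks -/

/-- The bits `b_{i_1}, b_{i_2}, …`, where `i_1 < i_2 < …` are the elements of `S`, in the cells
`0, 1, …` of an array (all other cells are `0`). -/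
def packBits {N : ℕ} (S : Finset (Fin N)) (b : BitsOn S) (k : ℕ) : ℕ :=
  if h : k < #S then (b (S.orderIsoOfFin rfl ⟨k, h⟩)).val else 0

/-- A source word in the cells `0, …, N - 1` of an array. -/
def packWord {N : ℕ} (x : Fin N → ZMod 2) (k : ℕ) : ℕ :=
  if h : k < N then (x ⟨k, h⟩).val else 0

/-- A message in the cells `0, …, |𝒱_X| + |ℋ_X \ 𝒱_X| - 1` of an array. -/
def packMsg (p : PMF (ZMod 2)) (β : ℝ) (n : ℕ) (m : PolarMsg p β n) (k : ℕ) : ℕ :=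
  if k < #(veryHighSet p β n) then packBits (veryHighSet p β n) m.1 k
  else packBits (padSet p β n) m.2 (k - #(veryHighSet p β n))

/-- The table of the index sets: `1` on `𝒱_X`, `2` on `ℋ_X \ 𝒱_X`, and `0` elsewhere. -/
def indexTable (p : PMF (ZMod 2)) (β : ℝ) (n : ℕ) (k : ℕ) : ℕ :=
  if h : k < 2 ^ n then
    if (⟨k, h⟩ : Fin (2 ^ n)) ∈ veryHighSet p β n then 1
    else if (⟨k, h⟩ : Fin (2 ^ n)) ∈ padSet p β n then 2 else 0
  else 0

/-- The initial state: `n` and `N = 2 ^ n` in the integer registers `0` and `1`; the table of the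
index sets, the data and the seed in the integer arrays `0`, `1` and `2`; the two source
probabilities in the real registers `0` and `1`; and `0` everywhere else. -/
def inputState (p : PMF (ZMod 2)) (β : ℝ) (n : ℕ) (data : ℕ → ℕ) (u : BitsOn (padSet p β n)) :
    State where
  reg r := if r = 0 then n else if r = 1 then 2 ^ n else 0
  arr a := if a = 0 then indexTable p β n else if a = 1 then data
    else if a = 2 then packBits (padSet p β n) u else 0
  rreg r := if r = 0 then (p 0).toReal else if r = 1 then (p 1).toReal else 0
  rarr := 0

/-- Within `T` steps and with integers at most `B`, the program `P` encodes every source word of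
length `2 ^ n` with every seed; the message is returned in the integer array `3`. -/
def EncodesWithin (P : Prog) (p : PMF (ZMod 2)) (β : ℝ) (n B T : ℕ) : Prop :=
  ∀ (x : Fin (2 ^ n) → ZMod 2) (u : BitsOn (padSet p β n)), ∃ t ≤ T, ∃ s : State,
    Exec B P (inputState p β n (packWord x) u) t s ∧
    ∀ k < #(veryHighSet p β n) + #(padSet p β n),
      s.arr 3 k = packMsg p β n ((polarCode p β n).enc x u) k

/-- Within `T` steps and with integers at most `B`, the program `P` decodes every message with
every seed; the source word is returned in the integer array `3`. -/
def DecodesWithin (P : Prog) (p : PMF (ZMod 2)) (β : ℝ) (n B T : ℕ) : Prop :=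
  ∀ (m : PolarMsg p β n) (u : BitsOn (padSet p β n)), ∃ t ≤ T, ∃ s : State,
    Exec B P (inputState p β n (packMsg p β n m) u) t s ∧
    ∀ i : Fin (2 ^ n), s.arr 3 i = ((polarCode p β n).dec m u i).val

end UniformCompression

end

noncomputable section

namespace UniformCompression

open Finset Matrix Filter Topology

/-! ### The recursive structure of the polar transform -/

/-! Because `G_N` is a Kronecker power, the first half of `A` is the transform of the sum of the two
halves of `X`, and the second half of `A` is the transform of the second half of `X`. Hence the
joint law of `A_i` and its past arises from the symbol law by `n` steps, each `minus` (sum of two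
independent copies) or `plus` (second copy given the sum), selected by the binary digits of `i`
(`past_lo`, `past_hi`, `func_leaf`). Averages over `i` become averages over the leaves of a binary
tree (`treeAvg`).

Polarization is proved with two dual parameters, the Bhattacharyya parameter `Z` and the bias `T = ∑
|P(0,y) - P(1,y)|`. `plus` squares `Z`, `minus` squares `T`, each of the other two steps at most
doubles the parameter, and `Z + T ≥ 1`, `Z² + T² ≤ 1` (`SideSource.polarizes`). The mean of `√(ZT)`
contracts geometrically, so after a few steps one of `Z`, `T` is small at most leaves. A small
parameter then decays doubly exponentially, because about half of the remaining steps square it.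
This leaves a vanishing fraction of indices with both parameters above `δ_N / 4`
(`Polarizes.tendsto_unpolarized`). The inequalities `1 - T ≤ H ≤ 3Z` turn this into `|ℋ \ 𝒱| =
o(N)`, and conservation of entropy, `∑ H(A_i | A^{i-1}) = N H(X)`, gives `|𝒱| / N → H(X)`.

Decoding fails only if a maximum likelihood decision outside `ℋ` is wrong given a correct past; a
union bound yields at most `N δ_N` (`errorProb_le`). The padded bits are exactly uniform and
independent of the rest, so only `A[𝒱]` matters for uniformity; adding its bits one at a time costs
at most the bias, and `T² ≤ 6 (1 - H)` yields `N √(6 δ_N)` (`uniformity_le`). Both bounds tend to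
`0`.

For the complexity, the encoder performs `n` in-place butterfly stages. Successive cancellation is
characterized by a fixed-point equation with a unique solution, so it agrees with the recursion
`cancelWord`, whose cost satisfies `T(2h) = 2 T(h) + O(h)`. The decoder runs this recursion without
a stack, as a loop over a small machine state (`iter_decodeStep`). -/

lemma sum_zmod_two {M : Type*} [AddCommMonoid M] (f : ZMod 2 → M) : ∑ b, f b = f 0 + f 1 :=
  Fin.sum_univ_two f

/-- The index `b + 2 ^ n * a` of the `b`-th entry of the `a`-th half. -/
def halfEquiv (n : ℕ) : Fin 2 × Fin (2 ^ n) ≃ Fin (2 ^ (n + 1)) :=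
  finProdFinEquiv.trans (finCongr (pow_succ' 2 n).symm)

/-- The inclusion of the first half. -/
def lo {n : ℕ} (i : Fin (2 ^ n)) : Fin (2 ^ (n + 1)) := halfEquiv n (0, i)

/-- The inclusion of the second half. -/
def hi {n : ℕ} (i : Fin (2 ^ n)) : Fin (2 ^ (n + 1)) := halfEquiv n (1, i)

@[simp] lemma lo_val {n : ℕ} (i : Fin (2 ^ n)) : (lo i).val = i.val := by
  simp [lo, halfEquiv]

@[simp] lemma hi_val {n : ℕ} (i : Fin (2 ^ n)) : (hi i).val = 2 ^ n + i.val := by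
  simp [hi, halfEquiv, add_comm]

lemma lo_or_hi {n : ℕ} (i : Fin (2 ^ (n + 1))) : (∃ j, i = lo j) ∨ ∃ j, i = hi j := by
  obtain ⟨⟨a, b⟩, rfl⟩ := (halfEquiv n).surjective i
  fin_cases a
  · exact Or.inl ⟨b, rfl⟩
  · exact Or.inr ⟨b, rfl⟩

lemma lo_lt_lo {n : ℕ} {i j : Fin (2 ^ n)} : lo i < lo j ↔ i < j := by
  rw [Fin.lt_def, Fin.lt_def, lo_val, lo_val]

lemma hi_lt_hi {n : ℕ} {i j : Fin (2 ^ n)} : hi i < hi j ↔ i < j := by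
  rw [Fin.lt_def, Fin.lt_def, hi_val, hi_val]; omega

lemma lo_lt_hi {n : ℕ} (i j : Fin (2 ^ n)) : lo i < hi j := by
  have := i.isLt
  simp only [Fin.lt_def, lo_val, hi_val]; omega

lemma forall_half {n : ℕ} {P : Fin (2 ^ (n + 1)) → Prop} :
    (∀ i, P i) ↔ (∀ i, P (lo i)) ∧ ∀ i, P (hi i) := by
  refine ⟨fun h => ⟨fun i => h _, fun i => h _⟩, fun h i => ?_⟩
  rcases lo_or_hi i with ⟨j, rfl⟩ | ⟨j, rfl⟩
  exacts [h.1 j, h.2 j]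

lemma sum_half {n : ℕ} {M : Type*} [AddCommMonoid M] (f : Fin (2 ^ (n + 1)) → M) :
    ∑ i, f i = ∑ i, f (lo i) + ∑ i, f (hi i) := by
  rw [← (halfEquiv n).sum_comp, Fintype.sum_prod_type]
  simp [Fin.sum_univ_two, lo, hi]

lemma prod_half {n : ℕ} {M : Type*} [CommMonoid M] (f : Fin (2 ^ (n + 1)) → M) :
    ∏ i, f i = (∏ i, f (lo i)) * ∏ i, f (hi i) := by
  rw [← (halfEquiv n).prod_comp, Fintype.prod_prod_type]
  simp [Fin.prod_univ_two, lo, hi]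

/-- A function on the first half and a function on the second half, glued. -/
def glue {n : ℕ} {α : Type*} (f g : Fin (2 ^ n) → α) (i : Fin (2 ^ (n + 1))) : α :=
  if ((halfEquiv n).symm i).1 = 0 then f ((halfEquiv n).symm i).2 else g ((halfEquiv n).symm i).2

@[simp] lemma glue_lo {n : ℕ} {α : Type*} (f g : Fin (2 ^ n) → α) (i : Fin (2 ^ n)) :
    glue f g (lo i) = f i := by simp [glue, lo]

@[simp] lemma glue_hi {n : ℕ} {α : Type*} (f g : Fin (2 ^ n) → α) (i : Fin (2 ^ n)) :
    glue f g (hi i) = g i := by simp [glue, hi]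

/-- Functions on all indices are pairs of functions on the two halves. -/
def glueEquiv (n : ℕ) (α : Type*) :
    (Fin (2 ^ n) → α) × (Fin (2 ^ n) → α) ≃ (Fin (2 ^ (n + 1)) → α) where
  toFun f := glue f.1 f.2
  invFun f := (fun i => f (lo i), fun i => f (hi i))
  left_inv f := by simp
  right_inv f := by
    funext i
    rcases lo_or_hi i with ⟨j, rfl⟩ | ⟨j, rfl⟩ <;> simp

lemma sum_glue {n : ℕ} {α M : Type*} [Fintype α] [AddCommMonoid M]
    (F : (Fin (2 ^ (n + 1)) → α) → M) :
    ∑ x, F x = ∑ y, ∑ z, F (glue y z) := by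
  rw [← (glueEquiv n α).sum_comp, Fintype.sum_prod_type]
  rfl

lemma polarMatrix_half {n : ℕ} (a b : Fin 2 × Fin (2 ^ n)) :
    polarMatrix (n + 1) (halfEquiv n a) (halfEquiv n b) =
      (!![1, 0; 1, 1] : Matrix (Fin 2) (Fin 2) (ZMod 2)) a.1 b.1 * polarMatrix n a.2 b.2 := by
  simp only [polarMatrix, halfEquiv, Matrix.reindex_apply, Matrix.submatrix_apply,
    Equiv.symm_apply_apply, Matrix.kronecker, Matrix.kroneckerMap_apply]

lemma polarTransform_eq {n : ℕ} (x : Fin (2 ^ n) → ZMod 2) (i : Fin (2 ^ n)) :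
    polarTransform x i = ∑ j, x j * polarMatrix n j i := rfl

lemma polarTransform_lo {n : ℕ} (x : Fin (2 ^ (n + 1)) → ZMod 2) (i : Fin (2 ^ n)) :
    polarTransform x (lo i) = polarTransform (fun k => x (lo k) + x (hi k)) i := by
  simp only [polarTransform_eq, sum_half, add_mul, Finset.sum_add_distrib]
  simp only [lo, hi, polarMatrix_half]
  simp

lemma polarTransform_hi {n : ℕ} (x : Fin (2 ^ (n + 1)) → ZMod 2) (i : Fin (2 ^ n)) :
    polarTransform x (hi i) = polarTransform (fun k => x (hi k)) i := by
  simp only [polarTransform_eq, sum_half]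
  simp only [lo, hi, polarMatrix_half]
  simp

lemma polarTransform_zero (x : Fin (2 ^ 0) → ZMod 2) : polarTransform x = x := by
  simp [polarTransform, polarMatrix]

lemma zmod_two_add_self (a : ZMod 2) : a + a = 0 := CharTwo.add_self_eq_zero a

lemma polarTransform_add {n : ℕ} (x y : Fin (2 ^ n) → ZMod 2) :
    polarTransform (fun k => x k + y k) = fun k => polarTransform x k + polarTransform y k := by
  funext k
  simp [polarTransform_eq, add_mul, Finset.sum_add_distrib]

/-- In characteristic two `[1 0; 1 1]` is an involution, and so are its Kronecker powers. Encoder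
and inverse transform therefore coincide. -/
lemma polarTransform_polarTransform {n : ℕ} (x : Fin (2 ^ n) → ZMod 2) :
    polarTransform (polarTransform x) = x := by
  induction n with
  | zero => simp [polarTransform_zero]
  | succ n ih =>
    funext i
    rcases lo_or_hi i with ⟨j, rfl⟩ | ⟨j, rfl⟩
    · rw [polarTransform_lo]
      simp only [polarTransform_lo, polarTransform_hi]
      rw [← polarTransform_add]
      simp only [add_assoc, zmod_two_add_self, add_zero]
      exact congrFun (ih _) j
    · rw [polarTransform_hi]
      simp only [polarTransform_hi]
      exact congrFun (ih _) j

/-- The polar transform as a bijection. -/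
def polarEquiv (n : ℕ) : (Fin (2 ^ n) → ZMod 2) ≃ (Fin (2 ^ n) → ZMod 2) where
  toFun := polarTransform
  invFun := polarTransform
  left_inv := polarTransform_polarTransform
  right_inv := polarTransform_polarTransform

lemma polarMatrix_mul_self (n : ℕ) : polarMatrix n * polarMatrix n = 1 := by
  apply Matrix.ext_of_single_vecMul
  intro i
  rw [← Matrix.vecMul_vecMul, Matrix.vecMul_one]
  exact polarTransform_polarTransform _

lemma vecMul_polarMatrix_inv {n : ℕ} (x : Fin (2 ^ n) → ZMod 2) :
    x ᵥ* (polarMatrix n)⁻¹ = polarTransform x := by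
  rw [Matrix.inv_eq_left_inv (polarMatrix_mul_self n)]; rfl

/-! ### The joint probability of a transformed bit and of the preceding ones -/

/-- The mass of the words `x` with `A_j = a_j` for `j < i` and `A_i = b`, when `w k` is the
measure of the `k`-th symbol. -/
def past {n : ℕ} (w : Fin (2 ^ n) → ZMod 2 → ℝ) (i : Fin (2 ^ n)) (a : Fin (2 ^ n) → ZMod 2)
    (b : ZMod 2) : ℝ :=
  ∑ x : Fin (2 ^ n) → ZMod 2,
    if (∀ j < i, polarTransform x j = a j) ∧ polarTransform x i = b then ∏ k, w k (x k) else 0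

/-- The measures of the sums of the symbols of the two halves. -/
def minusW {n : ℕ} (w : Fin (2 ^ (n + 1)) → ZMod 2 → ℝ) (k : Fin (2 ^ n)) (b : ZMod 2) : ℝ :=
  w (lo k) b * w (hi k) 0 + w (lo k) (b + 1) * w (hi k) 1

/-- The measures of the symbols of the second half when the sums of the two halves are `u`. -/
def plusW {n : ℕ} (w : Fin (2 ^ (n + 1)) → ZMod 2 → ℝ) (u : Fin (2 ^ n) → ZMod 2)
    (k : Fin (2 ^ n)) (b : ZMod 2) : ℝ :=
  w (lo k) (u k + b) * w (hi k) b

lemma past_congr {n : ℕ} (w : Fin (2 ^ n) → ZMod 2 → ℝ) (i : Fin (2 ^ n))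
    {a a' : Fin (2 ^ n) → ZMod 2} (h : ∀ j < i, a j = a' j) (b : ZMod 2) :
    past w i a b = past w i a' b := by
  unfold past
  refine Finset.sum_congr rfl fun x _ => ?_
  have : (∀ j < i, polarTransform x j = a j) ↔ (∀ j < i, polarTransform x j = a' j) :=
    forall₂_congr fun j hj => by rw [h j hj]
  simp only [this]

lemma past_zero (w : Fin (2 ^ 0) → ZMod 2 → ℝ) (i : Fin (2 ^ 0)) (a : Fin (2 ^ 0) → ZMod 2)
    (b : ZMod 2) : past w i a b = w i b := by
  have hi : i = 0 := Subsingleton.elim (α := Fin 1) _ _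
  subst hi
  have hc (x : Fin (2 ^ 0) → ZMod 2) :
      ((∀ j < (0 : Fin (2 ^ 0)), polarTransform x j = a j) ∧ polarTransform x 0 = b) ↔
        x = fun _ => b := by
    rw [polarTransform_zero]
    constructor
    · rintro ⟨-, h⟩
      funext k
      rw [Subsingleton.elim (α := Fin 1) k 0]; exact h
    · rintro rfl
      exact ⟨fun j hj => absurd hj (by simp), rfl⟩
  unfold past
  simp only [hc]
  rw [Finset.sum_ite_eq' Finset.univ]
  simp only [Finset.mem_univ, if_true]
  exact Fintype.prod_subsingleton (ι := Fin 1) _ 0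

/-- Summation over pairs of words, in terms of their sum and of the second one. -/
lemma sum_glue_add {n : ℕ} {M : Type*} [AddCommMonoid M]
    (F : (Fin (2 ^ (n + 1)) → ZMod 2) → M) :
    ∑ x, F x = ∑ u : Fin (2 ^ n) → ZMod 2, ∑ v : Fin (2 ^ n) → ZMod 2,
      F (glue (fun k => u k + v k) v) := by
  rw [sum_glue, Finset.sum_comm]
  conv_rhs => rw [Finset.sum_comm]
  refine Finset.sum_congr rfl fun v _ => ?_
  exact (Equiv.sum_comp (Equiv.addRight v) fun u => F (glue u v)).symm

lemma transform_glue_lo {n : ℕ} (u v : Fin (2 ^ n) → ZMod 2) (i : Fin (2 ^ n)) :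
    polarTransform (glue (fun k => u k + v k) v) (lo i) = polarTransform u i := by
  rw [polarTransform_lo]
  simp [add_assoc, zmod_two_add_self]

lemma transform_glue_hi {n : ℕ} (u v : Fin (2 ^ n) → ZMod 2) (i : Fin (2 ^ n)) :
    polarTransform (glue u v) (hi i) = polarTransform v i := by
  rw [polarTransform_hi]
  simp

/-- Write the word as `(u + v, v)`. The event only involves `u`, so `v` can be summed out, and the
sum of products factors into a product over the symbols. -/
lemma past_lo {n : ℕ} (w : Fin (2 ^ (n + 1)) → ZMod 2 → ℝ) (i : Fin (2 ^ n))
    (a : Fin (2 ^ (n + 1)) → ZMod 2) (b : ZMod 2) :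
    past w (lo i) a b = past (minusW w) i (fun k => a (lo k)) b := by
  unfold past
  rw [sum_glue_add]
  refine Finset.sum_congr rfl fun u _ => ?_
  have hc (v : Fin (2 ^ n) → ZMod 2) :
      ((∀ j < lo i, polarTransform (glue (fun k => u k + v k) v) j = a j) ∧
        polarTransform (glue (fun k => u k + v k) v) (lo i) = b) ↔
      ((∀ j < i, polarTransform u j = a (lo j)) ∧ polarTransform u i = b) := by
    rw [forall_half]
    simp only [transform_glue_lo, lo_lt_lo]
    have : ∀ j : Fin (2 ^ n), ¬ hi j < lo i := fun j => (lo_lt_hi i j).not_gt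
    simp [this]
  simp only [hc]
  split_ifs with h
  · simp only [prod_half, glue_lo, glue_hi, ← Finset.prod_mul_distrib]
    have := Finset.prod_univ_sum (fun _ : Fin (2 ^ n) => (Finset.univ : Finset (ZMod 2)))
      (fun k v => w (lo k) (u k + v) * w (hi k) v)
    rw [Fintype.piFinset_univ] at this
    rw [← this]
    refine Finset.prod_congr rfl fun k _ => ?_
    rw [sum_zmod_two, add_zero, minusW]
  · simp

/-- The past now contains the whole transform of `u`. Since the transform is invertible, a single
`u` survives, and what remains is a sum over `v`. -/
lemma past_hi {n : ℕ} (w : Fin (2 ^ (n + 1)) → ZMod 2 → ℝ) (i : Fin (2 ^ n))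
    (a : Fin (2 ^ (n + 1)) → ZMod 2) (b : ZMod 2) :
    past w (hi i) a b =
      past (plusW w (polarTransform fun k => a (lo k))) i (fun k => a (hi k)) b := by
  unfold past
  rw [sum_glue_add]
  have hc (u v : Fin (2 ^ n) → ZMod 2) :
      ((∀ j < hi i, polarTransform (glue (fun k => u k + v k) v) j = a j) ∧
        polarTransform (glue (fun k => u k + v k) v) (hi i) = b) ↔
      (u = (polarTransform fun k => a (lo k)) ∧
        ((∀ j < i, polarTransform v j = a (hi j)) ∧ polarTransform v i = b)) := by
    rw [forall_half]
    simp only [transform_glue_lo, transform_glue_hi, hi_lt_hi, lo_lt_hi, true_imp_iff]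
    have : (∀ j, polarTransform u j = a (lo j)) ↔ u = (polarTransform fun k => a (lo k)) := by
      rw [← funext_iff (f := polarTransform u)]
      constructor
      · intro h
        have := congrArg polarTransform h
        rwa [polarTransform_polarTransform] at this
      · rintro rfl
        rw [polarTransform_polarTransform]
    rw [this, and_assoc]
  simp only [hc]
  rw [Finset.sum_eq_single (polarTransform fun k => a (lo k))]
  · simp only [true_and, prod_half, glue_lo, glue_hi, ← Finset.prod_mul_distrib]
    rfl
  · intro u _ hu
    simp [hu]
  · simp

/-! ### The recursive form of successive cancellation -/

/-- The more likely bit, `0` in case of a tie. -/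
def likelyBit (s t : ℝ) : ZMod 2 := if s < t then 1 else 0

/-- A received bit, or else the more likely one. -/
def decideBit (k : Option (ZMod 2)) (s t : ℝ) : ZMod 2 := k.getD (likelyBit s t)

/-- `a` is the output of successive cancellation. -/
def IsCancellation {n : ℕ} (w : Fin (2 ^ n) → ZMod 2 → ℝ) (known : Fin (2 ^ n) → Option (ZMod 2))
    (a : Fin (2 ^ n) → ZMod 2) : Prop :=
  ∀ i, a i = decideBit (known i) (past w i a 0) (past w i a 1)

/-- The decision at `i` depends on `a` only below `i`, so the equations determine the bits one after
the other. This identifies the decoder's output with the recursive one, and with the true word when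
no decision is wrong. -/
lemma IsCancellation.unique {n : ℕ} {w : Fin (2 ^ n) → ZMod 2 → ℝ}
    {known : Fin (2 ^ n) → Option (ZMod 2)} {a a' : Fin (2 ^ n) → ZMod 2}
    (h : IsCancellation w known a) (h' : IsCancellation w known a') : a = a' := by
  have key : ∀ (m : ℕ) (i : Fin (2 ^ n)), i.val = m → a i = a' i := by
    intro m
    induction m using Nat.strong_induction_on with
    | _ m ih =>
      intro i hi
      have hlt : ∀ j < i, a j = a' j := fun j hj => ih j.val (by rw [← hi]; exact hj) j rfl
      rw [h i, h' i, past_congr w i hlt 0, past_congr w i hlt 1]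
  funext i
  exact key _ i rfl

/-- The word that successive cancellation produces, computed recursively. -/
def cancelWord : (n : ℕ) → (Fin (2 ^ n) → ZMod 2 → ℝ) → (Fin (2 ^ n) → Option (ZMod 2)) →
    Fin (2 ^ n) → ZMod 2
  | 0, w, known => fun i => decideBit (known i) (w i 0) (w i 1)
  | n + 1, w, known =>
    glue
      (fun k => cancelWord n (minusW w) (fun j => known (lo j)) k +
        cancelWord n (plusW w (cancelWord n (minusW w) (fun j => known (lo j))))
          (fun j => known (hi j)) k)
      (cancelWord n (plusW w (cancelWord n (minusW w) (fun j => known (lo j))))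
        (fun j => known (hi j)))

/-- By `past_lo` the first half is cancellation for `minusW`. By `past_hi` the second half is
cancellation for `plusW`, where the decided first half enters only through its inverse transform,
which is the word already returned by the first recursive call. -/
lemma isCancellation_cancelWord {n : ℕ} (w : Fin (2 ^ n) → ZMod 2 → ℝ)
    (known : Fin (2 ^ n) → Option (ZMod 2)) :
    IsCancellation w known (polarTransform (cancelWord n w known)) := by
  induction n with
  | zero => intro i; simp [past_zero, polarTransform_zero, cancelWord]
  | succ n ih =>
    have hlo : (fun k => polarTransform (cancelWord (n + 1) w known) (lo k)) =
        polarTransform (cancelWord n (minusW w) (fun j => known (lo j))) := by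
      funext k; simp only [cancelWord, transform_glue_lo]
    have hhi : (fun k => polarTransform (cancelWord (n + 1) w known) (hi k)) =
        polarTransform (cancelWord n (plusW w (cancelWord n (minusW w) (fun j => known (lo j))))
          (fun j => known (hi j))) := by
      funext k; simp only [cancelWord, transform_glue_hi]
    intro i
    rcases lo_or_hi i with ⟨j, rfl⟩ | ⟨j, rfl⟩
    · rw [past_lo, past_lo, hlo, congrFun hlo j]
      exact ih _ _ j
    · rw [past_hi, past_hi, hlo, hhi, congrFun hhi j, polarTransform_polarTransform]
      exact ih _ _ j

lemma pastProb_eq_past (p : PMF (ZMod 2)) {n : ℕ} (i : Fin (2 ^ n))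
    (a : Fin (2 ^ n) → ZMod 2) (b : ZMod 2) :
    pastProb p i (fun j => a j) b = past (fun _ x => (p x).toReal) i a b := by
  unfold pastProb lawOf past
  rw [Finset.sum_filter]
  refine Finset.sum_congr rfl fun x _ => ?_
  have : (((fun j : {j : Fin (2 ^ n) // j < i} => polarTransform x j), polarTransform x i) =
      ((fun j : {j : Fin (2 ^ n) // j < i} => a j), b)) ↔
      ((∀ j < i, polarTransform x j = a j) ∧ polarTransform x i = b) := by
    rw [Prod.mk.injEq, funext_iff, Subtype.forall]
  simp only [this, sourceLaw]

lemma isCancellation_successiveCancellation (p : PMF (ZMod 2)) {n : ℕ}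
    (known : Fin (2 ^ n) → Option (ZMod 2)) :
    IsCancellation (fun _ x => (p x).toReal) known (successiveCancellation p known) := by
  intro i
  rw [← pastProb_eq_past, ← pastProb_eq_past]
  conv_lhs => rw [successiveCancellation]
  cases h : known i with
  | none => simp [decideBit, likelyBit]
  | some b => simp [decideBit]

lemma successiveCancellation_eq (p : PMF (ZMod 2)) {n : ℕ}
    (known : Fin (2 ^ n) → Option (ZMod 2)) :
    successiveCancellation p known ᵥ* (polarMatrix n)⁻¹ =
      cancelWord n (fun _ x => (p x).toReal) known := by
  rw [vecMul_polarMatrix_inv, (isCancellation_successiveCancellation p known).unique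
    (isCancellation_cancelWord _ known), polarTransform_polarTransform]

/-! ### Averages over the leaves of a binary tree -/

section Tree

variable {S : Type*}

/-- The average of `F` over the `2 ^ n` points that are reached from a point by `n` steps, each of
which is one of the maps `f` and `g`. -/
def treeAvg (f g : S → S) : ℕ → (S → ℝ) → S → ℝ
  | 0, F, s => F s
  | n + 1, F, s => (treeAvg f g n F (f s) + treeAvg f g n F (g s)) / 2

lemma treeAvg_comm (f g : S → S) (n : ℕ) (F : S → ℝ) (s : S) :
    treeAvg f g n F s = treeAvg g f n F s := by
  induction n generalizing s with
  | zero => rfl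
  | succ n ih => simp only [treeAvg, ih, add_comm]

lemma treeAvg_mono (f g : S → S) (n : ℕ) {F G : S → ℝ} (h : ∀ s, F s ≤ G s) (s : S) :
    treeAvg f g n F s ≤ treeAvg f g n G s := by
  induction n generalizing s with
  | zero => exact h s
  | succ n ih => simp only [treeAvg]; linarith [ih (f s), ih (g s)]

lemma treeAvg_const (f g : S → S) (n : ℕ) (c : ℝ) (s : S) : treeAvg f g n (fun _ => c) s = c := by
  induction n generalizing s with
  | zero => rfl
  | succ n ih => simp only [treeAvg, ih]; ring

lemma treeAvg_add (f g : S → S) (n : ℕ) (F G : S → ℝ) (s : S) :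
    treeAvg f g n (fun s => F s + G s) s = treeAvg f g n F s + treeAvg f g n G s := by
  induction n generalizing s with
  | zero => rfl
  | succ n ih => simp only [treeAvg, ih]; ring

lemma treeAvg_mul_const (f g : S → S) (n : ℕ) (F : S → ℝ) (c : ℝ) (s : S) :
    treeAvg f g n (fun s => F s * c) s = treeAvg f g n F s * c := by
  induction n generalizing s with
  | zero => rfl
  | succ n ih => simp only [treeAvg, ih]; ring

lemma treeAvg_steps (f g : S → S) (m k : ℕ) (F : S → ℝ) (s : S) :
    treeAvg f g (m + k) F s = treeAvg f g m (treeAvg f g k F) s := by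
  induction m generalizing s with
  | zero => simp [treeAvg]
  | succ m ih => rw [Nat.succ_add]; simp only [treeAvg, ih]

open Classical in
/-- The indicator function of a predicate. -/
def ind (P : S → Prop) (s : S) : ℝ := if P s then 1 else 0

lemma ind_nonneg (P : S → Prop) (s : S) : 0 ≤ ind P s := by unfold ind; split_ifs <;> norm_num

lemma ind_le_one (P : S → Prop) (s : S) : ind P s ≤ 1 := by unfold ind; split_ifs <;> norm_num

lemma ind_mono {P Q : S → Prop} {s : S} (h : P s → Q s) : ind P s ≤ ind Q s := by
  unfold ind
  by_cases hP : P s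
  · simp [hP, h hP]
  · rw [if_neg hP]; split_ifs <;> norm_num

lemma treeAvg_ind_nonneg (f g : S → S) (n : ℕ) (P : S → Prop) (s : S) :
    0 ≤ treeAvg f g n (ind P) s := by
  simpa only [treeAvg_const] using treeAvg_mono f g n (ind_nonneg P) s

lemma treeAvg_ind_le_one (f g : S → S) (n : ℕ) (P : S → Prop) (s : S) :
    treeAvg f g n (ind P) s ≤ 1 := by
  simpa only [treeAvg_const] using treeAvg_mono f g n (ind_le_one P) s

/-- If the average over `k` further steps of the indicator of `Q` is at most `ε` except where `P`
holds, then the average over `m + k` steps is at most that of the indicator of `P` plus `ε`. -/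
lemma treeAvg_ind_steps_le (f g : S → S) (m k : ℕ) {P Q : S → Prop} {ε : ℝ} (hε : 0 ≤ ε)
    (h : ∀ s, ¬ P s → treeAvg f g k (ind Q) s ≤ ε) (s : S) :
    treeAvg f g (m + k) (ind Q) s ≤ treeAvg f g m (ind P) s + ε := by
  have h1 : ∀ s, treeAvg f g k (ind Q) s ≤ ind P s + ε := by
    intro s
    by_cases hP : P s
    · have := treeAvg_ind_le_one f g k Q s
      simp only [ind, hP, if_true]; linarith
    · simpa [ind, hP] using h s hP
  rw [treeAvg_steps]
  refine (treeAvg_mono f g m h1 s).trans ?_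
  rw [treeAvg_add, treeAvg_const]

/-! ### Polarization -/

/-- The relations between a pair of parameters and a pair of maps that lead to polarization. -/
structure Polarizes (f g : S → S) (Z T : S → ℝ) : Prop where
  Z_nonneg : ∀ s, 0 ≤ Z s
  T_nonneg : ∀ s, 0 ≤ T s
  Z_sq : ∀ s, Z (g s) = Z s ^ 2
  Z_le : ∀ s, Z (f s) ≤ Z s * (2 - Z s)
  T_sq : ∀ s, T (f s) = T s ^ 2
  T_le : ∀ s, T (g s) ≤ T s * (2 - T s)
  one_le : ∀ s, 1 ≤ Z s + T s
  sq_le : ∀ s, Z s ^ 2 + T s ^ 2 ≤ 1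

lemma Polarizes.symm {f g : S → S} {Z T : S → ℝ} (h : Polarizes f g Z T) : Polarizes g f T Z where
  Z_nonneg := h.T_nonneg
  T_nonneg := h.Z_nonneg
  Z_sq := h.T_sq
  Z_le := h.T_le
  T_sq := h.Z_sq
  T_le := h.Z_le
  one_le s := by rw [add_comm]; exact h.one_le s
  sq_le s := by rw [add_comm]; exact h.sq_le s

lemma Polarizes.Z_le_one {f g : S → S} {Z T : S → ℝ} (h : Polarizes f g Z T) (s : S) :
    Z s ≤ 1 := by
  nlinarith [h.sq_le s, sq_nonneg (T s), h.Z_nonneg s]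

/-- The left side is continuous on a compact set, so it suffices that it stays below `1` pointwise.
Equality could only come from `z = 1` or `t = 1`, where the constraint forces the other variable to
be `0` and the value is `√2 / 2`. -/
lemma exists_contraction : ∃ ρ : ℝ, 0 < ρ ∧ ρ < 1 ∧ ∀ z t : ℝ, 0 ≤ z → 0 ≤ t → z ^ 2 + t ^ 2 ≤ 1 →
    (√(z * (2 - t)) + √(t * (2 - z))) / 2 ≤ ρ := by
  let K : Set (ℝ × ℝ) := (Set.Icc 0 1 ×ˢ Set.Icc 0 1) ∩ {q | q.1 ^ 2 + q.2 ^ 2 ≤ 1}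
  have hK : IsCompact K := by
    refine (isCompact_Icc.prod isCompact_Icc).inter_right ?_
    exact isClosed_le (by fun_prop) continuous_const
  let F : ℝ × ℝ → ℝ := fun q => (√(q.1 * (2 - q.2)) + √(q.2 * (2 - q.1))) / 2
  have hF : ContinuousOn F K := by
    apply Continuous.continuousOn
    fun_prop
  obtain ⟨q, hq, hmax⟩ := hK.exists_isMaxOn ⟨(0, 0), by simp [K]⟩ hF
  have hlt : F q < 1 := by
    obtain ⟨⟨⟨h0, h1⟩, h2, h3⟩, h4⟩ := hq
    change q.1 ^ 2 + q.2 ^ 2 ≤ 1 at h4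
    have hA : 0 ≤ q.1 * (2 - q.2) := mul_nonneg h0 (by linarith)
    have hB : 0 ≤ q.2 * (2 - q.1) := mul_nonneg h2 (by linarith)
    have sA := Real.sq_sqrt hA
    have sB := Real.sq_sqrt hB
    have nA := Real.sqrt_nonneg (q.1 * (2 - q.2))
    have nB := Real.sqrt_nonneg (q.2 * (2 - q.1))
    change (√(q.1 * (2 - q.2)) + √(q.2 * (2 - q.1))) / 2 < 1
    by_contra hcon
    have hge : 2 ≤ √(q.1 * (2 - q.2)) + √(q.2 * (2 - q.1)) := by linarith
    -- The two radicands add up to `2 - 2 (1 - z)(1 - t)`, and this sum is at least half the square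
    -- of the sum of the roots, hence at least `2`.
    have h5 : (1 - q.1) * (1 - q.2) ≤ 0 := by
      nlinarith [sq_nonneg (√(q.1 * (2 - q.2)) - √(q.2 * (2 - q.1)))]
    have h6 : q.1 = 1 ∨ q.2 = 1 := by
      by_contra h
      push Not at h
      have := mul_pos (sub_pos.2 (lt_of_le_of_ne h1 h.1)) (sub_pos.2 (lt_of_le_of_ne h3 h.2))
      linarith
    rcases h6 with h | h
    · have h' : q.2 = 0 := by nlinarith
      rw [h, h'] at sA sB hge
      simp only [sub_zero, one_mul, zero_mul, Real.sqrt_zero, add_zero] at sA hge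
      nlinarith
    · have h' : q.1 = 0 := by nlinarith
      rw [h, h'] at sA sB hge
      simp only [sub_zero, one_mul, zero_mul, Real.sqrt_zero, zero_add] at sB hge
      nlinarith
  refine ⟨max (F q) (1 / 2), by simp, max_lt hlt (by norm_num), fun z t hz ht hzt => ?_⟩
  refine le_trans (hmax (a := (z, t)) ?_) (le_max_left _ _)
  refine ⟨⟨⟨hz, ?_⟩, ht, ?_⟩, hzt⟩
  · change z ≤ 1
    nlinarith
  · change t ≤ 1
    nlinarith

/-- The contraction constant of polarization. -/
def contraction : ℝ := exists_contraction.choose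

lemma contraction_pos : 0 < contraction := exists_contraction.choose_spec.1

lemma contraction_lt_one : contraction < 1 := exists_contraction.choose_spec.2.1

lemma contraction_spec {z t : ℝ} (hz : 0 ≤ z) (ht : 0 ≤ t) (h : z ^ 2 + t ^ 2 ≤ 1) :
    √(z * (2 - t)) + √(t * (2 - z)) ≤ 2 * contraction := by
  have := exists_contraction.choose_spec.2.2 z t hz ht h
  have h2 : (√(z * (2 - t)) + √(t * (2 - z))) / 2 ≤ contraction := this
  linarith

variable {f g : S → S} {Z T : S → ℝ}

/-- Each step squares one parameter and multiplies the other by at most `2` minus itself, so `√(ZT)`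
picks up exactly the two factors bounded in `contraction_spec`. -/
lemma Polarizes.sqrt_step (h : Polarizes f g Z T) (s : S) :
    √(Z (f s) * T (f s)) + √(Z (g s) * T (g s)) ≤ 2 * contraction * √(Z s * T s) := by
  have hZ := h.Z_nonneg s
  have hT := h.T_nonneg s
  have h1 : √(Z (f s) * T (f s)) ≤ √(Z s * T s) * √(T s * (2 - Z s)) := by
    rw [← Real.sqrt_mul (mul_nonneg hZ hT), h.T_sq]
    apply Real.sqrt_le_sqrt
    nlinarith [mul_le_mul_of_nonneg_right (h.Z_le s) (sq_nonneg (T s))]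
  have h2 : √(Z (g s) * T (g s)) ≤ √(Z s * T s) * √(Z s * (2 - T s)) := by
    rw [← Real.sqrt_mul (mul_nonneg hZ hT), h.Z_sq]
    apply Real.sqrt_le_sqrt
    nlinarith [mul_le_mul_of_nonneg_right (h.T_le s) (sq_nonneg (Z s))]
  nlinarith [mul_le_mul_of_nonneg_left (contraction_spec hZ hT (h.sq_le s))
    (Real.sqrt_nonneg (Z s * T s))]

lemma Polarizes.treeAvg_sqrt_le (h : Polarizes f g Z T) (n : ℕ) (s : S) :
    treeAvg f g n (fun s => √(Z s * T s)) s ≤ contraction ^ n * √(Z s * T s) := by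
  induction n generalizing s with
  | zero => simp [treeAvg]
  | succ n ih =>
    simp only [treeAvg]
    have := mul_le_mul_of_nonneg_left (h.sqrt_step s) (pow_nonneg contraction_pos.le n)
    rw [pow_succ]
    nlinarith [ih (f s), ih (g s)]

/-- Markov's inequality for `√(ZT)`, whose mean is at most `ρ ^ n`, at the threshold `√(ρ ^ n)`. -/
lemma Polarizes.treeAvg_middle_le (h : Polarizes f g Z T) (n : ℕ) (s : S) :
    treeAvg f g n (ind fun s => contraction ^ n < Z s * T s) s ≤ √contraction ^ n := by
  have hc := pow_pos contraction_pos n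
  have hs : √(contraction ^ n) = √contraction ^ n := by
    have h2 : √contraction ^ n * √contraction ^ n = contraction ^ n := by
      rw [← mul_pow, Real.mul_self_sqrt contraction_pos.le]
    rw [← h2, Real.sqrt_mul_self (by positivity)]
  have h1 : ∀ s, ind (fun s => contraction ^ n < Z s * T s) s ≤
      √(Z s * T s) * (1 / √(contraction ^ n)) := by
    intro s
    unfold ind
    split_ifs with hlt
    · rw [mul_one_div, le_div_iff₀ (Real.sqrt_pos.2 hc), one_mul]
      exact Real.sqrt_le_sqrt hlt.le
    · positivity
  refine (treeAvg_mono f g n h1 s).trans ?_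
  rw [treeAvg_mul_const]
  have h3 : √(Z s * T s) ≤ 1 := by
    rw [Real.sqrt_le_one]
    nlinarith [h.sq_le s, sq_nonneg (Z s - T s), sq_nonneg (Z s), sq_nonneg (T s)]
  have h4 := h.treeAvg_sqrt_le n s
  rw [mul_one_div, div_le_iff₀ (Real.sqrt_pos.2 hc), ← hs, Real.mul_self_sqrt hc.le]
  exact h4.trans (mul_le_of_le_one_right hc.le h3)

/-! ### Coin tosses and doubly exponential decay -/

/-- The probability of fewer than `j` successes in `k` tosses of a fair coin. -/
def coinTail : ℕ → ℕ → ℝ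
  | _, 0 => 0
  | 0, _ + 1 => 1
  | k + 1, j + 1 => (coinTail k (j + 1) + coinTail k j) / 2

lemma coinTail_zero (k : ℕ) : coinTail k 0 = 0 := by cases k <;> rfl

lemma coinTail_nonneg (k j : ℕ) : 0 ≤ coinTail k j := by
  induction k generalizing j with
  | zero => cases j <;> simp [coinTail]
  | succ k ih =>
    cases j with
    | zero => simp [coinTail]
    | succ j => simp only [coinTail]; linarith [ih (j + 1), ih j]

/-- Chernoff's bound with the weight `exp (-2 t)` per success: one toss contributes `(1 + exp (-2
t)) / 2 = exp (-t) cosh t`, which is at most `exp (t ^ 2 / 2 - t)`. -/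
lemma coinTail_le_exp (k j : ℕ) {t : ℝ} (ht : 0 ≤ t) :
    coinTail k j ≤ Real.exp (k * (t ^ 2 / 2 - t) + 2 * t * j) := by
  induction k generalizing j with
  | zero =>
    cases j with
    | zero => simp [coinTail]
    | succ j => simp only [coinTail]; apply Real.one_le_exp; push_cast; rw [zero_mul, zero_add]; positivity
  | succ k ih =>
    cases j with
    | zero => rw [coinTail_zero]; positivity
    | succ j =>
      simp only [coinTail]
      have h1 := ih (j + 1)
      have h2 := ih j
      set E : ℝ := k * (t ^ 2 / 2 - t) + 2 * t * j with hE
      have e1 : (k : ℝ) * (t ^ 2 / 2 - t) + 2 * t * ((j + 1 : ℕ) : ℝ) = (E + t) + t := by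
        rw [hE]; push_cast; ring
      have e2 : ((k + 1 : ℕ) : ℝ) * (t ^ 2 / 2 - t) + 2 * t * ((j + 1 : ℕ) : ℝ) =
          (E + t) + t ^ 2 / 2 := by
        rw [hE]; push_cast; ring
      have e3 : E = (E + t) + -t := by ring
      rw [e1, Real.exp_add] at h1
      rw [e3, Real.exp_add] at h2
      rw [e2, Real.exp_add]
      have h3 := Real.cosh_le_exp_half_sq t
      rw [Real.cosh_eq] at h3
      nlinarith [mul_le_mul_of_nonneg_left h3 (Real.exp_pos (E + t)).le]

/-- A parameter that is squared by `g` and at most doubled by `f` is, after `k` steps, at least `j`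
of which are `g`, at most `2 ^ (-2 ^ j (L - k))` when it was at most `2 ^ (-L)`. -/
lemma Polarizes.treeAvg_squaring_le (h : Polarizes f g Z T) (k j : ℕ) {L : ℝ} {s : S}
    (hL : Z s ≤ (2 : ℝ) ^ (-L)) :
    treeAvg f g k (ind fun s => (2 : ℝ) ^ (-((2 : ℝ) ^ j * (L - k))) < Z s) s ≤ coinTail k j := by
  induction k generalizing j L s with
  | zero =>
    cases j with
    | zero => simp [treeAvg, ind, coinTail, not_lt.2 hL]
    | succ j => exact ind_le_one _ _
  | succ k ih =>
    -- In terms of the exponent `L`, a step `f` costs at most one unit and a step `g` doubles it.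
    have hf : Z (f s) ≤ (2 : ℝ) ^ (-(L - 1)) := by
      have h1 : Z (f s) ≤ 2 * Z s := by nlinarith [h.Z_le s, h.Z_nonneg s]
      have h2 : (2 : ℝ) ^ (-(L - 1)) = 2 * (2 : ℝ) ^ (-L) := by
        rw [show -(L - 1) = 1 + -L by ring, Real.rpow_add (by norm_num), Real.rpow_one]
      rw [h2]; linarith
    have hfk := ih (j := j) hf
    rw [show L - 1 - (k : ℝ) = L - ((k + 1 : ℕ) : ℝ) by push_cast; ring] at hfk
    cases j with
    | zero =>
      have hg : Z (g s) ≤ (2 : ℝ) ^ (-(L - 1)) := by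
        have h1 : Z (g s) ≤ Z s := by
          rw [h.Z_sq]; nlinarith [h.Z_le_one s, h.Z_nonneg s]
        refine (h1.trans hL).trans (Real.rpow_le_rpow_of_exponent_le (by norm_num) (by linarith))
      have hgk := ih (j := 0) hg
      rw [show L - 1 - (k : ℝ) = L - ((k + 1 : ℕ) : ℝ) by push_cast; ring] at hgk
      rw [coinTail_zero] at hfk hgk ⊢
      exact div_nonpos_of_nonpos_of_nonneg (add_nonpos hfk hgk) (by norm_num)
    | succ j =>
      have hg : Z (g s) ≤ (2 : ℝ) ^ (-(2 * L)) := by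
        rw [h.Z_sq]
        refine (pow_le_pow_left₀ (h.Z_nonneg s) hL 2).trans_eq ?_
        rw [← Real.rpow_natCast, ← Real.rpow_mul (by norm_num)]
        congr 1
        push_cast
        ring
      have hgk := ih (j := j) hg
      have hmono : treeAvg f g k
          (ind fun s => (2 : ℝ) ^ (-((2 : ℝ) ^ (j + 1) * (L - ((k + 1 : ℕ) : ℝ)))) < Z s) (g s) ≤
          treeAvg f g k (ind fun s => (2 : ℝ) ^ (-((2 : ℝ) ^ j * (2 * L - k))) < Z s) (g s) := by
        apply treeAvg_mono
        intro s'
        have hle : (2 : ℝ) ^ (-((2 : ℝ) ^ j * (2 * L - k))) ≤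
            (2 : ℝ) ^ (-((2 : ℝ) ^ (j + 1) * (L - ((k + 1 : ℕ) : ℝ)))) := by
          apply Real.rpow_le_rpow_of_exponent_le (by norm_num)
          have : (0 : ℝ) < 2 ^ j := by positivity
          push_cast
          rw [pow_succ]
          nlinarith [mul_nonneg this.le (Nat.cast_nonneg (α := ℝ) k)]
        exact ind_mono hle.trans_lt
      simp only [treeAvg, coinTail]
      linarith

/-- A single phase would be useless unless `L` exceeds the number of steps. A short first phase
makes the exponent large enough to survive the subtraction of `k₂` in a long second one. -/
lemma Polarizes.treeAvg_squaring_twice_le (h : Polarizes f g Z T) (k₁ k₂ j₁ j₂ : ℕ) {L M : ℝ}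
    {s : S} (hL : Z s ≤ (2 : ℝ) ^ (-L))
    (hM : M ≤ (2 : ℝ) ^ j₂ * ((2 : ℝ) ^ j₁ * (L - k₁) - k₂)) :
    treeAvg f g (k₁ + k₂) (ind fun s => (2 : ℝ) ^ (-M) < Z s) s ≤
      coinTail k₁ j₁ + coinTail k₂ j₂ := by
  refine (treeAvg_ind_steps_le f g k₁ k₂
    (P := fun s => (2 : ℝ) ^ (-((2 : ℝ) ^ j₁ * (L - k₁))) < Z s) (coinTail_nonneg k₂ j₂)
    (fun s' hs' => ?_) s).trans ?_
  · refine le_trans (treeAvg_mono f g k₂ (fun s'' => ?_) s')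
      (h.treeAvg_squaring_le k₂ j₂ (not_lt.1 hs'))
    have hle := Real.rpow_le_rpow_of_exponent_le (x := (2 : ℝ)) (by norm_num) (neg_le_neg hM)
    exact ind_mono hle.trans_lt
  · gcongr
    exact h.treeAvg_squaring_le k₁ j₁ hL

/-- If `ZT ≤ ρ ^ m`, the larger parameter is at least `1 / 2` by `Z + T ≥ 1`, so the smaller is at
most `2 ρ ^ m`. It then decays by squaring; when it is `T`, exchange the roles of `f` and `g`. -/
lemma Polarizes.treeAvg_unpolarized_le (h : Polarizes f g Z T) (m k₁ k₂ j₁ j₂ : ℕ) {L M : ℝ}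
    (s : S) (hL : 2 * contraction ^ m ≤ (2 : ℝ) ^ (-L))
    (hM : M ≤ (2 : ℝ) ^ j₂ * ((2 : ℝ) ^ j₁ * (L - k₁) - k₂)) :
    treeAvg f g (m + (k₁ + k₂)) (ind fun s => (2 : ℝ) ^ (-M) < Z s ∧ (2 : ℝ) ^ (-M) < T s) s ≤
      √contraction ^ m + (coinTail k₁ j₁ + coinTail k₂ j₂) := by
  refine (treeAvg_ind_steps_le f g m (k₁ + k₂)
    (P := fun s => contraction ^ m < Z s * T s)
    (add_nonneg (coinTail_nonneg k₁ j₁) (coinTail_nonneg k₂ j₂)) (fun s' hs' => ?_) s).trans ?_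
  · rw [not_lt] at hs'
    have h1 := h.one_le s'
    have hZ := h.Z_nonneg s'
    have hT := h.T_nonneg s'
    rcases le_total (Z s') (T s') with hle | hle
    · have : Z s' ≤ (2 : ℝ) ^ (-L) := by nlinarith
      refine le_trans (treeAvg_mono f g _ (fun s'' => ?_) s')
        (h.treeAvg_squaring_twice_le k₁ k₂ j₁ j₂ this hM)
      exact ind_mono And.left
    · have : T s' ≤ (2 : ℝ) ^ (-L) := by nlinarith
      refine le_trans (treeAvg_mono f g _ (fun s'' => ?_) s') ((treeAvg_comm f g _ _ s').trans_le
        (h.symm.treeAvg_squaring_twice_le k₁ k₂ j₁ j₂ this hM))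
      exact ind_mono And.right
  · gcongr
    exact h.treeAvg_middle_le m s

lemma eight_mul_le_two_pow {u : ℕ} (hu : 6 ≤ u) : 8 * (u + 1) ≤ 2 ^ u := by
  induction u, hu using Nat.le_induction with
  | base => norm_num
  | succ u hu ih => rw [pow_succ]; omega

/-- The fraction of the leaves that are not polarized up to `2 ^ (-(N ^ β + 2))` tends to `0`. -/
theorem Polarizes.tendsto_unpolarized (h : Polarizes f g Z T) (s : S) {β : ℝ} (hβ0 : 0 < β)
    (hβ : β < 1 / 2) :
    Tendsto (fun n : ℕ => treeAvg f g n (ind fun s =>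
      (2 : ℝ) ^ (-(((2 : ℝ) ^ n) ^ β + 2)) < Z s ∧ (2 : ℝ) ^ (-(((2 : ℝ) ^ n) ^ β + 2)) < T s) s)
      atTop (𝓝 0) := by
  -- With `q = ⌊√n⌋`, the first `r q` steps bring `ρ ^ m` below `4 ^ (-q)`, so that `L = 2 q - 1`.
  -- Another `q` steps, a quarter of them squarings, raise the exponent above `n`. The remaining `k₂
  -- = n - O(√n)` steps contain `α k₂` squarings, where `β < α < 1 / 2`.
  obtain ⟨r, hr⟩ := exists_pow_lt_of_lt_one (show (0 : ℝ) < 1 / 4 by norm_num) contraction_lt_one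
  set α : ℝ := (β + 1 / 2) / 2 with hα
  set t : ℝ := 1 - 2 * α with ht
  have ht0 : 0 < t := by rw [ht, hα]; linarith
  set q : ℕ → ℕ := Nat.sqrt with hq
  set k₂ : ℕ → ℕ := fun n => n - (r * q n + q n) with hk₂
  have hqt : Tendsto q atTop atTop := by
    refine tendsto_atTop.2 fun b => ?_
    filter_upwards [eventually_ge_atTop (b * b)] with n hn
    exact Nat.le_sqrt.2 hn
  have hqR : Tendsto (fun n => (q n : ℝ)) atTop atTop := tendsto_natCast_atTop_atTop.comp hqt
  have hqn : ∀ n, q n * q n ≤ n := Nat.sqrt_le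
  have hnq : ∀ n, n < (q n + 1) * (q n + 1) := Nat.lt_succ_sqrt
  have ev1 : ∀ᶠ n in atTop, r * q n + q n + q n ≤ n := by
    filter_upwards [hqt.eventually_ge_atTop (r + 2)] with n hn
    nlinarith [hqn n]
  have hk₂t : Tendsto (fun n => (k₂ n : ℝ)) atTop atTop := by
    refine tendsto_atTop_mono' atTop ?_ hqR
    filter_upwards [ev1] with n hn
    exact_mod_cast (show q n ≤ n - (r * q n + q n) by omega)
  have hbound : Tendsto (fun n => √contraction ^ (r * q n) + (Real.exp (-(q n / 8 : ℝ)) +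
      Real.exp (-(k₂ n * (t ^ 2 / 2))))) atTop (𝓝 (0 + (0 + 0))) := by
    refine Tendsto.add ?_ (Tendsto.add ?_ ?_)
    · have hr0 : r ≠ 0 := by rintro rfl; norm_num at hr
      have hs1 : √contraction < 1 := by
        rw [Real.sqrt_lt' one_pos]; simpa using contraction_lt_one
      refine (tendsto_pow_atTop_nhds_zero_of_lt_one (Real.sqrt_nonneg _) hs1).comp ?_
      exact Tendsto.const_mul_atTop' (Nat.pos_of_ne_zero hr0) hqt
    · exact Real.tendsto_exp_neg_atTop_nhds_zero.comp (hqR.atTop_div_const (by norm_num))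
    · exact Real.tendsto_exp_neg_atTop_nhds_zero.comp (hk₂t.atTop_mul_const (by positivity))
  rw [add_zero, add_zero] at hbound
  refine squeeze_zero' (Eventually.of_forall fun n => treeAvg_ind_nonneg f g n _ s) ?_ hbound
  have ev2 : ∀ᶠ n in atTop, (r : ℝ) + 4 ≤ (α - β) * q n :=
    (Tendsto.const_mul_atTop (by rw [hα]; linarith) hqR).eventually_ge_atTop _
  filter_upwards [ev1, ev2, hqt.eventually_ge_atTop 24] with n h1 h2 h3
  have hk : (k₂ n : ℝ) = n - (r * q n + q n) := by
    rw [hk₂]; push_cast [show r * q n + q n ≤ n by omega]; rfl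
  have hqn' : (q n : ℝ) * q n ≤ n := by exact_mod_cast hqn n
  have h3' : (24 : ℝ) ≤ q n := by exact_mod_cast h3
  have hr0 : (0 : ℝ) ≤ r := Nat.cast_nonneg r
  have hL : 2 * contraction ^ (r * q n) ≤ (2 : ℝ) ^ (-(2 * (q n : ℝ) - 1)) := by
    have e : (2 : ℝ) ^ (-(2 * (q n : ℝ) - 1)) = 2 * (1 / 4) ^ (q n) := by
      rw [show -(2 * (q n : ℝ) - 1) = 1 + (-2) * (q n : ℝ) by ring, Real.rpow_add (by norm_num),
        Real.rpow_one, Real.rpow_mul (by norm_num), Real.rpow_natCast]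
      norm_num
    rw [e, pow_mul]
    gcongr
    exact pow_nonneg contraction_pos.le _
  have hα0 : 0 < α := by rw [hα]; linarith
  have hα1 : α < 1 := by rw [hα]; linarith
  -- The `O(√n)` steps spent before the last phase, and the rounding, are paid for by the gap `(α -
  -- β) n`.
  have hj2 : (β * n + 2 : ℝ) ≤ (⌊α * k₂ n⌋₊ : ℝ) := by
    have hfl := Nat.lt_floor_add_one (α * (k₂ n : ℝ))
    rw [hk] at hfl ⊢
    have : (r + 4 : ℝ) * q n ≤ (α - β) * n := by
      calc (r + 4 : ℝ) * q n ≤ (α - β) * q n * q n := by gcongr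
        _ = (α - β) * (q n * q n) := by ring
        _ ≤ (α - β) * n := mul_le_mul_of_nonneg_left hqn' (by rw [hα]; linarith)
    have h5 : α * (r * q n + q n) ≤ 1 * (r * q n + q n) :=
      mul_le_mul_of_nonneg_right hα1.le (by positivity)
    nlinarith
  -- The factor `2 ^ ⌊α k₂⌋ ≥ 4 N ^ β` already exceeds the target, so the bracket only needs to be
  -- at least `1`.
  have hM : ((2 : ℝ) ^ n) ^ β + 2 ≤ (2 : ℝ) ^ ⌊α * k₂ n⌋₊ *
      ((2 : ℝ) ^ (q n / 4) * ((2 * (q n : ℝ) - 1) - q n) - k₂ n) := by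
    have hA : (1 : ℝ) ≤ (2 : ℝ) ^ (q n / 4) * ((2 * (q n : ℝ) - 1) - q n) - k₂ n := by
      have h6 := eight_mul_le_two_pow (u := q n / 4) (by omega)
      have h7 : 2 * (q n + 1) ≤ 2 ^ (q n / 4) := by omega
      have h7' : 2 * ((q n : ℝ) + 1) ≤ (2 : ℝ) ^ (q n / 4) := by exact_mod_cast h7
      have h8 : (n : ℝ) + 1 ≤ (q n + 1) * (q n + 1) := by exact_mod_cast hnq n
      have h9 : (0 : ℝ) ≤ r * q n := by positivity
      have h10 := mul_le_mul_of_nonneg_right h7' (show (0 : ℝ) ≤ (q n : ℝ) - 1 by linarith)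
      rw [hk]
      nlinarith
    have hB : ((2 : ℝ) ^ n) ^ β + 2 ≤ (2 : ℝ) ^ ⌊α * k₂ n⌋₊ := by
      rw [← Real.rpow_natCast 2 ⌊α * k₂ n⌋₊, ← Real.rpow_natCast 2 n, ← Real.rpow_mul (by norm_num)]
      refine le_trans ?_ (Real.rpow_le_rpow_of_exponent_le (by norm_num) hj2)
      rw [Real.rpow_add (by norm_num), mul_comm β]
      have : (1 : ℝ) ≤ (2 : ℝ) ^ ((n : ℝ) * β) := Real.one_le_rpow (by norm_num) (by positivity)
      norm_num
      linarith
    exact hB.trans (le_mul_of_one_le_right (by positivity) hA)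
  have key := h.treeAvg_unpolarized_le (r * q n) (q n) (k₂ n) (q n / 4) ⌊α * k₂ n⌋₊ s hL hM
  have hn : r * q n + (q n + k₂ n) = n := by simp only [hk₂]; omega
  rw [hn] at key
  refine key.trans ?_
  gcongr
  -- The exponent is at most `q (1/8 - 1/2) + q / 4 = -q / 8`.
  · refine (coinTail_le_exp (q n) (q n / 4) (t := 1 / 2) (by norm_num)).trans ?_
    apply Real.exp_le_exp.2
    have : ((q n / 4 : ℕ) : ℝ) ≤ q n / 4 := Nat.cast_div_le
    linarith
  -- The choice `t = 1 - 2 α` minimizes `t ^ 2 / 2 - t + 2 t α`, with value `-t ^ 2 / 2`.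
  · refine (coinTail_le_exp (k₂ n) _ ht0.le).trans ?_
    apply Real.exp_le_exp.2
    have h11 : (⌊α * k₂ n⌋₊ : ℝ) ≤ α * k₂ n := Nat.floor_le (by positivity)
    have h12 : 2 * t * (⌊α * k₂ n⌋₊ : ℝ) ≤ 2 * t * (α * k₂ n) :=
      mul_le_mul_of_nonneg_left h11 (by positivity)
    have h13 : 2 * t * (α * k₂ n) = t * (1 - t) * k₂ n := by rw [ht]; ring
    rw [h13] at h12
    nlinarith

end Tree

/-! ### Binary sources with side information -/

/-- The joint measure of a bit and of some side information. -/
structure SideSource : Type 1 where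
  Y : Type
  [fintypeY : Fintype Y]
  w : Y → ZMod 2 → ℝ
  nonneg : ∀ y b, 0 ≤ w y b
  total : ∑ y, (w y 0 + w y 1) = 1

attribute [instance] SideSource.fintypeY

namespace SideSource

/-- The sum of `φ (P(0, y)) (P(1, y))` over the values `y` of the side information. -/
def func (φ : ℝ → ℝ → ℝ) (S : SideSource) : ℝ := ∑ y, φ (S.w y 0) (S.w y 1)

lemma zmod_two_one_add_one : (1 + 1 : ZMod 2) = 0 := rfl

/-- The sum of two symbols, given both pieces of side information. -/
def minus (S : SideSource) : SideSource where
  Y := S.Y × S.Y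
  w y b := S.w y.1 b * S.w y.2 0 + S.w y.1 (b + 1) * S.w y.2 1
  nonneg y b := add_nonneg (mul_nonneg (S.nonneg _ _) (S.nonneg _ _))
    (mul_nonneg (S.nonneg _ _) (S.nonneg _ _))
  total := by
    rw [Fintype.sum_prod_type, ← one_mul (1 : ℝ), ← S.total, Finset.sum_mul_sum]
    refine Finset.sum_congr rfl fun y _ => Finset.sum_congr rfl fun y' _ => ?_
    rw [zmod_two_one_add_one, zero_add]
    ring

/-- The second symbol, given both pieces of side information and the sum of the symbols. -/
def plus (S : SideSource) : SideSource where
  Y := (S.Y × S.Y) × ZMod 2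
  w y b := S.w y.1.1 (y.2 + b) * S.w y.1.2 b
  nonneg y b := mul_nonneg (S.nonneg _ _) (S.nonneg _ _)
  total := by
    rw [Fintype.sum_prod_type, Fintype.sum_prod_type, ← one_mul (1 : ℝ), ← S.total,
      Finset.sum_mul_sum]
    refine Finset.sum_congr rfl fun y _ => Finset.sum_congr rfl fun y' _ => ?_
    rw [sum_zmod_two, zmod_two_one_add_one]
    simp only [zero_add, add_zero]
    ring

lemma func_minus (φ : ℝ → ℝ → ℝ) (S : SideSource) :
    S.minus.func φ = ∑ y, ∑ y', φ (S.w y 0 * S.w y' 0 + S.w y 1 * S.w y' 1)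
      (S.w y 1 * S.w y' 0 + S.w y 0 * S.w y' 1) := by
  unfold func
  exact Fintype.sum_prod_type _

lemma func_plus (φ : ℝ → ℝ → ℝ) (S : SideSource) :
    S.plus.func φ = ∑ y, ∑ y', (φ (S.w y 0 * S.w y' 0) (S.w y 1 * S.w y' 1) +
      φ (S.w y 1 * S.w y' 0) (S.w y 0 * S.w y' 1)) := by
  unfold func
  refine (Fintype.sum_prod_type _).trans ((Fintype.sum_prod_type _).trans ?_)
  refine Finset.sum_congr rfl fun y _ => Finset.sum_congr rfl fun y' _ => ?_
  exact sum_zmod_two _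

lemma sum_mass_mul (S : SideSource) (f : S.Y → ℝ) :
    ∑ y, ∑ y', (S.w y' 0 + S.w y' 1) * f y = ∑ y, f y := by
  refine Finset.sum_congr rfl fun y _ => ?_
  rw [← Finset.sum_mul, S.total, one_mul]

lemma sum_mass_mul' (S : SideSource) (f : S.Y → ℝ) :
    ∑ y, ∑ y', (S.w y 0 + S.w y 1) * f y' = ∑ y, f y := by
  rw [Finset.sum_comm]; exact S.sum_mass_mul f

end SideSource

/-! ### The Bhattacharyya parameter, the bias and the entropy -/

/-- The contribution of a pair of masses to the Bhattacharyya parameter. -/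
def bhat (s t : ℝ) : ℝ := 2 * √(s * t)

/-- The contribution of a pair of masses to the bias. -/
def bias (s t : ℝ) : ℝ := |s - t|

/-- The contribution of a pair of masses to the conditional entropy in bits. -/
def bits (s t : ℝ) : ℝ :=
  (Real.negMulLog s + Real.negMulLog t - Real.negMulLog (s + t)) / Real.log 2

lemma bhat_nonneg (s t : ℝ) : 0 ≤ bhat s t := by unfold bhat; positivity

lemma bhat_le {s t : ℝ} (hs : 0 ≤ s) (ht : 0 ≤ t) : bhat s t ≤ s + t := by
  unfold bhat
  have h := Real.sq_sqrt (mul_nonneg hs ht)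
  have h0 := Real.sqrt_nonneg (s * t)
  nlinarith [sq_nonneg (s - t)]

lemma bhat_plus {a b : ℝ} (ha : 0 ≤ a) (hb : 0 ≤ b) (c d : ℝ) :
    bhat (a * c) (b * d) + bhat (b * c) (a * d) = bhat a b * bhat c d := by
  unfold bhat
  rw [show a * c * (b * d) = (a * b) * (c * d) by ring,
    show b * c * (a * d) = (a * b) * (c * d) by ring, Real.sqrt_mul (mul_nonneg ha hb)]
  ring

/-- Compare squares: with `z₁`, `z₂` the two Bhattacharyya terms, the difference is `2 z₁ z₂ (a + b
- z₁) (c + d - z₂)`, and both brackets are nonnegative by `bhat_le`. -/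
lemma bhat_minus_le {a b c d : ℝ} (ha : 0 ≤ a) (hb : 0 ≤ b) (hc : 0 ≤ c) (hd : 0 ≤ d) :
    bhat (a * c + b * d) (b * c + a * d) ≤
      (c + d) * bhat a b + (a + b) * bhat c d - bhat a b * bhat c d := by
  have h1 := bhat_le ha hb
  have h2 := bhat_le hc hd
  have n1 := bhat_nonneg a b
  have n2 := bhat_nonneg c d
  have e1 : bhat a b ^ 2 = 4 * (a * b) := by
    unfold bhat; rw [mul_pow, Real.sq_sqrt (mul_nonneg ha hb)]; norm_num
  have e2 : bhat c d ^ 2 = 4 * (c * d) := by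
    unfold bhat; rw [mul_pow, Real.sq_sqrt (mul_nonneg hc hd)]; norm_num
  have e3 : bhat (a * c + b * d) (b * c + a * d) ^ 2 =
      4 * ((a * c + b * d) * (b * c + a * d)) := by
    unfold bhat; rw [mul_pow, Real.sq_sqrt (by positivity)]; norm_num
  set z₁ := bhat a b
  set z₂ := bhat c d
  have hR : 0 ≤ (c + d) * z₁ + (a + b) * z₂ - z₁ * z₂ := by nlinarith
  refine le_of_sq_le_sq ?_ hR
  rw [e3]
  have e4 : 4 * ((a * c + b * d) * (b * c + a * d)) =
      z₁ ^ 2 * (c + d) ^ 2 + z₂ ^ 2 * (a + b) ^ 2 - z₁ ^ 2 * z₂ ^ 2 := by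
    rw [e1, e2]; ring
  rw [e4]
  have := mul_nonneg (mul_nonneg n1 n2) (mul_nonneg (sub_nonneg.2 h1) (sub_nonneg.2 h2))
  nlinarith

lemma bias_minus (a b c d : ℝ) :
    bias (a * c + b * d) (b * c + a * d) = bias a b * bias c d := by
  unfold bias
  rw [← abs_mul]
  ring_nf

lemma bias_plus_le {a b c d : ℝ} (ha : 0 ≤ a) (hb : 0 ≤ b) (hc : 0 ≤ c) (hd : 0 ≤ d) :
    bias (a * c) (b * d) + bias (b * c) (a * d) ≤
      (c + d) * bias a b + (a + b) * bias c d - bias a b * bias c d := by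
  unfold bias
  have hac := mul_nonneg ha hc
  have had := mul_nonneg ha hd
  have hbc := mul_nonneg hb hc
  have hbd := mul_nonneg hb hd
  rcases abs_cases (a - b) with ⟨e1, h1⟩ | ⟨e1, h1⟩ <;>
  rcases abs_cases (c - d) with ⟨e2, h2⟩ | ⟨e2, h2⟩ <;>
  rcases abs_cases (a * c - b * d) with ⟨e3, h3⟩ | ⟨e3, h3⟩ <;>
  rcases abs_cases (b * c - a * d) with ⟨e4, h4⟩ | ⟨e4, h4⟩ <;>
  rw [e1, e2, e3, e4] <;> nlinarith

lemma le_bhat_add_bias {s t : ℝ} (hs : 0 ≤ s) (ht : 0 ≤ t) : s + t ≤ bhat s t + bias s t := by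
  unfold bhat bias
  rcases le_total s t with h | h
  · have : s ≤ √(s * t) := Real.le_sqrt_of_sq_le (by nlinarith)
    rw [abs_of_nonpos (by linarith)]; linarith
  · have : t ≤ √(s * t) := Real.le_sqrt_of_sq_le (by nlinarith)
    rw [abs_of_nonneg (by linarith)]; linarith

lemma bhat_sq_add_bias_sq {s t : ℝ} (hs : 0 ≤ s) (ht : 0 ≤ t) :
    bhat s t ^ 2 + bias s t ^ 2 = (s + t) ^ 2 := by
  unfold bhat bias
  rw [mul_pow, Real.sq_sqrt (mul_nonneg hs ht), sq_abs]
  ring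

/-- The chain rule: the pair (sum, second symbol) carries the same information as the pair of
symbols. -/
lemma bits_conservation (a b c d : ℝ) :
    bits (a * c + b * d) (b * c + a * d) + (bits (a * c) (b * d) + bits (b * c) (a * d)) =
      (c + d) * bits a b + (a + b) * bits c d := by
  unfold bits
  rw [show a * c + b * d + (b * c + a * d) = (a + b) * (c + d) by ring]
  simp only [Real.negMulLog_mul]
  ring

/-- Write the logarithm of `(s + t) / s` as twice that of its square root and use `log y ≤ y - 1`,
then `√(s + t) ≤ √s + √t`. -/
lemma negMulLog_sub_le_sqrt {s t : ℝ} (hs : 0 ≤ s) (ht : 0 ≤ t) :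
    Real.negMulLog s + s * Real.log (s + t) ≤ 2 * √(s * t) := by
  rcases hs.eq_or_lt with rfl | hs'
  · simp
  have hm : 0 < s + t := by linarith
  have h1 : Real.negMulLog s + s * Real.log (s + t) = s * (2 * Real.log (√(s + t) / √s)) := by
    rw [Real.log_div (by positivity) (by positivity), Real.log_sqrt hm.le, Real.log_sqrt hs,
      Real.negMulLog]
    ring
  have h2 := Real.log_le_sub_one_of_pos (show 0 < √(s + t) / √s by positivity)
  have hss := Real.mul_self_sqrt hs
  have h3 : √(s + t) ≤ √s + √t := by
    rw [Real.sqrt_le_left (by positivity)]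
    nlinarith [Real.mul_self_sqrt ht, Real.sqrt_nonneg s, Real.sqrt_nonneg t,
      mul_nonneg (Real.sqrt_nonneg s) (Real.sqrt_nonneg t)]
  have h4 : s * (√(s + t) / √s) = √s * √(s + t) := by
    field_simp
    nlinarith
  rw [h1, Real.sqrt_mul hs]
  nlinarith [mul_le_mul_of_nonneg_left h2 hs, mul_le_mul_of_nonneg_left h3 (Real.sqrt_nonneg s)]

/-- The factor `3` works because `4 / log 2 < 6`. -/
lemma bits_le_bhat {s t : ℝ} (hs : 0 ≤ s) (ht : 0 ≤ t) : bits s t ≤ 3 * bhat s t := by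
  have h1 := negMulLog_sub_le_sqrt hs ht
  have h2 := negMulLog_sub_le_sqrt ht hs
  have h3 := Real.log_two_gt_d9
  have h4 := bhat_nonneg s t
  unfold bits
  rw [div_le_iff₀ (by linarith)]
  have h5 : Real.negMulLog (s + t) = -(s * Real.log (s + t)) - t * Real.log (s + t) := by
    rw [Real.negMulLog]; ring
  rw [mul_comm t s, add_comm t s] at h2
  have h6 : 4 * √(s * t) ≤ 3 * bhat s t * Real.log 2 := by
    have : bhat s t = 2 * √(s * t) := rfl
    rw [this]
    nlinarith [Real.sqrt_nonneg (s * t)]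
  linarith

/-- The entropy of a pair of masses in terms of the total mass `m` and of the ratio
`x = 2 s / m`. -/
lemma bits_eq (m x : ℝ) :
    bits (m / 2 * x) (m / 2 * (2 - x)) * Real.log 2 =
      m * Real.log 2 + m / 2 * (Real.negMulLog x + Real.negMulLog (2 - x)) := by
  have h0 : Real.log 2 ≠ 0 := (Real.log_pos (by norm_num)).ne'
  unfold bits
  rw [div_mul_cancel₀ _ h0, show m / 2 * x + m / 2 * (2 - x) = m by ring, Real.negMulLog_mul,
    Real.negMulLog_mul, div_eq_mul_inv, Real.negMulLog_mul]
  have h1 : Real.negMulLog (2⁻¹ : ℝ) = Real.log 2 / 2 := by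
    rw [Real.negMulLog, Real.log_inv]; ring
  rw [h1]
  ring

lemma exists_ratio {s t : ℝ} (hs : 0 ≤ s) (ht : 0 ≤ t) : ∃ m x : ℝ, 0 ≤ m ∧ 0 ≤ x ∧ x ≤ 2 ∧
    s = m / 2 * x ∧ t = m / 2 * (2 - x) := by
  rcases (add_nonneg hs ht).eq_or_lt with h | h
  · refine ⟨0, 0, le_rfl, le_rfl, by norm_num, ?_, ?_⟩ <;> linarith
  · refine ⟨s + t, 2 * s / (s + t), h.le, by positivity, ?_, ?_, ?_⟩
    · rw [div_le_iff₀ h]; linarith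
    · field_simp
    · field_simp; ring

/-- `negMulLog (2 - x)` lies above its chord between `1` and `2`, and `negMulLog x` is nonnegative.
This is the bound of binary entropy from below by twice the smaller probability. -/
lemma negMulLog_pair_ge {x : ℝ} (h0 : 0 ≤ x) (h1 : x ≤ 1) :
    -(2 * (1 - x) * Real.log 2) ≤ Real.negMulLog x + Real.negMulLog (2 - x) := by
  have hc := Real.concaveOn_negMulLog.2 (show (1 : ℝ) ∈ Set.Ici 0 by simp)
    (show (2 : ℝ) ∈ Set.Ici 0 by simp) h0 (sub_nonneg.2 h1) (by ring)
  simp only [smul_eq_mul, Real.negMulLog_one, mul_zero, zero_add] at hc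
  rw [show x * 1 + (1 - x) * 2 = 2 - x by ring] at hc
  have h2 := Real.negMulLog_nonneg h0 h1
  have h3 : Real.negMulLog 2 = -(2 * Real.log 2) := by rw [Real.negMulLog]; ring
  rw [h3] at hc
  linarith

lemma mass_le_bits_add_bias {s t : ℝ} (hs : 0 ≤ s) (ht : 0 ≤ t) :
    s + t ≤ bits s t + bias s t := by
  obtain ⟨m, x, hm, hx0, hx2, rfl, rfl⟩ := exists_ratio hs ht
  have hl := Real.log_pos (show (1 : ℝ) < 2 by norm_num)
  have he := bits_eq m x
  have hb : bias (m / 2 * x) (m / 2 * (2 - x)) = m * |x - 1| := by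
    unfold bias
    rw [show m / 2 * x - m / 2 * (2 - x) = m * (x - 1) by ring, abs_mul, abs_of_nonneg hm]
  rw [hb]
  refine le_of_mul_le_mul_right ?_ hl
  rw [add_mul (bits _ _), he]
  rcases le_total x 1 with h | h
  · have := negMulLog_pair_ge hx0 h
    rw [abs_of_nonpos (by linarith)]
    nlinarith [mul_le_mul_of_nonneg_left this hm]
  · have := negMulLog_pair_ge (x := 2 - x) (by linarith) (by linarith)
    rw [show 2 - (2 - x) = x by ring] at this
    rw [abs_of_nonneg (by linarith)]
    nlinarith [mul_le_mul_of_nonneg_left this hm]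

/-- From `log √x ≥ 1 - 1 / √x` one gets the bound with `(√x - 1) ^ 2` in place of `(x - 1) ^ 2 / 6`;
the ratio `(√x + 1) ^ 2` is below `6` on `[0, 2]`. -/
lemma negMulLog_le_of_le_two {x : ℝ} (h0 : 0 ≤ x) (h2 : x ≤ 2) :
    Real.negMulLog x ≤ 1 - x - (x - 1) ^ 2 / 6 := by
  rcases h0.eq_or_lt with rfl | hx
  · norm_num
  have hs : 0 < √x := Real.sqrt_pos.2 hx
  have hss := Real.mul_self_sqrt h0
  have h3 := Real.one_sub_inv_le_log_of_pos hs
  have h4 : Real.log (√x) = Real.log x / 2 := Real.log_sqrt h0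
  have h5 : x * (√x)⁻¹ = √x := by field_simp; nlinarith
  have h6 : Real.negMulLog x ≤ 1 - x - (√x - 1) ^ 2 := by
    rw [Real.negMulLog]
    nlinarith [mul_le_mul_of_nonneg_left h3 h0]
  have h7 : √x ≤ 1.42 := by
    rw [Real.sqrt_le_left (by norm_num)]; norm_num; linarith
  have h8 : (x - 1) ^ 2 = (√x - 1) ^ 2 * (√x + 1) ^ 2 := by
    rw [← mul_pow]; congr 1; nlinarith
  have h9 : (√x + 1) ^ 2 ≤ 6 := by nlinarith
  nlinarith [mul_le_mul_of_nonneg_left h9 (sq_nonneg (√x - 1))]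

/-- The quadratic bound `bias ^ 2 / m ≤ 6 (m - bits)`, `m = s + t`, with its left side replaced by
the tangent `2 τ bias - τ ^ 2 m`. In this linear form it can be summed over the side information,
and `τ = T` then gives `bias_sq_le` without Jensen's inequality. -/
lemma bits_add_bias_le {s t : ℝ} (hs : 0 ≤ s) (ht : 0 ≤ t) (τ : ℝ) :
    6 * bits s t + (2 * τ * bias s t - τ ^ 2 * (s + t)) ≤ 6 * (s + t) := by
  obtain ⟨m, x, hm, hx0, hx2, rfl, rfl⟩ := exists_ratio hs ht
  have hl := Real.log_pos (show (1 : ℝ) < 2 by norm_num)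
  have hl1 := Real.log_two_lt_d9
  have he := bits_eq m x
  have hb : bias (m / 2 * x) (m / 2 * (2 - x)) = m * |x - 1| := by
    unfold bias
    rw [show m / 2 * x - m / 2 * (2 - x) = m * (x - 1) by ring, abs_mul, abs_of_nonneg hm]
  have h1 := negMulLog_le_of_le_two hx0 hx2
  have h2 := negMulLog_le_of_le_two (x := 2 - x) (by linarith) (by linarith)
  have h3 : Real.negMulLog x + Real.negMulLog (2 - x) ≤ -((x - 1) ^ 2 / 3) := by nlinarith
  have h4 : m * ((x - 1) ^ 2 / 6) ≤
      (m - bits (m / 2 * x) (m / 2 * (2 - x))) * Real.log 2 := by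
    nlinarith [mul_le_mul_of_nonneg_left h3 hm]
  have h5 : 0 ≤ m - bits (m / 2 * x) (m / 2 * (2 - x)) := by
    by_contra hneg
    push Not at hneg
    have : 0 ≤ m * ((x - 1) ^ 2 / 6) := by positivity
    nlinarith
  -- The factor `log 2 < 1` may be dropped because the difference is nonnegative.
  have h6 : m * ((x - 1) ^ 2 / 6) ≤ m - bits (m / 2 * x) (m / 2 * (2 - x)) := by nlinarith
  rw [hb, show m / 2 * x + m / 2 * (2 - x) = m by ring]
  have h7 : 0 ≤ m * (|x - 1| - τ) ^ 2 := by positivity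
  have h8 : |x - 1| ^ 2 = (x - 1) ^ 2 := sq_abs _
  nlinarith

namespace SideSource

lemma polarizes : Polarizes minus plus (func bhat) (func bias) where
  Z_nonneg S := Finset.sum_nonneg fun _ _ => bhat_nonneg _ _
  T_nonneg S := Finset.sum_nonneg fun _ _ => abs_nonneg _
  Z_sq S := by
    rw [func_plus, sq, func, Finset.sum_mul_sum]
    exact Finset.sum_congr rfl fun y _ => Finset.sum_congr rfl fun y' _ =>
      bhat_plus (S.nonneg _ _) (S.nonneg _ _) _ _
  Z_le S := by
    rw [func_minus]
    refine (Finset.sum_le_sum fun y _ => Finset.sum_le_sum fun y' _ =>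
      bhat_minus_le (S.nonneg _ _) (S.nonneg _ _) (S.nonneg _ _) (S.nonneg _ _)).trans_eq ?_
    simp only [Finset.sum_sub_distrib, Finset.sum_add_distrib]
    rw [sum_mass_mul S fun y => bhat (S.w y 0) (S.w y 1),
      sum_mass_mul' S fun y => bhat (S.w y 0) (S.w y 1), ← Finset.sum_mul_sum]
    unfold func
    ring
  T_sq S := by
    rw [func_minus, sq, func, Finset.sum_mul_sum]
    exact Finset.sum_congr rfl fun y _ => Finset.sum_congr rfl fun y' _ => bias_minus _ _ _ _
  T_le S := by
    rw [func_plus]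
    refine (Finset.sum_le_sum fun y _ => Finset.sum_le_sum fun y' _ =>
      bias_plus_le (S.nonneg _ _) (S.nonneg _ _) (S.nonneg _ _) (S.nonneg _ _)).trans_eq ?_
    simp only [Finset.sum_sub_distrib, Finset.sum_add_distrib]
    rw [sum_mass_mul S fun y => bias (S.w y 0) (S.w y 1),
      sum_mass_mul' S fun y => bias (S.w y 0) (S.w y 1), ← Finset.sum_mul_sum]
    unfold func
    ring
  one_le S := by
    rw [← S.total, func, func, ← Finset.sum_add_distrib]
    exact Finset.sum_le_sum fun y _ => le_bhat_add_bias (S.nonneg _ _) (S.nonneg _ _)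
  sq_le S := by
    set z := S.func bhat with hz
    set t := S.func bias with ht
    -- The vector `(z, t)` is a sum of plane vectors whose lengths are the masses of the values `y`.
    -- Pairing each with `(z, t)` by Cauchy–Schwarz bounds its squared length by its length.
    have h1 : z ^ 2 + t ^ 2 ≤ √(z ^ 2 + t ^ 2) := by
      have e : z ^ 2 + t ^ 2 =
          ∑ y, (z * bhat (S.w y 0) (S.w y 1) + t * bias (S.w y 0) (S.w y 1)) := by
        rw [Finset.sum_add_distrib, ← Finset.mul_sum, ← Finset.mul_sum, sq, sq]
        rfl
      rw [e, ← mul_one (√_), ← S.total, Finset.mul_sum]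
      refine Finset.sum_le_sum fun y _ => ?_
      rw [← e]
      refine le_of_sq_le_sq ?_ (mul_nonneg (Real.sqrt_nonneg _)
        (add_nonneg (S.nonneg _ _) (S.nonneg _ _)))
      rw [mul_pow, Real.sq_sqrt (by positivity), ← bhat_sq_add_bias_sq (S.nonneg _ _) (S.nonneg _ _)]
      nlinarith [sq_nonneg (z * bias (S.w y 0) (S.w y 1) - t * bhat (S.w y 0) (S.w y 1))]
    have h2 := Real.sq_sqrt (show 0 ≤ z ^ 2 + t ^ 2 by positivity)
    have h3 := Real.sqrt_nonneg (z ^ 2 + t ^ 2)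
    nlinarith

lemma bits_conserved (S : SideSource) :
    S.minus.func bits + S.plus.func bits = 2 * S.func bits := by
  rw [func_minus, func_plus, ← Finset.sum_add_distrib]
  simp only [← Finset.sum_add_distrib, bits_conservation]
  simp only [Finset.sum_add_distrib]
  rw [sum_mass_mul S fun y => bits (S.w y 0) (S.w y 1),
      sum_mass_mul' S fun y => bits (S.w y 0) (S.w y 1)]
  unfold func
  ring

/-- Entropy is a martingale along the tree. -/
lemma treeAvg_bits (n : ℕ) (S : SideSource) :
    treeAvg minus plus n (func bits) S = S.func bits := by
  induction n generalizing S with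
  | zero => rfl
  | succ n ih =>
    simp only [treeAvg, ih, bits_conserved]
    ring

lemma bits_le (S : SideSource) : S.func bits ≤ 3 * S.func bhat := by
  rw [func, func, Finset.mul_sum]
  exact Finset.sum_le_sum fun y _ => bits_le_bhat (S.nonneg _ _) (S.nonneg _ _)

lemma one_sub_bias_le (S : SideSource) : 1 - S.func bias ≤ S.func bits := by
  rw [sub_le_iff_le_add, ← S.total, func, func, ← Finset.sum_add_distrib]
  exact Finset.sum_le_sum fun y _ => mass_le_bits_add_bias (S.nonneg _ _) (S.nonneg _ _)

lemma bias_sq_le (S : SideSource) : S.func bias ^ 2 ≤ 6 * (1 - S.func bits) := by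
  set τ := S.func bias with hτ
  have h : ∑ y, (6 * bits (S.w y 0) (S.w y 1) + (2 * τ * bias (S.w y 0) (S.w y 1) -
      τ ^ 2 * (S.w y 0 + S.w y 1))) ≤ ∑ y, 6 * (S.w y 0 + S.w y 1) :=
    Finset.sum_le_sum fun y _ => bits_add_bias_le (S.nonneg _ _) (S.nonneg _ _) τ
  rw [Finset.sum_add_distrib, Finset.sum_sub_distrib, ← Finset.mul_sum, ← Finset.mul_sum,
    ← Finset.mul_sum, ← Finset.mul_sum, S.total] at h
  change 6 * S.func bits + (2 * τ * τ - τ ^ 2 * 1) ≤ 6 * 1 at h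
  nlinarith

/-! ### The sources at the leaves -/

/-- The source that the index `i` reaches after `n` polarization steps. -/
def leaf : (n : ℕ) → SideSource → Fin (2 ^ n) → SideSource
  | 0, S => fun _ => S
  | n + 1, S => glue (leaf n S.minus) (leaf n S.plus)

lemma sum_leaf (n : ℕ) (S : SideSource) (F : SideSource → ℝ) :
    ∑ i, F (leaf n S i) = 2 ^ n * treeAvg minus plus n F S := by
  induction n generalizing S with
  | zero => simp [leaf, treeAvg]
  | succ n ih =>
    rw [sum_half]
    simp only [leaf, glue_lo, glue_hi, treeAvg, ih]
    ring

lemma two_pow_succ_sub {n : ℕ} (i : Fin (2 ^ n)) :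
    (2 : ℝ) ^ (2 ^ (n + 1) - i.val) = 2 ^ (2 ^ n) * 2 ^ (2 ^ n - i.val) := by
  rw [← pow_add]
  congr 1
  have := i.isLt
  rw [pow_succ]
  omega

lemma sum_fun_prod {ι A B M : Type*} [Fintype ι] [DecidableEq ι] [Fintype A] [Fintype B]
    [AddCommMonoid M] (F : (ι → A × B) → M) :
    ∑ y, F y = ∑ y₁ : ι → A, ∑ y₂ : ι → B, F fun k => (y₁ k, y₂ k) := by
  rw [← (Equiv.arrowProdEquivProdArrow ι (fun _ => A) (fun _ => B)).symm.sum_comp,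
    Fintype.sum_prod_type]
  rfl

lemma sum_minus {ι M : Type*} [Fintype ι] [DecidableEq ι] [AddCommMonoid M] (S : SideSource)
    (F : (ι → S.minus.Y) → M) :
    ∑ y, F y = ∑ y₁ : ι → S.Y, ∑ y₂ : ι → S.Y, F fun k => (y₁ k, y₂ k) :=
  sum_fun_prod (A := S.Y) (B := S.Y) F

lemma sum_plus {ι M : Type*} [Fintype ι] [DecidableEq ι] [AddCommMonoid M] (S : SideSource)
    (F : (ι → S.plus.Y) → M) :
    ∑ y, F y = ∑ y₁ : ι → S.Y, ∑ y₂ : ι → S.Y, ∑ u : ι → ZMod 2, F fun k => ((y₁ k, y₂ k), u k) :=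
  (sum_fun_prod (A := S.Y × S.Y) (B := ZMod 2) F).trans (sum_fun_prod (A := S.Y) (B := S.Y) _)

/-- The functionals of the source at the leaf `i` in terms of the transformed bits. -/
lemma func_leaf (φ : ℝ → ℝ → ℝ) (n : ℕ) (S : SideSource) (i : Fin (2 ^ n)) :
    (leaf n S i).func φ = (∑ y : Fin (2 ^ n) → S.Y, ∑ a : Fin (2 ^ n) → ZMod 2,
      φ (past (fun k => S.w (y k)) i a 0) (past (fun k => S.w (y k)) i a 1)) /
        2 ^ (2 ^ n - i.val) := by
  induction n generalizing S with
  | zero =>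
    have hi : i = 0 := Subsingleton.elim (α := Fin 1) _ _
    subst hi
    simp only [past_zero, leaf, func, Finset.sum_const, Finset.card_univ, Fintype.card_fun,
      ZMod.card, Fintype.card_fin, nsmul_eq_mul, ← Finset.mul_sum]
    have h := (Equiv.funUnique (Fin 1) S.Y).symm.sum_comp
      (fun y : Fin 1 → S.Y => φ (S.w (y 0) 0) (S.w (y 0) 1))
    have h2 : ∑ y : Fin (2 ^ 0) → S.Y, φ (S.w (y 0) 0) (S.w (y 0) 1) =
        ∑ y, φ (S.w y 0) (S.w y 1) := h.symm
    rw [h2]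
    simp
    rfl
  | succ n ih =>
    rcases lo_or_hi i with ⟨j, rfl⟩ | ⟨j, rfl⟩
    · simp only [leaf, glue_lo, ih, past_lo, lo_val, two_pow_succ_sub]
      rw [sum_glue (α := S.Y), sum_minus]
      have e : ∀ y z : Fin (2 ^ n) → S.Y,
          minusW (fun k => S.w (glue y z k)) = fun k => S.minus.w (y k, z k) := by
        intro y z; funext k b; simp [minusW, minus]
      -- The second half of `a` plays no role and contributes a factor `2 ^ 2 ^ n`, which cancels
      -- against the larger denominator. Summing over complete words `a` avoids index types that
      -- depend on `i`.
      simp only [e, sum_glue (α := ZMod 2), glue_lo, Finset.sum_const, Finset.card_univ,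
        Fintype.card_fun, ZMod.card, Fintype.card_fin, nsmul_eq_mul, ← Finset.mul_sum]
      push_cast
      rw [mul_div_mul_left _ _ (by positivity)]
    · simp only [leaf, glue_hi, ih, past_hi, hi_val]
      have e2 : 2 ^ (n + 1) - (2 ^ n + j.val) = 2 ^ n - j.val := by rw [pow_succ]; omega
      rw [e2]
      congr 1
      rw [sum_glue (α := S.Y), sum_plus]
      have e : ∀ (y z : Fin (2 ^ n) → S.Y) (u : Fin (2 ^ n) → ZMod 2),
          plusW (fun k => S.w (glue y z k)) u = fun k => S.plus.w ((y k, z k), u k) := by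
        intro y z u; funext k b; simp [plusW, plus]
      simp only [e, sum_glue (α := ZMod 2), glue_lo, glue_hi]
      refine Finset.sum_congr rfl fun y _ => Finset.sum_congr rfl fun z _ => ?_
      -- The first half of `a` enters only through its transform, which runs through all words
      -- exactly once.
      exact (polarEquiv n).symm.sum_comp (fun u : Fin (2 ^ n) → ZMod 2 =>
        ∑ a, φ (past (fun k => S.plus.w ((y k, z k), u k)) j a 0)
          (past (fun k => S.plus.w ((y k, z k), u k)) j a 1)) |>.symm

end SideSource

/-! ### Laws of random variables -/

section Law

variable {α β γ : Type*} [Fintype α]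

lemma lawOf_eq [DecidableEq β] (q : α → ℝ) (f : α → β) (b : β) :
    lawOf q f b = ∑ a, if f a = b then q a else 0 := by
  rw [lawOf, Finset.sum_filter]

lemma sum_mul_comp [Fintype β] [DecidableEq β] (q : α → ℝ) (f : α → β) (G : β → ℝ) :
    ∑ a, q a * G (f a) = ∑ b, lawOf q f b * G b := by
  simp only [lawOf_eq, Finset.sum_mul]
  rw [Finset.sum_comm]
  refine Finset.sum_congr rfl fun a _ => ?_
  simp

lemma lawOf_comp [Fintype β] [DecidableEq β] [DecidableEq γ] (q : α → ℝ) (f : α → β) (g : β → γ)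
    (c : γ) : lawOf q (fun a => g (f a)) c = ∑ b with g b = c, lawOf q f b := by
  have := sum_mul_comp q f (fun b => if g b = c then 1 else 0)
  rw [lawOf_eq, Finset.sum_filter]
  simpa using this

lemma lawOf_nonneg [DecidableEq β] {q : α → ℝ} (hq : ∀ a, 0 ≤ q a) (f : α → β) (b : β) :
    0 ≤ lawOf q f b := Finset.sum_nonneg fun a _ => hq a

/-- The total variation does not increase under coarsening. -/
lemma sum_abs_lawOf_comp_le [Fintype β] [DecidableEq β] [Fintype γ] [DecidableEq γ] (q : α → ℝ)
    (f : α → β) (g : β → γ) : ∑ c, |lawOf q (fun a => g (f a)) c| ≤ ∑ b, |lawOf q f b| := by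
  simp only [lawOf_comp]
  refine (Finset.sum_le_sum fun c _ => Finset.abs_sum_le_sum_abs _ _).trans_eq ?_
  exact Finset.sum_fiberwise _ _ _

/-- The sign `(-1) ^ b` of a bit. -/
def sign (b : ZMod 2) : ℝ := if b = 0 then 1 else -1

/-- The bias of a bit given `f` is the total variation of the signed law of `f`. Hence it does not
increase when `f` is coarsened. -/
lemma lawOf_sign [DecidableEq β] (q : α → ℝ) (f : α → β) (g : α → ZMod 2) (b : β) :
    lawOf (fun a => q a * sign (g a)) f b =
      lawOf q (fun a => (f a, g a)) (b, 0) - lawOf q (fun a => (f a, g a)) (b, 1) := by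
  simp only [lawOf_eq, ← Finset.sum_sub_distrib]
  refine Finset.sum_congr rfl fun a _ => ?_
  have h : g a = 0 ∨ g a = 1 := by
    generalize g a = x
    revert x
    decide
  by_cases hb : f a = b <;> rcases h with h | h <;> simp [hb, h, sign]

/-- Functions on `insert a s` are pairs of a value at `a` and a function on `s`. -/
def insertFunEquiv {N : ℕ} {a : Fin N} {s : Finset (Fin N)} (ha : a ∉ s) :
    (↥(insert a s) → ZMod 2) ≃ (s → ZMod 2) × ZMod 2 where
  toFun m := (fun i : s => m ⟨i.1, Finset.mem_insert_of_mem i.2⟩, m ⟨a, Finset.mem_insert_self a s⟩)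
  invFun m i := if h : i.1 ∈ s then m.1 ⟨i.1, h⟩ else m.2
  left_inv m := by
    funext ⟨i, hi⟩
    rcases Finset.mem_insert.1 hi with rfl | h
    · simp [ha]
    · simp [h]
  right_inv m := by
    ext
    · simp
    · simp [ha]

lemma lawOf_injective [DecidableEq β] [DecidableEq γ] (q : α → ℝ) (f : α → β) {e : β → γ}
    (he : Function.Injective e) (b : β) : lawOf q (fun a => e (f a)) (e b) = lawOf q f b := by
  simp only [lawOf_eq, he.eq_iff]

lemma lawOf_fst [DecidableEq β] (q : α → ℝ) (f : α → β) (g : α → ZMod 2) (b : β) :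
    lawOf q f b =
      lawOf q (fun a => (f a, g a)) (b, 0) + lawOf q (fun a => (f a, g a)) (b, 1) := by
  simp only [lawOf_eq, ← Finset.sum_add_distrib]
  refine Finset.sum_congr rfl fun a _ => ?_
  have h : g a = 0 ∨ g a = 1 := by
    generalize g a = x
    revert x
    decide
  by_cases hb : f a = b <;> rcases h with h | h <;> simp [hb, h]

/-- The chain step for uniformity: splitting an atom of ideal mass `c` costs the bias of the new bit
plus the error already present in the old atom. -/
lemma abs_sub_half_add_le (p₀ p₁ c : ℝ) :
    |p₀ - c / 2| + |p₁ - c / 2| ≤ |p₀ - p₁| + |p₀ + p₁ - c| := by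
  have h1 : p₀ - c / 2 = ((p₀ - p₁) + (p₀ + p₁ - c)) / 2 := by ring
  have h2 : p₁ - c / 2 = (-(p₀ - p₁) + (p₀ + p₁ - c)) / 2 := by ring
  rw [h1, h2, abs_div, abs_div, abs_of_pos (show (0 : ℝ) < 2 by norm_num)]
  have h3 := abs_add_le (p₀ - p₁) (p₀ + p₁ - c)
  have h4 := abs_add_le (-(p₀ - p₁)) (p₀ + p₁ - c)
  rw [abs_neg] at h4
  linarith

/-- The distance to uniformity of the bits `A_i`, `i ∈ V`, is at most the sum of the average biases
of these bits given the preceding ones. -/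
lemma sum_abs_lawOf_sub_le {N : ℕ} {q : α → ℝ} (hq : ∑ a, q a = 1) (A : α → Fin N → ZMod 2)
    (V : Finset (Fin N)) :
    ∑ m : V → ZMod 2, |lawOf q (fun a (i : V) => A a i) m - 1 / 2 ^ #V| ≤
      ∑ i ∈ V, ∑ z : {j // j < i} → ZMod 2,
        |lawOf q (fun a => ((fun j : {j // j < i} => A a j), A a i)) (z, 0) -
          lawOf q (fun a => ((fun j : {j // j < i} => A a j), A a i)) (z, 1)| := by
  -- Adding the largest index last ensures that the bits already treated are among the predecessors
  -- of the new one.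
  induction V using Finset.induction_on_max with
  | empty =>
    rw [Finset.sum_empty]
    refine (Finset.sum_eq_zero fun m _ => ?_).le
    have h : ∀ a, (fun i : ↥(∅ : Finset (Fin N)) => A a i) = m := fun a => by
      funext i; exact absurd i.2 (Finset.notMem_empty _)
    simp [lawOf_eq, h, hq]
  | insert i s hi ih =>
    have his : i ∉ s := fun h => (hi i h).false
    rw [Finset.sum_insert his, ← (insertFunEquiv his).symm.sum_comp, Fintype.sum_prod_type,
      Finset.card_insert_of_notMem his]
    have hstep : ∀ (m : s → ZMod 2) (b : ZMod 2),
        lawOf q (fun a (j : ↥(insert i s)) => A a j)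
          ((insertFunEquiv his).symm (m, b)) =
        lawOf q (fun a => ((fun j : s => A a j), A a i)) (m, b) := by
      intro m b
      rw [← lawOf_injective q _ (insertFunEquiv his).injective, Equiv.apply_symm_apply]
      rfl
    have hcoarse : ∑ m : s → ZMod 2,
        |lawOf q (fun a => ((fun j : s => A a j), A a i)) (m, 0) -
          lawOf q (fun a => ((fun j : s => A a j), A a i)) (m, 1)| ≤
        ∑ z : {j // j < i} → ZMod 2,
        |lawOf q (fun a => ((fun j : {j // j < i} => A a j), A a i)) (z, 0) -
          lawOf q (fun a => ((fun j : {j // j < i} => A a j), A a i)) (z, 1)| := by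
      simp only [← lawOf_sign]
      exact sum_abs_lawOf_comp_le (fun a => q a * sign (A a i))
        (fun a => (fun j : {j // j < i} => A a j))
        (fun (z : {j // j < i} → ZMod 2) (j : s) => z ⟨j.1, hi j.1 j.2⟩)
    refine le_trans ?_ (add_le_add hcoarse ih)
    rw [← Finset.sum_add_distrib]
    refine Finset.sum_le_sum fun m _ => ?_
    rw [sum_zmod_two, hstep, hstep, lawOf_fst q (fun a (j : s) => A a j) (fun a => A a i) m,
      pow_succ, ← div_div]
    exact abs_sub_half_add_le _ _ _

end Law

/-! ### The transformed source -/

lemma toReal_zero_add_one (p : PMF (ZMod 2)) : (p 0).toReal + (p 1).toReal = 1 := by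
  have h : ∑ b, p b = 1 := (tsum_fintype _).symm.trans p.tsum_coe
  rw [sum_zmod_two] at h
  rw [← ENNReal.toReal_add (p.apply_ne_top 0) (p.apply_ne_top 1), h, ENNReal.toReal_one]

/-- The source without side information. -/
def SideSource.ofPMF (p : PMF (ZMod 2)) : SideSource where
  Y := Unit
  w _ b := (p b).toReal
  nonneg _ _ := ENNReal.toReal_nonneg
  total := by simpa using toReal_zero_add_one p

lemma sourceLaw_nonneg {𝒳 : Type*} (p : PMF 𝒳) (N : ℕ) (x : Fin N → 𝒳) : 0 ≤ sourceLaw p N x :=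
  Finset.prod_nonneg fun _ _ => ENNReal.toReal_nonneg

lemma sum_sourceLaw (p : PMF (ZMod 2)) (N : ℕ) : ∑ x, sourceLaw p N x = 1 := by
  unfold sourceLaw
  have := Finset.prod_univ_sum (fun _ : Fin N => (Finset.univ : Finset (ZMod 2)))
      (fun _ v => (p v).toReal)
  rw [Fintype.piFinset_univ] at this
  rw [← this]
  simp [sum_zmod_two, toReal_zero_add_one]

lemma pastProb_nonneg (p : PMF (ZMod 2)) {n : ℕ} (i : Fin (2 ^ n))
    (z : {j : Fin (2 ^ n) // j < i} → ZMod 2) (b : ZMod 2) : 0 ≤ pastProb p i z b :=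
  lawOf_nonneg (sourceLaw_nonneg p _) _ _

/-- Each assignment to the indices below `i` has `2 ^ (N - i)` extensions; this is the denominator
in `func_leaf`. -/
lemma sum_restrict {N : ℕ} (i : Fin N) (F : ({j : Fin N // j < i} → ZMod 2) → ℝ) :
    ∑ a : Fin N → ZMod 2, F (fun j => a j) = 2 ^ (N - i.val) * ∑ z, F z := by
  have hc : Fintype.card {j : Fin N // ¬ j < i} = N - i.val := by
    rw [Fintype.card_subtype_compl, Fintype.card_fin]
    congr 1
    have h : #{j : Fin N | j < i} = i.val := by rw [Finset.filter_gt_eq_Iio, Fin.card_Iio]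
    exact (Fintype.card_subtype _).trans h
  rw [← (Equiv.piEquivPiSubtypeProd (fun j => j < i) (fun _ => ZMod 2)).symm.sum_comp,
    Fintype.sum_prod_type]
  trans ∑ z, ∑ _y : {j : Fin N // ¬ j < i} → ZMod 2, F z
  · refine Finset.sum_congr rfl fun z _ => Finset.sum_congr rfl fun y _ => congrArg F ?_
    funext j
    exact dif_pos j.2
  simp only [Finset.sum_const, Finset.card_univ, Fintype.card_fun, ZMod.card, hc,
    nsmul_eq_mul, ← Finset.mul_sum]
  push_cast
  rfl

/-- The source that describes the bit `A_i` given the preceding ones. -/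
def bitSource (p : PMF (ZMod 2)) {n : ℕ} (i : Fin (2 ^ n)) : SideSource :=
  SideSource.leaf n (SideSource.ofPMF p) i

lemma func_bitSource (φ : ℝ → ℝ → ℝ) (p : PMF (ZMod 2)) {n : ℕ} (i : Fin (2 ^ n)) :
    (bitSource p i).func φ = ∑ z, φ (pastProb p i z 0) (pastProb p i z 1) := by
  have h1 : ∀ (F : (Fin (2 ^ n) → (SideSource.ofPMF p).Y) → ℝ),
      ∑ y, F y = F (fun _ => ()) := fun F =>
    haveI : Subsingleton (SideSource.ofPMF p).Y := inferInstanceAs (Subsingleton Unit)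
    Fintype.sum_subsingleton F _
  rw [bitSource, SideSource.func_leaf, h1, div_eq_iff (by positivity), mul_comm]
  rw [← sum_restrict i (fun z => φ (pastProb p i z 0) (pastProb p i z 1))]
  simp only [pastProb_eq_past]
  rfl

lemma bits_eq_logb {s t : ℝ} (hs : 0 ≤ s) (ht : 0 ≤ t) :
    bits s t = -(s * Real.logb 2 (s / (s + t)) + t * Real.logb 2 (t / (s + t))) := by
  have key : ∀ {s t : ℝ}, 0 ≤ s → 0 ≤ t →
      s * Real.logb 2 (s / (s + t)) = (s * Real.log s - s * Real.log (s + t)) / Real.log 2 := by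
    intro s t hs ht
    rcases hs.eq_or_lt with rfl | h
    · simp
    · rw [Real.logb, Real.log_div h.ne' (by linarith)]
      ring
  have h2 := key ht hs
  rw [add_comm t s] at h2
  rw [key hs ht, h2, bits]
  simp only [Real.negMulLog]
  ring

lemma polarEntropy_eq (p : PMF (ZMod 2)) {n : ℕ} (i : Fin (2 ^ n)) :
    polarEntropy p i = (bitSource p i).func bits := by
  rw [func_bitSource, polarEntropy, condEntropy, sum_zmod_two, ← Finset.sum_add_distrib,
    ← Finset.sum_neg_distrib]
  refine Finset.sum_congr rfl fun z _ => ?_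
  have h1 (b : ZMod 2) : lawOf (sourceLaw p (2 ^ n)) (fun a => (polarTransform a i,
      fun j : {j : Fin (2 ^ n) // j < i} => polarTransform a j)) (b, z) = pastProb p i z b :=
    (lawOf_injective (sourceLaw p (2 ^ n)) (fun a => (polarTransform a i,
      fun j : {j : Fin (2 ^ n) // j < i} => polarTransform a j)) Prod.swap_injective (b, z)).symm
  have h2 : lawOf (sourceLaw p (2 ^ n))
      (fun a (j : {j : Fin (2 ^ n) // j < i}) => polarTransform a j) z =
      pastProb p i z 0 + pastProb p i z 1 := lawOf_fst _ _ _ _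
  rw [h1, h1, h2, bits_eq_logb (pastProb_nonneg p i z 0) (pastProb_nonneg p i z 1)]

lemma sum_polarEntropy (p : PMF (ZMod 2)) (n : ℕ) :
    ∑ i : Fin (2 ^ n), polarEntropy p i = 2 ^ n * entropy p := by
  simp only [polarEntropy_eq, bitSource]
  rw [SideSource.sum_leaf n _ (SideSource.func bits), SideSource.treeAvg_bits]
  congr 1
  have : (SideSource.ofPMF p).func bits = bits (p 0).toReal (p 1).toReal :=
    haveI : Subsingleton (SideSource.ofPMF p).Y := inferInstanceAs (Subsingleton Unit)
    Fintype.sum_subsingleton _ ()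
  rw [this, bits, toReal_zero_add_one, entropy, sum_zmod_two, Real.negMulLog_one]
  ring

lemma polarEntropy_nonneg (p : PMF (ZMod 2)) {n : ℕ} (i : Fin (2 ^ n)) : 0 ≤ polarEntropy p i := by
  have h1 := (bitSource p i).one_sub_bias_le
  have h2 := SideSource.polarizes.symm.Z_le_one (bitSource p i)
  rw [polarEntropy_eq]
  linarith

lemma polarEntropy_le_one (p : PMF (ZMod 2)) {n : ℕ} (i : Fin (2 ^ n)) : polarEntropy p i ≤ 1 := by
  have h1 := (bitSource p i).bias_sq_le
  rw [polarEntropy_eq]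
  nlinarith [sq_nonneg ((bitSource p i).func bias)]

/-! ### The index sets -/

lemma polarDelta_pos (β : ℝ) (n : ℕ) : 0 < polarDelta β n := by unfold polarDelta; positivity

/-- `2 ^ (c N ^ β)` grows faster than `N`. -/
lemma tendsto_two_pow_mul_rpow {β c : ℝ} (hβ : 0 < β) (hc : 0 < c) :
    Tendsto (fun n : ℕ => (2 : ℝ) ^ n * (2 : ℝ) ^ (-(c * ((2 : ℝ) ^ n) ^ β))) atTop (𝓝 0) := by
  have h1 : Tendsto (fun n : ℕ => ((2 : ℝ) ^ n) ^ β) atTop atTop :=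
    (tendsto_rpow_atTop hβ).comp (tendsto_pow_atTop_atTop_of_one_lt (by norm_num))
  have hl := Real.log_pos (show (1 : ℝ) < 2 by norm_num)
  -- In the variable `x = N ^ β` the quantity is `x ^ (1 / β) exp (-c x log 2)`.
  refine ((tendsto_rpow_mul_exp_neg_mul_atTop_nhds_zero β⁻¹ (c * Real.log 2)
    (by positivity)).comp h1).congr fun n => ?_
  simp only [Function.comp]
  rw [← Real.rpow_mul (by positivity), mul_inv_cancel₀ hβ.ne', Real.rpow_one,
    Real.rpow_def_of_pos (by norm_num : (0 : ℝ) < 2)]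
  congr 2
  ring

lemma tendsto_two_pow_mul_polarDelta {β : ℝ} (hβ : 0 < β) :
    Tendsto (fun n : ℕ => (2 : ℝ) ^ n * polarDelta β n) atTop (𝓝 0) := by
  refine (tendsto_two_pow_mul_rpow hβ one_pos).congr fun n => ?_
  rw [one_mul, polarDelta]

lemma tendsto_two_pow_mul_sqrt {β : ℝ} (hβ : 0 < β) :
    Tendsto (fun n : ℕ => (2 : ℝ) ^ n * √(6 * polarDelta β n)) atTop (𝓝 0) := by
  have h := (tendsto_two_pow_mul_rpow hβ (show (0 : ℝ) < 1 / 2 by norm_num)).mul_const √6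
  rw [zero_mul] at h
  refine h.congr fun n => ?_
  rw [Real.sqrt_mul (by norm_num), polarDelta, Real.sqrt_eq_rpow (2 ^ _), ← Real.rpow_mul (by norm_num)]
  rw [show -((2 : ℝ) ^ n) ^ β * (1 / 2) = -(1 / 2 * ((2 : ℝ) ^ n) ^ β) by ring]
  ring

lemma tendsto_polarDelta {β : ℝ} (hβ : 0 < β) : Tendsto (polarDelta β) atTop (𝓝 0) := by
  refine squeeze_zero (fun n => (polarDelta_pos β n).le) (fun n => ?_)
    (tendsto_two_pow_mul_polarDelta hβ)
  exact le_mul_of_one_le_left (polarDelta_pos β n).le (one_le_pow₀ (by norm_num))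

lemma mem_veryHighSet {p : PMF (ZMod 2)} {β : ℝ} {n : ℕ} {i : Fin (2 ^ n)} :
    i ∈ veryHighSet p β n ↔ 1 - polarDelta β n < polarEntropy p i := by
  simp [veryHighSet]

lemma mem_highSet {p : PMF (ZMod 2)} {β : ℝ} {n : ℕ} {i : Fin (2 ^ n)} :
    i ∈ highSet p β n ↔ polarDelta β n < polarEntropy p i := by
  simp [highSet]

/-- If `δ < H ≤ 1 - δ`, then `Z ≥ H / 3 > δ / 4` and `T ≥ 1 - H > δ / 4`, so the leaf is
unpolarized. The threshold `δ / 4` is the reason for the `+ 2` in the exponent of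
`tendsto_unpolarized`. -/
lemma tendsto_card_padSet (p : PMF (ZMod 2)) {β : ℝ} (hβ0 : 0 < β) (hβ : β < 1 / 2) :
    Tendsto (fun n : ℕ => (#(padSet p β n) : ℝ) / 2 ^ n) atTop (𝓝 0) := by
  have h := SideSource.polarizes.tendsto_unpolarized (SideSource.ofPMF p) hβ0 hβ
  refine squeeze_zero (fun n => by positivity) (fun n => ?_) h
  rw [div_le_iff₀ (by positivity), mul_comm, ← SideSource.sum_leaf]
  have hcard : (#(padSet p β n) : ℝ) = ∑ i, if i ∈ padSet p β n then (1 : ℝ) else 0 := by simp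
  rw [hcard]
  refine Finset.sum_le_sum fun i _ => ?_
  split_ifs with hi
  · rw [padSet, Finset.mem_sdiff, mem_highSet, mem_veryHighSet, not_lt, polarEntropy_eq,
      bitSource] at hi
    have hδ : (2 : ℝ) ^ (-(((2 : ℝ) ^ n) ^ β + 2)) = polarDelta β n / 4 := by
      rw [polarDelta, neg_add, Real.rpow_add (by norm_num)]
      norm_num
      ring
    have h0 := polarDelta_pos β n
    have h1 := (SideSource.leaf n (SideSource.ofPMF p) i).bits_le
    have h2 := (SideSource.leaf n (SideSource.ofPMF p) i).one_sub_bias_le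
    rw [ind, if_pos]
    rw [hδ]
    constructor <;> linarith [hi.1, hi.2]
  · exact ind_nonneg _ _

/-- Both bounds compare `∑ H(A_i | A^{i-1}) = N H(X)` with termwise estimates: terms in `𝒱` exceed
`1 - δ`, terms outside `𝒱 ∪ ℋ` are at most `δ`, and no term exceeds `1`. -/
lemma card_veryHighSet_bounds (p : PMF (ZMod 2)) (β : ℝ) (n : ℕ) :
    #(veryHighSet p β n) * (1 - polarDelta β n) ≤ 2 ^ n * entropy p ∧
      2 ^ n * entropy p ≤ #(veryHighSet p β n) + #(padSet p β n) + 2 ^ n * polarDelta β n := by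
  rw [← sum_polarEntropy]
  constructor
  · rw [← nsmul_eq_mul, ← Finset.sum_const]
    refine (Finset.sum_le_sum fun i hi => (mem_veryHighSet.1 hi).le).trans ?_
    exact Finset.sum_le_sum_of_subset_of_nonneg (Finset.subset_univ _)
      fun i _ _ => polarEntropy_nonneg p i
  · have h1 : ∀ i : Fin (2 ^ n), polarEntropy p i ≤ (if i ∈ veryHighSet p β n then (1 : ℝ) else 0) +
        (if i ∈ padSet p β n then (1 : ℝ) else 0) + polarDelta β n := by
      intro i
      have h0 := polarDelta_pos β n
      have h2 := polarEntropy_le_one p i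
      by_cases hv : i ∈ veryHighSet p β n
      · rw [if_pos hv]; split_ifs <;> linarith
      · by_cases hp : i ∈ padSet p β n
        · rw [if_neg hv, if_pos hp]; linarith
        · rw [if_neg hv, if_neg hp]
          have : i ∉ highSet p β n := fun h => hp (Finset.mem_sdiff.2 ⟨h, hv⟩)
          rw [mem_highSet, not_lt] at this
          linarith
    refine (Finset.sum_le_sum fun i _ => h1 i).trans_eq ?_
    simp [Finset.sum_add_distrib]

lemma tendsto_card_veryHighSet (p : PMF (ZMod 2)) {β : ℝ} (hβ0 : 0 < β) (hβ : β < 1 / 2) :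
    Tendsto (fun n : ℕ => (#(veryHighSet p β n) : ℝ) / 2 ^ n) atTop (𝓝 (entropy p)) := by
  have hpad := tendsto_card_padSet p hβ0 hβ
  have hδ := tendsto_polarDelta hβ0
  have hlow : Tendsto (fun n : ℕ => entropy p - (#(padSet p β n) : ℝ) / 2 ^ n - polarDelta β n)
      atTop (𝓝 (entropy p)) := by
    simpa using (tendsto_const_nhds.sub hpad).sub hδ
  have hup : Tendsto (fun n : ℕ => entropy p + polarDelta β n) atTop (𝓝 (entropy p)) := by
    simpa using tendsto_const_nhds.add hδ
  refine tendsto_of_tendsto_of_tendsto_of_le_of_le hlow hup (fun n => ?_) (fun n => ?_)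
  · have h := (card_veryHighSet_bounds p β n).2
    have h2 : (0 : ℝ) < 2 ^ n := by positivity
    rw [le_div_iff₀ h2, sub_mul, sub_mul, div_mul_cancel₀ _ h2.ne']
    linarith
  · have h := (card_veryHighSet_bounds p β n).1
    have h2 : (0 : ℝ) < 2 ^ n := by positivity
    have h3 : (#(veryHighSet p β n) : ℝ) ≤ 2 ^ n := by
      have := Finset.card_le_univ (veryHighSet p β n)
      rw [Fintype.card_fin] at this
      exact_mod_cast this
    rw [div_le_iff₀ h2]
    nlinarith [mul_le_mul_of_nonneg_right h3 (polarDelta_pos β n).le]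

/-! ### The probability of error -/

/-- The smaller mass is the error of a maximum likelihood decision. Since `s + t - |s - t|` is twice
the minimum, `mass_le_bits_add_bias` even leaves a factor `2` to spare. -/
lemma min_le_bits {s t : ℝ} (hs : 0 ≤ s) (ht : 0 ≤ t) : min s t ≤ bits s t := by
  have h := mass_le_bits_add_bias hs ht
  unfold bias at h
  rcases le_total s t with hst | hst
  · rw [min_eq_left hst]; rw [abs_of_nonpos (by linarith)] at h; linarith
  · rw [min_eq_right hst]; rw [abs_of_nonneg (by linarith)] at h; linarith

/-- The probability that the more likely value of `A_i` given the preceding bits is wrong. -/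
lemma sum_wrong_le (p : PMF (ZMod 2)) {n : ℕ} (i : Fin (2 ^ n)) :
    ∑ x, sourceLaw p (2 ^ n) x *
      (if polarTransform x i = likelyBit (pastProb p i (fun j => polarTransform x j) 0)
        (pastProb p i (fun j => polarTransform x j) 1) then 0 else 1) ≤ polarEntropy p i := by
  have h := sum_mul_comp (sourceLaw p (2 ^ n))
    (fun x => ((fun j : {j : Fin (2 ^ n) // j < i} => polarTransform x j), polarTransform x i))
    (fun z => if z.2 = likelyBit (pastProb p i z.1 0) (pastProb p i z.1 1) then 0 else 1)
  refine h.trans_le ?_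
  rw [Fintype.sum_prod_type, polarEntropy_eq, func_bitSource]
  refine Finset.sum_le_sum fun z _ => ?_
  refine le_trans ?_ (min_le_bits (pastProb_nonneg p i z 0) (pastProb_nonneg p i z 1))
  rw [sum_zmod_two]
  change pastProb p i z 0 * _ + pastProb p i z 1 * _ ≤ _
  unfold likelyBit
  by_cases hlt : pastProb p i z 0 < pastProb p i z 1
  · simp [hlt, hlt.le]
  · simp [hlt, not_lt.1 hlt]

/-- The union with `𝒱` appears because `β` is arbitrary here: a negative `β` allows `δ > 1 / 2`, and
then `𝒱 ⊆ ℋ` is not automatic. -/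
lemma receivedBits_enc (p : PMF (ZMod 2)) (β : ℝ) (n : ℕ) (x : Fin (2 ^ n) → ZMod 2)
    (u : BitsOn (padSet p β n)) (i : Fin (2 ^ n)) :
    receivedBits p β n (polarEnc p β n x u) u i =
      if i ∈ highSet p β n ∪ veryHighSet p β n then some (polarTransform x i) else none := by
  unfold receivedBits polarEnc
  by_cases hv : i ∈ veryHighSet p β n
  · simp [hv]
  · by_cases hp : i ∈ highSet p β n
    · have : i ∈ padSet p β n := Finset.mem_sdiff.2 ⟨hp, hv⟩
      simp [hv, hp, this, add_assoc, zmod_two_add_self]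
    · have : i ∉ padSet p β n := fun h => hp (Finset.mem_sdiff.1 h).1
      simp [hv, hp, this]

/-- If the word is not recovered, then at some position outside `ℋ_X` the more likely bit given the
correct preceding ones is wrong. -/
lemma exists_wrong (p : PMF (ZMod 2)) (β : ℝ) (n : ℕ) (x : Fin (2 ^ n) → ZMod 2)
    (u : BitsOn (padSet p β n)) (h : x ≠ polarDec p β n (polarEnc p β n x u) u) :
    ∃ i ∉ highSet p β n, polarTransform x i ≠ likelyBit
      (pastProb p i (fun j => polarTransform x j) 0)
      (pastProb p i (fun j => polarTransform x j) 1) := by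
  set known := receivedBits p β n (polarEnc p β n x u) u with hk
  have hsc := isCancellation_successiveCancellation p known
  by_contra! hcon
  apply h
  rw [polarDec, vecMul_polarMatrix_inv, ← hk]
  -- If no decision given the true past is wrong, the true bits solve the equations of successive
  -- cancellation, and uniqueness excludes error propagation.
  have : IsCancellation (fun _ x => (p x).toReal) known (polarTransform x) := by
    intro i
    rw [hk, receivedBits_enc]
    split_ifs with hi
    · simp [decideBit]
    · rw [Finset.mem_union, not_or] at hi
      rw [← pastProb_eq_past, ← pastProb_eq_past]
      exact hcon i hi.1
  rw [hsc.unique this, polarTransform_polarTransform]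

lemma sum_jointLaw {𝒳 : Type} [Fintype 𝒳] [DecidableEq 𝒳] {N : ℕ} (C : Code 𝒳 N) (p : PMF 𝒳)
    (G : (Fin N → 𝒳) → ℝ) :
    ∑ w : (Fin N → 𝒳) × C.Seed, C.jointLaw p w * G w.1 = ∑ x, sourceLaw p N x * G x := by
  have hseed : (Fintype.card C.Seed : ℝ) ≠ 0 := by
    rw [C.card_seed]; positivity
  rw [Fintype.sum_prod_type]
  refine Finset.sum_congr rfl fun x _ => ?_
  simp only [Code.jointLaw, Finset.sum_const, Finset.card_univ, nsmul_eq_mul]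
  field_simp

lemma errorProb_le (p : PMF (ZMod 2)) (β : ℝ) (n : ℕ) :
    (polarCode p β n).errorProb p ≤ 2 ^ n * polarDelta β n := by
  set W : (Fin (2 ^ n) → ZMod 2) → Fin (2 ^ n) → ℝ := fun x i =>
    if polarTransform x i = likelyBit (pastProb p i (fun j => polarTransform x j) 0)
      (pastProb p i (fun j => polarTransform x j) 1) then 0 else 1 with hW
  have h1 : (polarCode p β n).errorProb p ≤ ∑ w : (Fin (2 ^ n) → ZMod 2) × (polarCode p β n).Seed,
      (polarCode p β n).jointLaw p w * ∑ i ∈ (highSet p β n)ᶜ, W w.1 i := by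
    unfold Code.errorProb
    rw [Finset.sum_filter]
    refine Finset.sum_le_sum fun w _ => ?_
    have hq : 0 ≤ (polarCode p β n).jointLaw p w :=
      mul_nonneg (sourceLaw_nonneg _ _ _) (by positivity)
    have hnn : ∀ i ∈ (highSet p β n)ᶜ, 0 ≤ W w.1 i := by
      intro i _; rw [hW]; dsimp only; split_ifs <;> norm_num
    split_ifs with hw
    · obtain ⟨i, hi, hne⟩ := exists_wrong p β n w.1 w.2 hw
      refine le_mul_of_one_le_right hq ?_
      refine le_trans ?_ (Finset.single_le_sum hnn (Finset.mem_compl.2 hi))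
      rw [hW]
      dsimp only
      rw [if_neg hne]
    · exact mul_nonneg hq (Finset.sum_nonneg hnn)
  refine h1.trans ?_
  rw [sum_jointLaw (polarCode p β n) p fun x => ∑ i ∈ (highSet p β n)ᶜ, W x i]
  simp only [Finset.mul_sum]
  rw [Finset.sum_comm]
  calc _ ≤ ∑ i ∈ (highSet p β n)ᶜ, polarEntropy p i := Finset.sum_le_sum fun i _ => sum_wrong_le p i
    _ ≤ ∑ i ∈ (highSet p β n)ᶜ, polarDelta β n := Finset.sum_le_sum fun i hi => by
        rw [Finset.mem_compl, mem_highSet, not_lt] at hi; exact hi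
    _ ≤ 2 ^ n * polarDelta β n := by
        rw [Finset.sum_const, nsmul_eq_mul]
        refine mul_le_mul_of_nonneg_right ?_ (polarDelta_pos β n).le
        have := Finset.card_le_univ (highSet p β n)ᶜ
        rw [Fintype.card_fin] at this
        exact_mod_cast this

/-! ### Uniformity of the message -/

/-- The one-time pad: for every `x` with the right bits on `𝒱` exactly one seed produces `m`, so the
padded part is uniform and independent of the rest. -/
lemma lawOf_enc (p : PMF (ZMod 2)) (β : ℝ) (n : ℕ) (m : PolarMsg p β n) (c : ℝ) :
    lawOf (fun w : (Fin (2 ^ n) → ZMod 2) × BitsOn (padSet p β n) => sourceLaw p (2 ^ n) w.1 * c)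
      (fun w => polarEnc p β n w.1 w.2) m =
      lawOf (sourceLaw p (2 ^ n)) (fun x (i : veryHighSet p β n) => polarTransform x i) m.1 * c := by
  rw [lawOf_eq, Fintype.sum_prod_type, lawOf_eq, Finset.sum_mul]
  refine Finset.sum_congr rfl fun x _ => ?_
  have hiff : ∀ u : BitsOn (padSet p β n), polarEnc p β n x u = m ↔
      (fun i : veryHighSet p β n => polarTransform x i) = m.1 ∧
        u = fun i : padSet p β n => polarTransform x i + m.2 i := by
    intro u
    rw [polarEnc, Prod.ext_iff]
    refine and_congr Iff.rfl ?_
    rw [funext_iff, funext_iff]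
    refine forall_congr' fun i => ?_
    constructor
    · intro h
      rw [← h, ← add_assoc, zmod_two_add_self, zero_add]
    · intro h
      change polarTransform x i + u i = m.2 i
      rw [h, ← add_assoc, zmod_two_add_self, zero_add]
  simp only [hiff]
  split_ifs with h
  · simp [h]
  · simp [h]

lemma card_msg (p : PMF (ZMod 2)) (β : ℝ) (n : ℕ) :
    (polarCode p β n).numMsg = 2 ^ (#(veryHighSet p β n) + #(padSet p β n)) := by
  have : (polarCode p β n).numMsg = Fintype.card (PolarMsg p β n) := rfl
  rw [this, Fintype.card_prod, Fintype.card_fun, Fintype.card_fun, ZMod.card, Fintype.card_coe,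
    Fintype.card_coe, pow_add]

/-- Summing out the pad leaves the distance of `A[𝒱]` from uniform. On `𝒱` the entropy exceeds `1 -
δ`, so each bias is at most `√(6 δ)`. -/
lemma uniformity_le (p : PMF (ZMod 2)) (β : ℝ) (n : ℕ) :
    (polarCode p β n).uniformity p ≤ 2 ^ n * √(6 * polarDelta β n) := by
  have h1 : (polarCode p β n).uniformity p = ∑ m : BitsOn (veryHighSet p β n),
      |lawOf (sourceLaw p (2 ^ n)) (fun x (i : veryHighSet p β n) => polarTransform x i) m -
        1 / 2 ^ #(veryHighSet p β n)| := by
    change ∑ m : PolarMsg p β n, |lawOf (fun w : (Fin (2 ^ n) → ZMod 2) × BitsOn (padSet p β n) =>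
      sourceLaw p (2 ^ n) w.1 * (1 / (Fintype.card (BitsOn (padSet p β n)) : ℝ)))
      (fun w => polarEnc p β n w.1 w.2) m - 1 / ((polarCode p β n).numMsg : ℝ)| = _
    simp only [lawOf_enc, card_msg]
    rw [Fintype.sum_prod_type]
    refine Finset.sum_congr rfl fun m _ => ?_
    simp only [Finset.sum_const, Finset.card_univ, nsmul_eq_mul, Fintype.card_fun, ZMod.card,
      Fintype.card_coe]
    push_cast
    rw [pow_add, ← one_div_mul_one_div, ← sub_mul, abs_mul,
      abs_of_pos (show (0 : ℝ) < 1 / 2 ^ #(padSet p β n) by positivity)]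
    field_simp
  rw [h1]
  refine (sum_abs_lawOf_sub_le (sum_sourceLaw p _) (fun x => polarTransform x) _).trans ?_
  have h2 : ∀ i ∈ veryHighSet p β n, ∑ z : {j // j < i} → ZMod 2,
        |lawOf (sourceLaw p (2 ^ n)) (fun a => ((fun j : {j // j < i} => polarTransform a j),
          polarTransform a i)) (z, 0) -
        lawOf (sourceLaw p (2 ^ n)) (fun a => ((fun j : {j // j < i} => polarTransform a j),
          polarTransform a i)) (z, 1)| ≤ √(6 * polarDelta β n) := by
    intro i hi
    have e := func_bitSource bias p i
    have h3 := (bitSource p i).bias_sq_le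
    rw [← polarEntropy_eq] at h3
    rw [mem_veryHighSet] at hi
    refine (e.symm.trans_le ?_ : (∑ z, bias (pastProb p i z 0) (pastProb p i z 1)) ≤ _)
    exact Real.le_sqrt_of_sq_le (by linarith)
  refine (Finset.sum_le_sum h2).trans ?_
  rw [Finset.sum_const, nsmul_eq_mul]
  refine mul_le_mul_of_nonneg_right ?_ (Real.sqrt_nonneg _)
  have := Finset.card_le_univ (veryHighSet p β n)
  rw [Fintype.card_fin] at this
  exact_mod_cast this

/-- The polar codes achieve every rate above the entropy. -/
theorem achievesRate_polarCode (p : PMF (ZMod 2)) {β : ℝ} (hβ0 : 0 < β) (hβ : β < 1 / 2) {R : ℝ}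
    (hR : entropy p < R) : AchievesRate p R (fun n => 2 ^ n) (fun n => polarCode p β n) := by
  refine ⟨tendsto_pow_atTop_atTop_of_one_lt (by norm_num), ⟨entropy p, hR.le, ?_⟩, ?_, ?_, ?_⟩
  · have h := (tendsto_card_veryHighSet p hβ0 hβ).add (tendsto_card_padSet p hβ0 hβ)
    rw [add_zero] at h
    refine h.congr fun n => ?_
    rw [card_msg]
    push_cast
    rw [Real.logb_pow, Real.logb_self_eq_one (by norm_num)]
    push_cast
    rw [mul_one]
    rw [add_div]
  · refine (tendsto_card_padSet p hβ0 hβ).congr fun n => ?_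
    push_cast
    rfl
  · refine squeeze_zero (fun n => ?_) (errorProb_le p β) (tendsto_two_pow_mul_polarDelta hβ0)
    exact Finset.sum_nonneg fun w _ => mul_nonneg (sourceLaw_nonneg _ _ _) (by positivity)
  · refine squeeze_zero (fun n => ?_) (uniformity_le p β) (tendsto_two_pow_mul_sqrt hβ0)
    exact Finset.sum_nonneg fun m _ => abs_nonneg _

lemma card_padSet_isLittleO (p : PMF (ZMod 2)) {β : ℝ} (hβ0 : 0 < β) (hβ : β < 1 / 2) :
    (fun n : ℕ => (#(padSet p β n) : ℝ)) =o[atTop] (fun n : ℕ => ((2 ^ n : ℕ) : ℝ)) := by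
  rw [Asymptotics.isLittleO_iff_tendsto' (Eventually.of_forall fun n h => absurd h (by positivity))]
  refine (tendsto_card_padSet p hβ0 hβ).congr fun n => ?_
  push_cast
  rfl

/-! ### Reasoning about programs -/

/-- The program `P`, started in `s`, stops after at most `T` steps in a state that satisfies `Q`. -/
def Run (B : ℕ) (P : Prog) (s : State) (T : ℕ) (Q : State → Prop) : Prop :=
  ∃ t ≤ T, ∃ s', Exec B P s t s' ∧ Q s'

lemma Run.mono {B : ℕ} {P : Prog} {s : State} {T T' : ℕ} {Q Q' : State → Prop}
    (h : Run B P s T Q) (hT : T ≤ T') (hQ : ∀ s', Q s' → Q' s') : Run B P s T' Q' := by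
  obtain ⟨t, ht, s', he, hq⟩ := h
  exact ⟨t, ht.trans hT, s', he, hQ s' hq⟩

lemma Run.seq {B : ℕ} {P P' : Prog} {s : State} {T T' : ℕ} {Q R : State → Prop}
    (h : Run B P s T Q) (h' : ∀ s', Q s' → Run B P' s' T' R) :
    Run B (.seq P P') s (T + T') R := by
  obtain ⟨t, ht, s', he, hq⟩ := h
  obtain ⟨t', ht', s'', he', hr⟩ := h' s' hq
  exact ⟨t + t', by omega, s'', .seq he he', hr⟩

lemma Run.seq' {B : ℕ} {P P' : Prog} {s : State} {T T' : ℕ} {R : State → Prop}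
    (h : Run B P s T fun s' => Run B P' s' T' R) : Run B (.seq P P') s (T + T') R :=
  h.seq fun _ h' => h'

lemma Run.le {B : ℕ} {P : Prog} {s : State} {T T' : ℕ} {Q : State → Prop}
    (h : Run B P s T Q) (hT : T ≤ T') : Run B P s T' Q := h.mono hT fun _ h' => h'

lemma Run.branch {B : ℕ} {c : Test} {P P' : Prog} {s : State} {T : ℕ} {Q : State → Prop}
    (h : c.holds s → Run B P s T Q) (h' : ¬ c.holds s → Run B P' s T Q) :
    Run B (.branch c P P') s (T + 1) Q := by
  by_cases hc : c.holds s
  · obtain ⟨t, ht, s', he, hq⟩ := h hc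
    exact ⟨1 + t, by omega, s', .branch_true hc he, hq⟩
  · obtain ⟨t, ht, s', he, hq⟩ := h' hc
    exact ⟨1 + t, by omega, s', .branch_false hc he, hq⟩

/-- Some iterations of a loop, taking at most `T` steps, lead from `s` to a state that satisfies
`Q`. -/
def Iter (B : ℕ) (c : Test) (P : Prog) (s : State) (T : ℕ) (Q : State → Prop) : Prop :=
  ∃ t ≤ T, ∃ s', (∀ t' s'', Exec B (.loop c P) s' t' s'' → Exec B (.loop c P) s (t + t') s'') ∧ Q s'

lemma Iter.refl {B : ℕ} {c : Test} {P : Prog} {s : State} {Q : State → Prop} (h : Q s) :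
    Iter B c P s 0 Q :=
  ⟨0, le_rfl, s, fun t' s'' he => by rwa [zero_add], h⟩

lemma Iter.mono {B : ℕ} {c : Test} {P : Prog} {s : State} {T T' : ℕ} {Q Q' : State → Prop}
    (h : Iter B c P s T Q) (hT : T ≤ T') (hQ : ∀ s', Q s' → Q' s') : Iter B c P s T' Q' := by
  obtain ⟨t, ht, s', he, hq⟩ := h
  exact ⟨t, ht.trans hT, s', he, hQ s' hq⟩

lemma Iter.trans {B : ℕ} {c : Test} {P : Prog} {s : State} {T T' : ℕ} {Q R : State → Prop}
    (h : Iter B c P s T Q) (h' : ∀ s', Q s' → Iter B c P s' T' R) :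
    Iter B c P s (T + T') R := by
  obtain ⟨t, ht, s', he, hq⟩ := h
  obtain ⟨t', ht', s'', he', hr⟩ := h' s' hq
  refine ⟨t + t', by omega, s'', fun u s₃ hex => ?_, hr⟩
  rw [add_assoc]
  exact he _ _ (he' _ _ hex)

lemma Iter.one {B : ℕ} {c : Test} {P : Prog} {s : State} {T : ℕ} {Q : State → Prop}
    (hc : c.holds s) (h : Run B P s T Q) : Iter B c P s (T + 1) Q := by
  obtain ⟨t, ht, s', he, hq⟩ := h
  refine ⟨1 + t, by omega, s', fun t' s'' hex => .loop_step hc he hex, hq⟩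

lemma Iter.run {B : ℕ} {c : Test} {P : Prog} {s : State} {T : ℕ} {Q : State → Prop}
    (h : Iter B c P s T Q) (hc : ∀ s', Q s' → ¬ c.holds s') :
    Run B (.loop c P) s (T + 1) Q := by
  obtain ⟨t, ht, s', he, hq⟩ := h
  exact ⟨t + 1, by omega, s', he _ _ (.loop_done (hc s' hq)), hq⟩

/-- A loop with the invariant `I k` after `k` iterations. -/
lemma Run.for {B : ℕ} {c : Test} {P : Prog} {s : State} (I : ℕ → State → Prop) (m T : ℕ)
    (h0 : I 0 s) (hstep : ∀ k < m, ∀ s, I k s → c.holds s ∧ Run B P s T (I (k + 1)))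
    (hend : ∀ s, I m s → ¬ c.holds s) : Run B (.loop c P) s (m * (T + 1) + 1) (I m) := by
  have key : ∀ k ≤ m, Iter B c P s (k * (T + 1)) (I k) := by
    intro k
    induction k with
    | zero => intro _; rw [zero_mul]; exact Iter.refl h0
    | succ k ih =>
      intro hk
      rw [add_mul, one_mul]
      refine (ih (by omega)).trans fun s' hs' => ?_
      obtain ⟨hc, hr⟩ := hstep k (by omega) s' hs'
      exact Iter.one hc hr
  exact (key m le_rfl).run hend

/-! ### Straight-line code -/

/-- A sequence of instructions, followed by one that does nothing. -/
def block : List Instr → Prog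
  | [] => .instr (.set 0 (.reg 0))
  | i :: l => .seq (.instr i) (block l)

/-- The effect of a sequence of instructions. -/
def execList : State → List Instr → State
  | s, [] => s
  | s, i :: l => execList (i.exec s) l

/-- A constant of the program is at most `B`. -/
def Operand.ConstLe (B : ℕ) : Operand → Prop
  | .reg _ => True
  | .const c => c ≤ B

/-- A condition for an instruction to leave all integers at most `B`. -/
def Instr.Fits (B : ℕ) (s : State) : Instr → Prop
  | .set _ e => e.ConstLe B
  | .add _ e₁ e₂ => e₁.eval s + e₂.eval s ≤ B
  | .sub _ e₁ _ => e₁.ConstLe B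
  | .store _ _ e => e.ConstLe B
  | _ => True

/-- All instructions of a sequence leave all integers at most `B`. -/
def FitsList (B : ℕ) : State → List Instr → Prop
  | _, [] => True
  | s, i :: l => i.Fits B s ∧ FitsList B (i.exec s) l

lemma Operand.eval_le {B : ℕ} {s : State} (hs : s.BoundedBy B) {e : Operand} (he : e.ConstLe B) :
    e.eval s ≤ B := by
  cases e with
  | reg r => exact hs.1 r
  | const c => exact he

lemma update_le {B : ℕ} {f : ℕ → ℕ} (hf : ∀ r, f r ≤ B) (r : ℕ) {v : ℕ} (hv : v ≤ B) (r' : ℕ) :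
    Function.update f r v r' ≤ B := by
  unfold Function.update
  split_ifs with h
  · subst h; exact hv
  · exact hf r'

lemma Instr.Fits.boundedBy {B : ℕ} {s : State} {i : Instr} (h : i.Fits B s)
    (hs : s.BoundedBy B) : (i.exec s).BoundedBy B := by
  cases i with
  | set r e => exact ⟨update_le hs.1 r (e.eval_le hs h), hs.2⟩
  | add r e₁ e₂ => exact ⟨update_le hs.1 r h, hs.2⟩
  | sub r e₁ e₂ => exact ⟨update_le hs.1 r ((Nat.sub_le _ _).trans (e₁.eval_le hs h)), hs.2⟩
  | load r a idx => exact ⟨update_le hs.1 r (hs.2 _ _), hs.2⟩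
  | store a idx e =>
    refine ⟨hs.1, fun a' => ?_⟩
    simp only [Instr.exec]
    intro j
    by_cases ha : a' = a
    · subst ha
      rw [Function.update_self]
      exact update_le (hs.2 _) _ (e.eval_le hs h) j
    · rw [Function.update_of_ne ha]
      exact hs.2 a' j
  | radd r r₁ r₂ => exact hs
  | rmul r r₁ r₂ => exact hs
  | rload r a idx => exact hs
  | rstore a idx r => exact hs

/-- Reduces straight-line code to evaluating `execList`, which `simp` can do. Boundedness of the
final state is handed to the postcondition, so that invariants can carry it along. -/
lemma run_block {B : ℕ} {s : State} {l : List Instr} {Q : State → Prop} (hs : s.BoundedBy B)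
    (hl : FitsList B s l) (hQ : (execList s l).BoundedBy B → Q (execList s l)) :
    Run B (block l) s (l.length + 1) Q := by
  induction l generalizing s with
  | nil =>
    have he : Instr.exec s (.set 0 (.reg 0)) = s := by
      simp only [Instr.exec, Operand.eval, Function.update_eq_self]
    refine ⟨1, by simp, s, ?_, hQ hs⟩
    have := Exec.instr (B := B) (.set 0 (.reg 0)) s (by rw [he]; exact hs)
    rwa [he] at this
  | cons i l ih =>
    have h1 := hl.1.boundedBy hs
    obtain ⟨t, ht, s', he, hq⟩ := ih h1 hl.2 hQ
    refine ⟨1 + t, by simp only [List.length_cons]; omega, s', .seq (.instr i s h1) he, hq⟩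

/-! ### Packed bits -/

/-- The number of elements of `S` below `i`. -/
def rank {N : ℕ} (S : Finset (Fin N)) (i : ℕ) : ℕ := #{j ∈ S | j.val < i}

lemma rank_zero {N : ℕ} (S : Finset (Fin N)) : rank S 0 = 0 := by simp [rank]

lemma rank_top {N : ℕ} (S : Finset (Fin N)) : rank S N = #S := by
  simp [rank]

lemma rank_le {N : ℕ} (S : Finset (Fin N)) (i : ℕ) : rank S i ≤ #S :=
  Finset.card_filter_le _ _

lemma card_le_length {N : ℕ} (S : Finset (Fin N)) : #S ≤ N := by
  simpa using Finset.card_le_univ S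

lemma rank_succ_of_mem {N : ℕ} {S : Finset (Fin N)} {i : Fin N} (h : i ∈ S) :
    rank S (i.val + 1) = rank S i.val + 1 := by
  have h2 : (S.filter fun j => j.val < i.val + 1) = insert i (S.filter fun j => j.val < i.val) := by
    ext j
    simp only [Finset.mem_filter, Finset.mem_insert, Fin.ext_iff]
    constructor
    · rintro ⟨h1, h2⟩
      by_cases hj : j.val = i.val
      · exact Or.inl hj
      · exact Or.inr ⟨h1, by omega⟩
    · rintro (h1 | h1)
      · rw [Fin.ext h1]; exact ⟨h, by simp⟩
      · exact ⟨h1.1, by omega⟩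
  rw [rank, h2, Finset.card_insert_of_notMem (by simp)]
  rfl

lemma rank_succ_of_notMem {N : ℕ} {S : Finset (Fin N)} {i : Fin N} (h : i ∉ S) :
    rank S (i.val + 1) = rank S i.val := by
  unfold rank
  congr 1
  ext j
  simp only [Finset.mem_filter, and_congr_right_iff]
  intro hj
  have : j.val ≠ i.val := fun e => h (Fin.ext e ▸ hj)
  omega

lemma rank_lt {N : ℕ} {S : Finset (Fin N)} {i : Fin N} (h : i ∈ S) : rank S i.val < #S := by
  have := rank_le S (i.val + 1)
  rw [rank_succ_of_mem h] at this
  omega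

/-- The increasing enumeration of `S` has `i` at the position that counts the elements below `i`. A
scan can therefore address packed bits with a running counter. -/
lemma packBits_rank {N : ℕ} {S : Finset (Fin N)} (b : BitsOn S) {i : Fin N} (h : i ∈ S) :
    packBits S b (rank S i.val) = (b ⟨i, h⟩).val := by
  have hlt := rank_lt h
  rw [packBits, dif_pos hlt]
  have hk : S.orderIsoOfFin rfl ⟨rank S i.val, hlt⟩ = ⟨i, h⟩ := by
    set k := (S.orderIsoOfFin rfl).symm ⟨i, h⟩ with hk
    have hki : S.orderIsoOfFin rfl k = ⟨i, h⟩ := OrderIso.apply_symm_apply _ _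
    have hr : rank S i.val = k.val := by
      have : (S.filter fun j => j.val < i.val) =
          (Finset.Iio k).image (fun l => ((S.orderIsoOfFin rfl l : S) : Fin N)) := by
        ext j
        simp only [Finset.mem_filter, Finset.mem_image, Finset.mem_Iio]
        constructor
        · rintro ⟨hj, hji⟩
          refine ⟨(S.orderIsoOfFin rfl).symm ⟨j, hj⟩, ?_, by simp⟩
          rw [hk, OrderIso.lt_iff_lt]
          exact hji
        · rintro ⟨l, hl, rfl⟩
          refine ⟨(S.orderIsoOfFin rfl l).2, ?_⟩
          have h3 := (S.orderIsoOfFin rfl).lt_iff_lt.2 hl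
          rw [hki] at h3
          exact h3
      rw [rank, this, Finset.card_image_of_injective, Fin.card_Iio]
      exact Subtype.val_injective.comp (S.orderIsoOfFin rfl).injective
    rw [← hki]
    congr 1
    exact Fin.ext hr
  rw [hk]

attribute [local simp] execList Instr.exec Operand.eval FitsList Instr.Fits Operand.ConstLe
  Test.holds Function.update_apply

/-- The programs form the sum of two bits from truncated differences: one of the two differences is
`0`, the other is `|a - b|`. -/
lemma zmod_two_xor (a b : ZMod 2) : a.val - b.val + (b.val - a.val) = (a + b).val := by
  revert a b; decide

lemma zmod_two_val_le (a : ZMod 2) : a.val ≤ 1 := by revert a; decide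

/-! ### The table of the index sets -/

section Table

variable {p : PMF (ZMod 2)} {β : ℝ} {n : ℕ}

lemma notMem_padSet_of_mem {i : Fin (2 ^ n)} (h : i ∈ veryHighSet p β n) : i ∉ padSet p β n :=
  fun h' => (Finset.mem_sdiff.1 h').2 h

lemma indexTable_veryHigh {i : Fin (2 ^ n)} (h : i ∈ veryHighSet p β n) :
    indexTable p β n i = 1 := by simp [indexTable, h]

lemma indexTable_pad {i : Fin (2 ^ n)} (h : i ∈ padSet p β n) : indexTable p β n i = 2 := by
  simp [indexTable, h, (Finset.mem_sdiff.1 h).2]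

lemma indexTable_other {i : Fin (2 ^ n)} (h : i ∉ veryHighSet p β n) (h' : i ∉ padSet p β n) :
    indexTable p β n i = 0 := by simp [indexTable, h, h']

lemma indexTable_le (k : ℕ) : indexTable p β n k ≤ 2 := by
  unfold indexTable; split_ifs <;> omega

lemma card_add_card_le : #(veryHighSet p β n) + #(padSet p β n) ≤ 2 ^ n := by
  rw [← Finset.card_union_of_disjoint]
  · exact card_le_length _
  · exact Finset.disjoint_left.2 fun _ => notMem_padSet_of_mem

lemma packBits_le {N : ℕ} (S : Finset (Fin N)) (b : BitsOn S) (k : ℕ) : packBits S b k ≤ 1 := by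
  unfold packBits; split_ifs
  · exact zmod_two_val_le _
  · omega

lemma packMsg_le (m : PolarMsg p β n) (k : ℕ) : packMsg p β n m k ≤ 1 := by
  unfold packMsg; split_ifs <;> exact packBits_le _ _ _

lemma packMsg_veryHigh (m : PolarMsg p β n) {i : Fin (2 ^ n)} (h : i ∈ veryHighSet p β n) :
    packMsg p β n m (rank (veryHighSet p β n) i) = (m.1 ⟨i, h⟩).val := by
  rw [packMsg, if_pos (rank_lt h), packBits_rank _ h]

lemma packMsg_pad (m : PolarMsg p β n) {i : Fin (2 ^ n)} (h : i ∈ padSet p β n) :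
    packMsg p β n m (#(veryHighSet p β n) + rank (padSet p β n) i) = (m.2 ⟨i, h⟩).val := by
  rw [packMsg, if_neg (by omega), Nat.add_sub_cancel_left, packBits_rank _ h]

lemma inputState_boundedBy {B : ℕ} (hB : 2 ^ n ≤ B) (hB2 : 2 ≤ B) {data : ℕ → ℕ}
    (hd : ∀ k, data k ≤ 1) (u : BitsOn (padSet p β n)) :
    (inputState p β n data u).BoundedBy B := by
  constructor
  · intro r
    simp only [inputState]
    split_ifs
    · exact (Nat.lt_two_pow_self (n := n)).le.trans hB
    · exact hB
    · omega
  · intro a i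
    simp only [inputState]
    split_ifs
    · exact (indexTable_le i).trans hB2
    · exact (hd i).trans (by omega)
    · exact (packBits_le _ _ i).trans (by omega)
    · simp

/-- Counts the elements of `𝒱_X`; the result is left in register `3`. -/
def countProg : Prog :=
  .seq (block [.set 2 (.const 0), .set 3 (.const 0)])
    (.loop (.lt (.reg 2) (.reg 1))
      (.seq (block [.load 4 0 (.reg 2), .add 2 (.reg 2) (.const 1)])
        (.branch (.lt (.reg 4) (.const 1)) (block [])
          (.branch (.lt (.reg 4) (.const 2)) (block [.add 3 (.reg 3) (.const 1)]) (block [])))))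

lemma run_countProg {B : ℕ} (hB : 2 ^ n + 2 ≤ B) {s : State} (hs : s.BoundedBy B)
    (h1 : s.reg 1 = 2 ^ n) (h0 : s.arr 0 = indexTable p β n) :
    Run B countProg s (10 * 2 ^ n + 10) fun s' => s'.BoundedBy B ∧ s'.reg 1 = 2 ^ n ∧
      s'.reg 3 = #(veryHighSet p β n) ∧ s'.arr = s.arr ∧ s'.rreg = s.rreg ∧ s'.rarr = s.rarr := by
  refine Run.le (Run.seq' (T := 3) (T' := 2 ^ n * (8 + 1) + 1)
    (run_block hs (by simp) fun hb => ?_)) (by omega)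
  refine Run.mono (Run.for (fun k s' => s'.BoundedBy B ∧ s'.reg 1 = 2 ^ n ∧ s'.reg 2 = k ∧
    s'.reg 3 = rank (veryHighSet p β n) k ∧ s'.arr = s.arr ∧ s'.rreg = s.rreg ∧
    s'.rarr = s.rarr) (2 ^ n) 8 ?_ ?_ ?_) le_rfl ?_
  · exact ⟨hb, by simp [h1], by simp, by simp [rank_zero], by simp, by simp, by simp⟩
  · rintro k hk t ⟨tb, t1, t2, t3, ta, tr, tra⟩
    refine ⟨by simp [t1, t2, hk], ?_⟩
    have hrank := rank_le (veryHighSet p β n) k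
    have hcard := card_le_length (veryHighSet p β n)
    refine Run.le (Run.seq' (T := 3) (T' := 4) (run_block tb ?_ fun ub => ?_)) (by omega)
    · simp [t2]; omega
    refine Run.le (Run.branch (T := 3) (fun hc => ?_) fun hc => ?_) (by omega)
    · refine Run.le (run_block ub (by simp) fun vb => ?_) (by simp)
      refine ⟨vb, by simp [t1], by simp [t2], ?_, by simp [ta], by simp [tr], by simp [tra]⟩
      simp only [Test.holds, execList, Instr.exec, Operand.eval, Function.update_apply, t2, ta, h0]
        at hc
      have hv : (⟨k, hk⟩ : Fin (2 ^ n)) ∉ veryHighSet p β n := fun hv => by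
        have := indexTable_veryHigh hv
        simp at hc this
        omega
      have := rank_succ_of_notMem hv
      simp at this
      simp [t3, this]
    · refine Run.le (Run.branch (T := 2) (fun hc' => ?_) fun hc' => ?_) (by omega)
      · refine Run.le (run_block ub ?_ fun vb => ?_) (by simp)
        · simp [t3]; omega
        refine ⟨vb, by simp [t1], by simp [t2], ?_, by simp [ta], by simp [tr], by simp [tra]⟩
        have hv : (⟨k, hk⟩ : Fin (2 ^ n)) ∈ veryHighSet p β n := by
          by_contra hv
          simp [t2, ta, h0] at hc hc'
          by_cases hp : (⟨k, hk⟩ : Fin (2 ^ n)) ∈ padSet p β n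
          · have := indexTable_pad hp
            simp at this
            omega
          · have := indexTable_other hv hp
            simp at this
            omega
        have := rank_succ_of_mem hv
        simp at this
        simp [t3, this]
      · refine Run.le (run_block ub (by simp) fun vb => ?_) (by simp)
        refine ⟨vb, by simp [t1], by simp [t2], ?_, by simp [ta], by simp [tr], by simp [tra]⟩
        have hv : (⟨k, hk⟩ : Fin (2 ^ n)) ∉ veryHighSet p β n := fun hv => by
          have := indexTable_veryHigh hv
          simp [t2, ta, h0] at hc' this
          omega
        have := rank_succ_of_notMem hv
        simp at this
        simp [t3, this]
  · rintro t ⟨tb, t1, t2, -⟩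
    simp [t1, t2]
  · rintro t ⟨tb, t1, t2, t3, ta, tr, tra⟩
    rw [rank_top] at t3
    exact ⟨tb, t1, t3, ta, tr, tra⟩

end Table

/-! ### The encoder -/

/-- The polar transforms of the successive blocks of length `2 ^ s` of a sequence. -/
def blockTransform (s : ℕ) (y : ℕ → ZMod 2) (j : ℕ) : ZMod 2 :=
  polarTransform (fun t : Fin (2 ^ s) => y (2 ^ s * (j / 2 ^ s) + t))
    ⟨j % 2 ^ s, Nat.mod_lt _ (by positivity)⟩

lemma blockTransform_eq {s q r : ℕ} (hr : r < 2 ^ s) (y : ℕ → ZMod 2) :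
    blockTransform s y (2 ^ s * q + r) =
      polarTransform (fun t : Fin (2 ^ s) => y (2 ^ s * q + t)) ⟨r, hr⟩ := by
  have h1 : (2 ^ s * q + r) / 2 ^ s = q := by
    rw [Nat.mul_add_div (by positivity), Nat.div_eq_of_lt hr, add_zero]
  have h2 : (2 ^ s * q + r) % 2 ^ s = r := by
    rw [Nat.mul_add_mod, Nat.mod_eq_of_lt hr]
  unfold blockTransform
  simp only [h1, h2]

/-- The butterfly: the block of length `2 ^ (s + 1)` containing `j` splits into two transformed
halves, and the second is added to the first. -/
lemma blockTransform_succ (s : ℕ) (y : ℕ → ZMod 2) (j : ℕ) :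
    blockTransform (s + 1) y j = if j % 2 ^ (s + 1) < 2 ^ s then
      blockTransform s y j + blockTransform s y (j + 2 ^ s) else blockTransform s y j := by
  obtain ⟨q, r, hr, rfl⟩ : ∃ q r, r < 2 ^ (s + 1) ∧ j = 2 ^ (s + 1) * q + r :=
    ⟨j / 2 ^ (s + 1), j % 2 ^ (s + 1), Nat.mod_lt _ (by positivity), (Nat.div_add_mod _ _).symm⟩
  rw [Nat.mul_add_mod, Nat.mod_eq_of_lt hr, blockTransform_eq hr]
  split_ifs with h
  · have e1 : 2 ^ (s + 1) * q + r = 2 ^ s * (2 * q) + r := by ring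
    have e2 : 2 ^ (s + 1) * q + r + 2 ^ s = 2 ^ s * (2 * q + 1) + r := by ring
    rw [e2, e1, blockTransform_eq h, blockTransform_eq h]
    have hlo : (⟨r, hr⟩ : Fin (2 ^ (s + 1))) = lo ⟨r, h⟩ := Fin.ext (by simp)
    rw [hlo, polarTransform_lo, polarTransform_add]
    simp only [lo_val, hi_val]
    congr 4 <;> funext t <;> congr 1 <;> ring
  · obtain ⟨t, rfl⟩ := Nat.exists_eq_add_of_le (not_lt.1 h)
    have ht : t < 2 ^ s := by rw [pow_succ] at hr; omega
    have e1 : 2 ^ (s + 1) * q + (2 ^ s + t) = 2 ^ s * (2 * q + 1) + t := by ring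
    rw [e1, blockTransform_eq ht]
    have hhi : (⟨2 ^ s + t, hr⟩ : Fin (2 ^ (s + 1))) = hi ⟨t, ht⟩ := Fin.ext (by simp)
    rw [hhi, polarTransform_hi]
    simp only [hi_val]
    congr 2
    funext t
    congr 1
    ring

/-- One stage of the in-place polar transform of array `1`, with `h` in register `5` and `2 h` in
register `6`. -/
def stageProg : Prog :=
  .loop (.lt (.reg 2) (.reg 1))
    (.seq (.branch (.lt (.reg 7) (.reg 5))
        (block [.add 9 (.reg 2) (.reg 5), .load 8 1 (.reg 2), .load 10 1 (.reg 9),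
          .sub 11 (.reg 8) (.reg 10), .sub 12 (.reg 10) (.reg 8), .add 11 (.reg 11) (.reg 12),
          .store 1 (.reg 2) (.reg 11)])
        (block []))
      (.seq (block [.add 2 (.reg 2) (.const 1), .add 7 (.reg 7) (.const 1)])
        (.branch (.lt (.reg 7) (.reg 6)) (block []) (block [.set 7 (.const 0)]))))

/-- The state of the in-place polar transform; `a` are the contents of the arrays except for
array `1`, which holds the bits `y`. -/
structure TransformState (B N cnt h : ℕ) (a : ℕ → ℕ → ℕ) (y : ℕ → ZMod 2) (s : State) : Prop where
  bdd : s.BoundedBy B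
  r1 : s.reg 1 = N
  r3 : s.reg 3 = cnt
  r5 : s.reg 5 = h
  arr1 : s.arr 1 = fun j => (y j).val
  arr : ∀ i ≠ 1, s.arr i = a i

/-- The bits after `i` steps of a stage. -/
def stageBits (h : ℕ) (y : ℕ → ZMod 2) (i j : ℕ) : ZMod 2 :=
  if j < i ∧ j % (2 * h) < h then y j + y (j + h) else y j

lemma stageBits_succ_of_lt {h i : ℕ} (hi : i % (2 * h) < h) (y : ℕ → ZMod 2) (j : ℕ) :
    stageBits h y (i + 1) j = if j = i then y i + y (i + h) else stageBits h y i j := by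
  unfold stageBits
  by_cases hj : j = i
  · subst hj; simp [hi]
  · have : j < i + 1 ↔ j < i := by omega
    simp [hj, this]

lemma stageBits_succ_of_not_lt {h i : ℕ} (hi : ¬ i % (2 * h) < h) (y : ℕ → ZMod 2) :
    stageBits h y (i + 1) = stageBits h y i := by
  funext j
  unfold stageBits
  by_cases hj : j = i
  · subst hj; simp [hi]
  · have : j < i + 1 ↔ j < i := by omega
    simp [this]

/-- Working in place is safe: the partner `i + h` of a cell to be changed lies in the second half of
its block of length `2 h`, and such cells are never written during the stage. -/
lemma run_stageProg {B N cnt h : ℕ} {a : ℕ → ℕ → ℕ} {y : ℕ → ZMod 2} (hB : 2 * N + 2 ≤ B)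
    (h0 : 0 < h) (hN : 2 * h ≤ N) {s : State} (hs : TransformState B N cnt h a y s)
    (h2 : s.reg 2 = 0) (h6 : s.reg 6 = 2 * h) (h7 : s.reg 7 = 0) :
    Run B stageProg s (N * 20 + 1) fun s' =>
      TransformState B N cnt h a (stageBits h y N) s' ∧ s'.reg 6 = 2 * h := by
  refine Run.mono (Run.for (fun k s' => TransformState B N cnt h a (stageBits h y k) s' ∧
    s'.reg 2 = k ∧ s'.reg 6 = 2 * h ∧ s'.reg 7 = k % (2 * h)) N 19 ?_ ?_ ?_) le_rfl ?_
  · refine ⟨?_, h2, h6, by simp [h7]⟩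
    have : stageBits h y 0 = y := by funext j; simp [stageBits]
    rwa [this]
  · rintro k hk t ⟨ht, t2, t6, t7⟩
    refine ⟨by simp [t2, ht.r1, hk], ?_⟩
    have hmod : k % (2 * h) < 2 * h := Nat.mod_lt _ (by omega)
    -- Both branches end with the same bookkeeping, which keeps register `7` equal to the position
    -- modulo `2 h` without a division.
    have tail : ∀ u : State, TransformState B N cnt h a (stageBits h y (k + 1)) u →
        u.reg 2 = k → u.reg 6 = 2 * h → u.reg 7 = k % (2 * h) →
        Run B (.seq (block [.add 2 (.reg 2) (.const 1), .add 7 (.reg 7) (.const 1)])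
          (.branch (.lt (.reg 7) (.reg 6)) (block []) (block [.set 7 (.const 0)]))) u 8
          fun s' => TransformState B N cnt h a (stageBits h y (k + 1)) s' ∧
            s'.reg 2 = k + 1 ∧ s'.reg 6 = 2 * h ∧ s'.reg 7 = (k + 1) % (2 * h) := by
      intro u hu u2 u6 u7
      refine Run.le (Run.seq' (T := 3) (T' := 3) (run_block hu.bdd ?_ fun vb => ?_)) (by omega)
      · simp [u2, u7]; omega
      refine Run.le (Run.branch (T := 2) (fun hc => ?_) fun hc => ?_) (by omega)
      · refine Run.le (run_block vb (by simp) fun wb => ?_) (by simp)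
        refine ⟨⟨wb, by simp [hu.r1], by simp [hu.r3], by simp [hu.r5], by simp [hu.arr1],
          fun i hi => by simp [hu.arr i hi]⟩, by simp [u2], by simp [u6], ?_⟩
        simp [u7, u6] at hc
        simp [u7]
        rw [Nat.add_mod, Nat.mod_eq_of_lt (show 1 < 2 * h by omega), Nat.mod_eq_of_lt hc]
      · refine Run.le (run_block vb (by simp) fun wb => ?_) (by simp)
        refine ⟨⟨wb, by simp [hu.r1], by simp [hu.r3], by simp [hu.r5], by simp [hu.arr1],
          fun i hi => by simp [hu.arr i hi]⟩, by simp [u2], by simp [u6], ?_⟩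
        simp [u7, u6] at hc
        have : k % (2 * h) + 1 = 2 * h := by omega
        simp
        rw [Nat.add_mod, Nat.mod_eq_of_lt (show 1 < 2 * h by omega), this, Nat.mod_self]
    refine Run.le (Run.seq' (T := 9) (T' := 8) (Run.branch (T := 8) (fun hc => ?_) fun hc => ?_))
      (by omega)
    · simp [t7, ht.r5] at hc
      have hxor : ((stageBits h y k k).val - (stageBits h y k (k + h)).val) +
          ((stageBits h y k (k + h)).val - (stageBits h y k k).val) = (y k + y (k + h)).val := by
        rw [zmod_two_xor]; simp [stageBits]
      have hval := zmod_two_val_le (y k + y (k + h))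
      refine Run.le (run_block ht.bdd ?_ fun ub => ?_) (by simp)
      · simp [t2, ht.r5, ht.arr1]; omega
      · refine tail _ ⟨ub, by simp [ht.r1], by simp [ht.r3], by simp [ht.r5], ?_,
          fun i hi => by simp [hi, ht.arr i hi]⟩ (by simp [t2]) (by simp [t6]) (by simp [t7])
        funext j
        rw [stageBits_succ_of_lt hc]
        by_cases hj : j = k
        · simp [t2, ht.r5, ht.arr1, hj, hxor]
        · simp [t2, ht.arr1, hj]
    · simp [t7, ht.r5] at hc
      rw [stageBits_succ_of_not_lt (not_lt.2 hc)] at tail ⊢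
      refine Run.le (run_block ht.bdd (by simp) fun ub => ?_) (by simp)
      exact tail _ ht t2 t6 t7
  · rintro t ⟨ht, t2, -⟩
    simp [t2, ht.r1]
  · rintro t ⟨ht, t2, t6, -⟩
    exact ⟨ht, t6⟩

/-- The in-place polar transform of array `1`. -/
def transformProg : Prog :=
  .seq (block [.set 5 (.const 1)])
    (.loop (.lt (.reg 5) (.reg 1))
      (.seq (block [.add 6 (.reg 5) (.reg 5), .set 2 (.const 0), .set 7 (.const 0)])
        (.seq stageProg (block [.set 5 (.reg 6)]))))

lemma stageBits_blockTransform {n : ℕ} (s : ℕ) (y : ℕ → ZMod 2) {j : ℕ} (hj : j < 2 ^ n) :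
    stageBits (2 ^ s) (blockTransform s y) (2 ^ n) j = blockTransform (s + 1) y j := by
  rw [blockTransform_succ, stageBits, pow_succ']
  simp [hj]

/-- The bits after `s` stages. -/
def stages (n : ℕ) (y : ℕ → ZMod 2) : ℕ → ℕ → ZMod 2
  | 0 => y
  | s + 1 => stageBits (2 ^ s) (stages n y s) (2 ^ n)

/-- The restriction to `j < 2 ^ n` matters, since the program leaves later cells alone. The partner
cell stays in range because `2 ^ (s + 1)` divides `2 ^ n`. -/
lemma stages_eq {n s : ℕ} (hs : s ≤ n) (y : ℕ → ZMod 2) {j : ℕ} (hj : j < 2 ^ n) :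
    stages n y s j = blockTransform s y j := by
  induction s generalizing j with
  | zero =>
    simp only [stages, blockTransform, polarTransform_zero]
    simp [Nat.mod_one]
  | succ s ih =>
    have hlt : j % (2 * 2 ^ s) < 2 ^ s → j + 2 ^ s < 2 ^ n := by
      intro h
      obtain ⟨d, rfl⟩ := Nat.exists_eq_add_of_lt hs
      rw [show s + d + 1 = (s + 1) + d by ring, pow_add, pow_succ'] at hj ⊢
      have h1 := Nat.div_add_mod j (2 * 2 ^ s)
      have h2 : j / (2 * 2 ^ s) < 2 ^ d := Nat.div_lt_of_lt_mul hj
      have h3 : 2 * 2 ^ s * (j / (2 * 2 ^ s) + 1) ≤ 2 * 2 ^ s * 2 ^ d :=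
        Nat.mul_le_mul_left _ h2
      rw [mul_add, mul_one] at h3
      omega
    rw [← stageBits_blockTransform s y hj, stages]
    unfold stageBits
    by_cases hc : j < 2 ^ n ∧ j % (2 * 2 ^ s) < 2 ^ s
    · rw [if_pos hc, if_pos hc, ih (by omega) hj, ih (by omega) (hlt hc.2)]
    · rw [if_neg hc, if_neg hc, ih (by omega) hj]

lemma stages_top {n : ℕ} (y : ℕ → ZMod 2) (i : Fin (2 ^ n)) :
    stages n y n i = polarTransform (fun t : Fin (2 ^ n) => y t) i := by
  rw [stages_eq le_rfl y i.2]
  have := blockTransform_eq (q := 0) i.2 y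
  simpa using this

lemma run_transformProg {B n cnt : ℕ} {a : ℕ → ℕ → ℕ} {y : ℕ → ZMod 2}
    (hB : 2 * 2 ^ n + 2 ≤ B) {s : State} {h : ℕ} (hs : TransformState B (2 ^ n) cnt h a y s) :
    Run B transformProg s (n * (2 ^ n * 20 + 10) + 10) fun s' =>
      TransformState B (2 ^ n) cnt (2 ^ n) a (stages n y n) s' := by
  refine Run.le (Run.seq' (T := 2) (T' := n * (2 ^ n * 20 + 8 + 1) + 1)
    (run_block hs.bdd (by simp; omega) fun hb => ?_)) (by nlinarith)
  refine Run.for (fun k s' => TransformState B (2 ^ n) cnt (2 ^ k) a (stages n y k) s') n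
    (2 ^ n * 20 + 8) ?_ ?_ ?_
  · exact ⟨hb, by simp [hs.r1], by simp [hs.r3], by simp, by simp [hs.arr1, stages],
      fun i hi => by simp [hs.arr i hi]⟩
  · intro k hk t ht
    have hpow : 2 * 2 ^ k ≤ 2 ^ n := by
      rw [← pow_succ']; exact Nat.pow_le_pow_right (by norm_num) hk
    have hpos : 0 < 2 ^ k := by positivity
    refine ⟨by simp [ht.r5, ht.r1]; omega, ?_⟩
    refine Run.le (Run.seq' (T := 4) (T' := 2 ^ n * 20 + 1 + 2)
      (run_block ht.bdd (by simp [ht.r5]; omega) fun ub => ?_)) (by omega)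
    refine Run.seq (run_stageProg hB hpos hpow (y := stages n y k) (cnt := cnt) (a := a) ?_ ?_ ?_ ?_)
      fun u hu => ?_
    · exact ⟨ub, by simp [ht.r1], by simp [ht.r3], by simp [ht.r5], by simp [ht.arr1],
        fun i hi => by simp [ht.arr i hi]⟩
    · simp
    · simp [ht.r5]; ring
    · simp
    · refine run_block hu.1.bdd (by simp) fun vb => ?_
      exact ⟨vb, by simp [hu.1.r1], by simp [hu.1.r3], by simp [hu.2, pow_succ'],
        by simp [hu.1.arr1, stages], fun i hi => by simp [hu.1.arr i hi]⟩
  · intro t ht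
    simp [ht.r5, ht.r1]

/-- Packs the message into array `3`. -/
def packProg : Prog :=
  .seq (block [.set 2 (.const 0), .set 5 (.const 0), .set 6 (.const 0)])
    (.loop (.lt (.reg 2) (.reg 1))
      (.seq (block [.load 4 0 (.reg 2), .load 8 1 (.reg 2), .load 10 2 (.reg 6),
          .sub 11 (.reg 8) (.reg 10), .sub 12 (.reg 10) (.reg 8), .add 2 (.reg 2) (.const 1)])
        (.branch (.lt (.reg 4) (.const 1)) (block [])
          (.branch (.lt (.reg 4) (.const 2))
            (block [.store 3 (.reg 5) (.reg 8), .add 5 (.reg 5) (.const 1)])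
            (block [.add 11 (.reg 11) (.reg 12), .store 3 (.reg 3) (.reg 11),
              .add 3 (.reg 3) (.const 1), .add 6 (.reg 6) (.const 1)])))))

/-- The state of the packing loop. -/
structure PackState (B : ℕ) (p : PMF (ZMod 2)) (β : ℝ) (n : ℕ) (a : ℕ → ℕ → ℕ)
    (m : PolarMsg p β n) (k : ℕ) (s : State) : Prop where
  bdd : s.BoundedBy B
  r1 : s.reg 1 = 2 ^ n
  r2 : s.reg 2 = k
  r3 : s.reg 3 = #(veryHighSet p β n) + rank (padSet p β n) k
  r5 : s.reg 5 = rank (veryHighSet p β n) k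
  r6 : s.reg 6 = rank (padSet p β n) k
  arr : ∀ i ≠ 3, s.arr i = a i
  msg : ∀ j, j < rank (veryHighSet p β n) k → s.arr 3 j = packMsg p β n m j
  pad : ∀ j < rank (padSet p β n) k, s.arr 3 (#(veryHighSet p β n) + j) =
    packMsg p β n m (#(veryHighSet p β n) + j)

/-- The two write positions are the ranks of the current index in `𝒱` and in `ℋ \ 𝒱`, the latter
shifted by `|𝒱|` from `countProg`. They do not collide because a rank in `𝒱` is at most `|𝒱|`. -/
lemma run_packProg {B : ℕ} {p : PMF (ZMod 2)} {β : ℝ} {n : ℕ} (hB : 2 ^ n + 2 ≤ B) {s : State}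
    (hs : s.BoundedBy B) (x : Fin (2 ^ n) → ZMod 2) (u : BitsOn (padSet p β n))
    (h1 : s.reg 1 = 2 ^ n) (h3 : s.reg 3 = #(veryHighSet p β n))
    (a0 : s.arr 0 = indexTable p β n)
    (a1 : ∀ i : Fin (2 ^ n), s.arr 1 i = (polarTransform x i).val)
    (a2 : s.arr 2 = packBits (padSet p β n) u) :
    Run B packProg s (20 * 2 ^ n + 10) fun s' =>
      ∀ k < #(veryHighSet p β n) + #(padSet p β n),
        s'.arr 3 k = packMsg p β n (polarEnc p β n x u) k := by
  set m := polarEnc p β n x u with hm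
  refine Run.le (Run.seq' (T := 4) (T' := 2 ^ n * (19 + 1) + 1)
    (run_block hs (by simp) fun hb => ?_)) (by omega)
  refine Run.mono (Run.for (PackState B p β n s.arr m) (2 ^ n) 19 ?_ ?_ ?_) le_rfl ?_
  · exact ⟨hb, by simp [h1], by simp, by simp [h3, rank_zero], by simp [rank_zero],
      by simp [rank_zero], fun i _ => by simp, fun j hj => by simp [rank_zero] at hj,
      fun j hj => by simp [rank_zero] at hj⟩
  · intro k hk t ht
    refine ⟨by simp [ht.r1, ht.r2, hk], ?_⟩
    set i : Fin (2 ^ n) := ⟨k, hk⟩ with hi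
    have hcard := card_add_card_le (p := p) (β := β) (n := n)
    have hr1 := rank_le (veryHighSet p β n) k
    have hr2 := rank_le (padSet p β n) k
    have ta0 : t.arr 0 k = indexTable p β n i := by rw [ht.arr 0 (by norm_num), a0]
    have ta1 : t.arr 1 k = (polarTransform x i).val := by rw [ht.arr 1 (by norm_num)]; exact a1 i
    have ta2 : t.arr 2 = packBits (padSet p β n) u := by rw [ht.arr 2 (by norm_num), a2]
    have hbit := zmod_two_val_le (polarTransform x i)
    refine Run.le (Run.seq' (T := 7) (T' := 7) (run_block ht.bdd ?_ fun ub => ?_)) (by omega)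
    · simp [ht.r2]; omega
    refine Run.le (Run.branch (T := 6) (fun hc => ?_) fun hc => ?_) (by omega)
    · simp [ht.r2, ta0] at hc
      have hv : i ∉ veryHighSet p β n := fun hv => by
        have := indexTable_veryHigh hv; omega
      have hp : i ∉ padSet p β n := fun hp => by
        have := indexTable_pad hp; omega
      have e1 := rank_succ_of_notMem hv
      have e2 := rank_succ_of_notMem hp
      simp only [hi] at e1 e2
      refine Run.le (run_block ub (by simp) fun vb => ?_) (by simp)
      exact ⟨vb, by simp [ht.r1], by simp [ht.r2], by simp [ht.r3, e2], by simp [ht.r5, e1],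
        by simp [ht.r6, e2], fun i hi => by simp [ht.arr i hi],
        fun j hj => by rw [e1] at hj; simpa using ht.msg j hj,
        fun j hj => by rw [e2] at hj; simpa using ht.pad j hj⟩
    · simp [ht.r2, ta0] at hc
      refine Run.le (Run.branch (T := 5) (fun hc' => ?_) fun hc' => ?_) (by omega)
      · simp [ht.r2, ta0] at hc'
        have hv : i ∈ veryHighSet p β n := by
          by_contra hv
          by_cases hp : i ∈ padSet p β n
          · have := indexTable_pad hp; omega
          · have := indexTable_other hv hp; omega
        have hp := notMem_padSet_of_mem hv
        have e1 := rank_succ_of_mem hv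
        have e2 := rank_succ_of_notMem hp
        have e3 := packMsg_veryHigh m hv
        have e4 := rank_lt hv
        simp only [hi] at e1 e2 e3 e4
        have e5 : (m.1 ⟨⟨k, hk⟩, hv⟩).val = (polarTransform x i).val := rfl
        refine Run.le (run_block ub ?_ fun vb => ?_) (by simp)
        · simp [ht.r5]; omega
        refine ⟨vb, by simp [ht.r1], by simp [ht.r2], by simp [ht.r3, e2], by simp [ht.r5, e1],
          by simp [ht.r6, e2], fun i hi => by simp [hi, ht.arr i hi], fun j hj => ?_,
          fun j hj => ?_⟩
        · rw [e1] at hj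
          by_cases hjk : j = rank (veryHighSet p β n) k
          · simp [ht.r5, ht.r2, hjk, ta1, e3, e5]
          · simp [ht.r5, hjk, ht.msg j (by omega)]
        · rw [e2] at hj
          have : #(veryHighSet p β n) + j ≠ rank (veryHighSet p β n) k := by omega
          simp [ht.r5, this, ht.pad j hj]
      · simp [ht.r2, ta0] at hc'
        have hp : i ∈ padSet p β n := by
          by_contra hp
          by_cases hv : i ∈ veryHighSet p β n
          · have := indexTable_veryHigh hv; omega
          · have := indexTable_other hv hp; omega
        have hv : i ∉ veryHighSet p β n := fun hv => notMem_padSet_of_mem hv hp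
        have e1 := rank_succ_of_notMem hv
        have e2 := rank_succ_of_mem hp
        have e3 := packMsg_pad m hp
        have e4 := rank_lt hp
        have e6 := packBits_rank u hp
        simp only [hi] at e1 e2 e3 e4 e6
        have e5 : (m.2 ⟨⟨k, hk⟩, hp⟩).val = (polarTransform x i + u ⟨i, hp⟩).val := rfl
        have hxor := zmod_two_xor (polarTransform x i) (u ⟨i, hp⟩)
        have hle := zmod_two_val_le (polarTransform x i + u ⟨i, hp⟩)
        simp only [hi] at hxor ta1 e5 hle
        refine Run.le (run_block ub ?_ fun vb => ?_) (by simp)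
        · simp [ht.r2, ht.r3, ht.r6, ta1, ta2, e6, hxor]; omega
        refine ⟨vb, by simp [ht.r1], by simp [ht.r2], by simp [ht.r3, e2, add_assoc],
          by simp [ht.r5, e1], by simp [ht.r6, e2], fun i hi => by simp [hi, ht.arr i hi],
          fun j hj => ?_, fun j hj => ?_⟩
        · rw [e1] at hj
          have : j ≠ #(veryHighSet p β n) + rank (padSet p β n) k := by omega
          simp [ht.r3, this, ht.msg j hj]
        · rw [e2] at hj
          by_cases hjk : j = rank (padSet p β n) k
          · simp [ht.r3, ht.r2, ht.r6, hjk, ta1, ta2, e6, hxor, e3, e5]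
          · simp [ht.r3, hjk, ht.pad j (by omega)]
  · intro t ht
    simp [ht.r1, ht.r2]
  · intro t ht k hk
    by_cases hkv : k < #(veryHighSet p β n)
    · exact ht.msg k (by rwa [rank_top])
    · have := ht.pad (k - #(veryHighSet p β n)) (by rw [rank_top]; omega)
      rwa [Nat.add_sub_cancel' (not_lt.1 hkv)] at this

/-- The program of the encoder. -/
def encodeProg : Prog := .seq countProg (.seq transformProg packProg)

lemma encodesWithin_encodeProg {p : PMF (ZMod 2)} {β : ℝ} {n B T : ℕ} (hB : 2 * 2 ^ n + 2 ≤ B)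
    (hT : 50 * 2 ^ n + 30 * (n * 2 ^ n) + 30 ≤ T) : EncodesWithin encodeProg p β n B T := by
  intro x u
  set y : ℕ → ZMod 2 := fun k => if h : k < 2 ^ n then x ⟨k, h⟩ else 0 with hy
  have hyx : (fun t : Fin (2 ^ n) => y t) = x := by funext t; simp [hy]
  have hpack : packWord x = fun k => (y k).val := by
    funext k
    simp only [packWord, hy]
    split_ifs <;> rfl
  have hbdd : (inputState p β n (packWord x) u).BoundedBy B :=
    inputState_boundedBy (by omega) (by omega) (fun k => by rw [hpack]; exact zmod_two_val_le _) u
  have hpos : 1 ≤ 2 ^ n := Nat.one_le_two_pow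
  have hrun : Run B encodeProg (inputState p β n (packWord x) u)
      ((10 * 2 ^ n + 10) + ((n * (2 ^ n * 20 + 10) + 10) + (20 * 2 ^ n + 10))) fun s' =>
      ∀ k < #(veryHighSet p β n) + #(padSet p β n),
        s'.arr 3 k = packMsg p β n (polarEnc p β n x u) k := by
    refine Run.seq (run_countProg (p := p) (β := β) (n := n) (by omega) hbdd (by simp [inputState])
      (by simp [inputState])) fun s1 h1 => ?_
    obtain ⟨b1, r1, r3, a, -, -⟩ := h1
    refine Run.seq (run_transformProg (y := y) (a := s1.arr) (cnt := s1.reg 3) hB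
      ⟨b1, r1, rfl, rfl, ?_, fun i _ => rfl⟩) fun s2 h2 => ?_
    · rw [a]; simp [inputState, hpack]
    · refine run_packProg (by omega) h2.bdd x u h2.r1 (h2.r3.trans r3) ?_ ?_ ?_
      · rw [h2.arr 0 (by norm_num), a]; simp [inputState]
      · intro i
        rw [h2.arr1]
        simp only [stages_top, hyx]
      · rw [h2.arr 2 (by norm_num), a]; simp [inputState]
  obtain ⟨t, ht, s', he, hq⟩ := hrun
  refine ⟨t, ht.trans (le_trans ?_ hT), s', he, hq⟩
  nlinarith

/-! ### The decoder -/

/-- The state of the decoder: it works on a block of length `h` at the position `base`, which it has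
to decode if `mode = 0`, and has decoded if `mode = 1`.  The measures of the symbols of the block are
in the cells `h, …, 2 h - 1` of the real arrays `0` and `1`. -/
structure DecoderState (B n : ℕ) (kn : ℕ → ℕ) (h base mode : ℕ) (out st : ℕ → ℕ) (W₀ W₁ : ℕ → ℝ)
    (s : State) : Prop where
  bdd : s.BoundedBy B
  r1 : s.reg 1 = 2 ^ n
  r2 : s.reg 2 = h
  r3 : s.reg 3 = base
  r4 : s.reg 4 = mode
  out : s.arr 3 = out
  kn : s.arr 4 = kn
  st : s.arr 5 = st
  half : ∀ j < n, s.arr 6 (2 ^ (j + 1)) = 2 ^ j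
  w0 : s.rarr 0 = W₀
  w1 : s.rarr 1 = W₁

/-- Computes the measures of the sums of the symbols of the two halves; half of the length of the
block is in register `6`. -/
def minusProg : Prog :=
  .seq (block [.set 5 (.const 0)])
    (.loop (.lt (.reg 5) (.reg 6))
      (block [.add 7 (.reg 2) (.reg 5), .add 8 (.reg 7) (.reg 6), .add 9 (.reg 6) (.reg 5),
        .rload 2 0 (.reg 7), .rload 3 1 (.reg 7), .rload 4 0 (.reg 8), .rload 5 1 (.reg 8),
        .rmul 6 2 4, .rmul 7 3 5, .radd 6 6 7, .rstore 0 (.reg 9) 6,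
        .rmul 6 3 4, .rmul 7 2 5, .radd 6 6 7, .rstore 1 (.reg 9) 6,
        .add 5 (.reg 5) (.const 1)]))

/-- Computes the measures of the symbols of the second half of the block of length `2 h` when the
sums of the two halves are in array `3` from the position `base` on; `2 h` is in register `6`. -/
def plusProg : Prog :=
  .seq (block [.set 5 (.const 0)])
    (.loop (.lt (.reg 5) (.reg 2))
      (.seq (block [.add 7 (.reg 6) (.reg 5), .add 8 (.reg 7) (.reg 2), .add 9 (.reg 2) (.reg 5),
          .add 10 (.reg 3) (.reg 5), .load 11 3 (.reg 10),
          .rload 2 0 (.reg 7), .rload 3 1 (.reg 7), .rload 4 0 (.reg 8), .rload 5 1 (.reg 8),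
          .add 5 (.reg 5) (.const 1)])
        (.branch (.lt (.reg 11) (.const 1))
          (block [.rmul 2 2 4, .rmul 3 3 5, .rstore 0 (.reg 9) 2, .rstore 1 (.reg 9) 3])
          (block [.rmul 3 3 4, .rmul 2 2 5, .rstore 0 (.reg 9) 3, .rstore 1 (.reg 9) 2]))))

/-- Adds the second half of a block of length `2 h` to the first one. -/
def combineProg : Prog :=
  .seq (block [.set 5 (.const 0)])
    (.loop (.lt (.reg 5) (.reg 2))
      (block [.add 7 (.reg 3) (.reg 5), .add 8 (.reg 7) (.reg 2), .load 9 3 (.reg 7),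
        .load 10 3 (.reg 8), .sub 11 (.reg 9) (.reg 10), .sub 12 (.reg 10) (.reg 9),
        .add 11 (.reg 11) (.reg 12), .store 3 (.reg 7) (.reg 11), .add 5 (.reg 5) (.const 1)]))

/-- One step of the decoder. -/
def decodeStep : Prog :=
  .branch (.lt (.reg 4) (.const 1))
    (.branch (.lt (.const 1) (.reg 2))
      (.seq (block [.load 6 6 (.reg 2)])
        (.seq minusProg (block [.store 5 (.reg 2) (.const 0), .set 2 (.reg 6)])))
      (.seq (block [.load 7 4 (.reg 3), .rload 2 0 (.const 1), .rload 3 1 (.const 1),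
          .set 4 (.const 1)])
        (.branch (.lt (.reg 7) (.const 2)) (block [.store 3 (.reg 3) (.reg 7)])
          (.branch (.rlt 2 3) (block [.store 3 (.reg 3) (.const 1)])
            (block [.store 3 (.reg 3) (.const 0)])))))
    (.branch (.lt (.reg 2) (.reg 1))
      (.seq (block [.add 6 (.reg 2) (.reg 2), .load 7 5 (.reg 6)])
        (.branch (.lt (.reg 7) (.const 1))
          (.seq plusProg
            (block [.store 5 (.reg 6) (.const 1), .add 3 (.reg 3) (.reg 2), .set 4 (.const 0)]))
          (.seq (block [.sub 3 (.reg 3) (.reg 2)])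
            (.seq combineProg (block [.set 2 (.reg 6)])))))
      (block [.set 4 (.const 2)]))

/-! ### Arithmetic loops of the decoder -/

section Loops

variable {B n : ℕ} {kn : ℕ → ℕ} {h base mode : ℕ} {out st : ℕ → ℕ} {W₀ W₁ : ℕ → ℝ} {s : State}

/-- A block of length `g` owns the cells `g, …, 2 g - 1`. Writing the measures of the half block
thus leaves those of all longer blocks intact, and `plusProg` can read them again later. -/
lemma run_minusProg (hB : 4 * 2 ^ n + 8 ≤ B) {g : ℕ} (hg : 2 * g ≤ 2 ^ n)
    (hs : DecoderState B n kn (2 * g) base mode out st W₀ W₁ s) (h6 : s.reg 6 = g) :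
    Run B minusProg s (g * 18 + 3) fun s' => ∃ W₀' W₁',
      DecoderState B n kn (2 * g) base mode out st W₀' W₁' s' ∧ s'.reg 6 = g ∧
      (∀ j ≥ 2 * g, W₀' j = W₀ j ∧ W₁' j = W₁ j) ∧
      ∀ t < g, W₀' (g + t) = W₀ (2 * g + t) * W₀ (2 * g + t + g) +
          W₁ (2 * g + t) * W₁ (2 * g + t + g) ∧
        W₁' (g + t) = W₁ (2 * g + t) * W₀ (2 * g + t + g) +
          W₀ (2 * g + t) * W₁ (2 * g + t + g) := by
  refine Run.le (Run.seq' (T := 2) (T' := g * (17 + 1) + 1)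
    (run_block hs.bdd (by simp) fun hb => ?_)) (by omega)
  refine Run.mono (Run.for (fun k s' => ∃ W₀' W₁',
      DecoderState B n kn (2 * g) base mode out st W₀' W₁' s' ∧ s'.reg 5 = k ∧ s'.reg 6 = g ∧
      (∀ j ≥ 2 * g, W₀' j = W₀ j ∧ W₁' j = W₁ j) ∧
      ∀ t < k, W₀' (g + t) = W₀ (2 * g + t) * W₀ (2 * g + t + g) +
          W₁ (2 * g + t) * W₁ (2 * g + t + g) ∧
        W₁' (g + t) = W₁ (2 * g + t) * W₀ (2 * g + t + g) +
          W₀ (2 * g + t) * W₁ (2 * g + t + g)) g 17 ?_ ?_ ?_) le_rfl ?_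
  · exact ⟨W₀, W₁, ⟨hb, by simp [hs.r1], by simp [hs.r2], by simp [hs.r3], by simp [hs.r4],
      by simp [hs.out], by simp [hs.kn], by simp [hs.st], by simpa using hs.half, by simp [hs.w0],
      by simp [hs.w1]⟩, by simp, by simp [h6], fun j _ => ⟨rfl, rfl⟩, fun t ht => by omega⟩
  · rintro k hk u ⟨W₀', W₁', hu, u5, u6, hfar, hnear⟩
    refine ⟨by simp [u5, u6, hk], ?_⟩
    refine Run.le (run_block hu.bdd ?_ fun vb => ?_) (by simp)
    · simp [hu.r2, u5, u6]; omega
    have f1 := hfar (2 * g + k) (by omega)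
    have f2 := hfar (2 * g + k + g) (by omega)
    refine ⟨_, _, ⟨vb, by simp [hu.r1], by simp [hu.r2], by simp [hu.r3], by simp [hu.r4],
      by simp [hu.out], by simp [hu.kn], by simp [hu.st], by simpa using hu.half, rfl, rfl⟩,
      by simp [u5], by simp [u6], fun j hj => ?_, fun t ht => ?_⟩
    · have : j ≠ g + k := by omega
      simp [u5, u6, this, hu.w0, hu.w1, hfar j hj]
    · by_cases htk : t = k
      · subst htk
        simp [u5, u6, hu.r2, hu.w0, hu.w1, f1, f2]
      · have := hnear t (by omega)
        simp [u5, u6, htk, hu.w0, hu.w1, this]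
  · rintro u ⟨W₀', W₁', hu, u5, u6, -⟩
    simp [u5, u6]
  · rintro u ⟨W₀', W₁', hu, u5, u6, hfar, hnear⟩
    exact ⟨W₀', W₁', hu, u6, hfar, hnear⟩

lemma run_plusProg (hB : 4 * 2 ^ n + 8 ≤ B) (hg : 2 * h ≤ 2 ^ n) (hbase : base + h ≤ 2 ^ n)
    (hs : DecoderState B n kn h base mode out st W₀ W₁ s) (h6 : s.reg 6 = 2 * h) :
    Run B plusProg s (h * 20 + 3) fun s' => ∃ W₀' W₁',
      DecoderState B n kn h base mode out st W₀' W₁' s' ∧ s'.reg 6 = 2 * h ∧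
      (∀ j ≥ 2 * h, W₀' j = W₀ j ∧ W₁' j = W₁ j) ∧
      ∀ t < h, W₀' (h + t) = (if out (base + t) < 1 then W₀ (2 * h + t) else W₁ (2 * h + t)) *
          W₀ (2 * h + t + h) ∧
        W₁' (h + t) = (if out (base + t) < 1 then W₁ (2 * h + t) else W₀ (2 * h + t)) *
          W₁ (2 * h + t + h) := by
  refine Run.le (Run.seq' (T := 2) (T' := h * (19 + 1) + 1)
    (run_block hs.bdd (by simp) fun hb => ?_)) (by omega)
  refine Run.mono (Run.for (fun k s' => ∃ W₀' W₁',
      DecoderState B n kn h base mode out st W₀' W₁' s' ∧ s'.reg 5 = k ∧ s'.reg 6 = 2 * h ∧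
      (∀ j ≥ 2 * h, W₀' j = W₀ j ∧ W₁' j = W₁ j) ∧
      ∀ t < k, W₀' (h + t) = (if out (base + t) < 1 then W₀ (2 * h + t) else W₁ (2 * h + t)) *
          W₀ (2 * h + t + h) ∧
        W₁' (h + t) = (if out (base + t) < 1 then W₁ (2 * h + t) else W₀ (2 * h + t)) *
          W₁ (2 * h + t + h)) h 19 ?_ ?_ ?_) le_rfl ?_
  · exact ⟨W₀, W₁, ⟨hb, by simp [hs.r1], by simp [hs.r2], by simp [hs.r3], by simp [hs.r4],
      by simp [hs.out], by simp [hs.kn], by simp [hs.st], by simpa using hs.half, by simp [hs.w0],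
      by simp [hs.w1]⟩, by simp, by simp [h6], fun j _ => ⟨rfl, rfl⟩, fun t ht => by omega⟩
  · rintro k hk u ⟨W₀', W₁', hu, u5, u6, hfar, hnear⟩
    refine ⟨by simp [u5, hu.r2, hk], ?_⟩
    have f1 := hfar (2 * h + k) (by omega)
    have f2 := hfar (2 * h + k + h) (by omega)
    refine Run.le (Run.seq' (T := 11) (T' := 6) (run_block hu.bdd ?_ fun vb => ?_)) (by omega)
    · simp [hu.r2, hu.r3, u5, u6]; omega
    refine Run.branch (T := 5) (fun hc => ?_) fun hc => ?_
    all_goals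
      simp [u5, hu.r3, hu.out] at hc
      refine Run.le (run_block vb (by simp) fun wb => ?_) (by simp)
      refine ⟨_, _, ⟨wb, by simp [hu.r1], by simp [hu.r2], by simp [hu.r3], by simp [hu.r4],
        by simp [hu.out], by simp [hu.kn], by simp [hu.st], by simpa using hu.half, rfl, rfl⟩,
        by simp [u5], by simp [u6], fun j hj => ?_, fun t ht => ?_⟩
      · have : j ≠ h + k := by omega
        simp [u5, hu.r2, this, hu.w0, hu.w1, hfar j hj]
      · by_cases htk : t = k
        · subst htk
          simp [u5, u6, hu.r2, hu.w0, hu.w1, f1, f2, hc]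
        · have := hnear t (by omega)
          simp [u5, hu.r2, htk, hu.w0, hu.w1, this]
  · rintro u ⟨W₀', W₁', hu, u5, u6, -⟩
    simp [u5, hu.r2]
  · rintro u ⟨W₀', W₁', hu, u5, u6, hfar, hnear⟩
    exact ⟨W₀', W₁', hu, u6, hfar, hnear⟩

lemma run_combineProg (hB : 4 * 2 ^ n + 8 ≤ B) (hbase : base + 2 * h ≤ 2 ^ n)
    (hs : DecoderState B n kn h base mode out st W₀ W₁ s) (h6 : s.reg 6 = 2 * h) :
    Run B combineProg s (h * 12 + 3) fun s' => s'.reg 6 = 2 * h ∧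
      DecoderState B n kn h base mode (fun j => if base ≤ j ∧ j < base + h then
        out j - out (j + h) + (out (j + h) - out j) else out j) st W₀ W₁ s' := by
  refine Run.le (Run.seq' (T := 2) (T' := h * (11 + 1) + 1)
    (run_block hs.bdd (by simp) fun hb => ?_)) (by omega)
  have hout : ∀ j, out j ≤ B := fun j => by rw [← hs.out]; exact hs.bdd.2 3 j
  refine Run.mono (Run.for (fun k s' => DecoderState B n kn h base mode
      (fun j => if base ≤ j ∧ j < base + k then out j - out (j + h) + (out (j + h) - out j)
        else out j) st W₀ W₁ s' ∧ s'.reg 5 = k ∧ s'.reg 6 = 2 * h) h 11 ?_ ?_ ?_) le_rfl ?_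
  · refine ⟨⟨hb, by simp [hs.r1], by simp [hs.r2], by simp [hs.r3], by simp [hs.r4],
      ?_, by simp [hs.kn], by simp [hs.st], by simpa using hs.half, by simp [hs.w0],
      by simp [hs.w1]⟩, by simp, by simp [h6]⟩
    funext j
    rw [if_neg (by omega)]
    simp [hs.out]
  · rintro k hk u ⟨hu, u5, u6⟩
    refine ⟨by simp [u5, hu.r2, hk], ?_⟩
    have o1 : u.arr 3 (base + k) = out (base + k) := by rw [hu.out]; simp
    have o2 : u.arr 3 (base + k + h) = out (base + k + h) := by
      rw [hu.out]; exact if_neg (by omega)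
    refine Run.le (run_block hu.bdd ?_ fun vb => ?_) (by simp)
    -- The sum of the two truncated differences is at most the larger entry, so the bound holds even
    -- if the entries are not bits.
    · have b1 := hout (base + k)
      have b2 := hout (base + k + h)
      simp [hu.r2, hu.r3, u5, o1, o2]; omega
    refine ⟨⟨vb, by simp [hu.r1], by simp [hu.r2], by simp [hu.r3], by simp [hu.r4],
      ?_, by simp [hu.kn], by simp [hu.st], by simpa using hu.half, by simp [hu.w0],
      by simp [hu.w1]⟩, by simp [u5], by simp [u6]⟩
    funext j
    by_cases hj : j = base + k
    · subst hj
      rw [if_pos (by omega)]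
      simp [hu.r2, hu.r3, u5, o1, o2]
    · have : (base ≤ j ∧ j < base + (k + 1)) ↔ (base ≤ j ∧ j < base + k) := by omega
      simp [hu.r3, u5, hj, this, hu.out]
  · rintro u ⟨hu, u5, u6⟩
    simp [u5, hu.r2]
  · rintro u ⟨hu, u5, u6⟩
    exact ⟨u6, hu⟩

end Loops

/-! ### Reading the arrays of the decoder as measures and words -/

/-- The measures of the symbols of a block of length `2 ^ ℓ`. -/
def blockW (ℓ : ℕ) (W₀ W₁ : ℕ → ℝ) (k : Fin (2 ^ ℓ)) (b : ZMod 2) : ℝ :=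
  if b = 0 then W₀ (2 ^ ℓ + k) else W₁ (2 ^ ℓ + k)

/-- The bits of a block that are known to the receiver; unknown bits are encoded by `2`. -/
def blockKnown (kn : ℕ → ℕ) (base ℓ : ℕ) (k : Fin (2 ^ ℓ)) : Option (ZMod 2) :=
  if kn (base + k) < 2 then some (kn (base + k) : ZMod 2) else none

/-- The sequence `out` with the bits `x` from the position `base` on. -/
def writeBits {ℓ : ℕ} (base : ℕ) (x : Fin (2 ^ ℓ) → ZMod 2) (out : ℕ → ℕ) (j : ℕ) : ℕ :=
  if h : base ≤ j ∧ j < base + 2 ^ ℓ then (x ⟨j - base, by omega⟩).val else out j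

lemma writeBits_apply {ℓ base : ℕ} (x : Fin (2 ^ ℓ) → ZMod 2) (out : ℕ → ℕ) (k : Fin (2 ^ ℓ)) :
    writeBits base x out (base + k) = (x k).val := by
  have := k.isLt
  rw [writeBits, dif_pos (by omega)]
  congr 2
  exact Fin.ext (Nat.add_sub_cancel_left _ _)

lemma writeBits_of_not {ℓ base : ℕ} (x : Fin (2 ^ ℓ) → ZMod 2) (out : ℕ → ℕ) {j : ℕ}
    (h : ¬ (base ≤ j ∧ j < base + 2 ^ ℓ)) : writeBits base x out j = out j := dif_neg h

lemma zmod_two_cases (b : ZMod 2) : b = 0 ∨ b = 1 := by revert b; decide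

lemma blockW_minus {ℓ : ℕ} {W₀ W₁ W₀' W₁' : ℕ → ℝ}
    (h : ∀ t < 2 ^ ℓ, W₀' (2 ^ ℓ + t) = W₀ (2 * 2 ^ ℓ + t) * W₀ (2 * 2 ^ ℓ + t + 2 ^ ℓ) +
          W₁ (2 * 2 ^ ℓ + t) * W₁ (2 * 2 ^ ℓ + t + 2 ^ ℓ) ∧
        W₁' (2 ^ ℓ + t) = W₁ (2 * 2 ^ ℓ + t) * W₀ (2 * 2 ^ ℓ + t + 2 ^ ℓ) +
          W₀ (2 * 2 ^ ℓ + t) * W₁ (2 * 2 ^ ℓ + t + 2 ^ ℓ)) :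
    blockW ℓ W₀' W₁' = minusW (blockW (ℓ + 1) W₀ W₁) := by
  funext k b
  have hk := h k k.isLt
  have e1 : 2 ^ (ℓ + 1) + (lo k).val = 2 * 2 ^ ℓ + k := by rw [lo_val, pow_succ']
  have e2 : 2 ^ (ℓ + 1) + (hi k).val = 2 * 2 ^ ℓ + k + 2 ^ ℓ := by rw [hi_val, pow_succ']; ring
  rcases zmod_two_cases b with rfl | rfl
  · simp only [minusW, blockW, e1, e2, zero_add, if_true, one_ne_zero, if_false]
    exact hk.1
  · simp only [minusW, blockW, e1, e2, SideSource.zmod_two_one_add_one, if_true, one_ne_zero,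
      if_false]
    exact hk.2

lemma blockW_plus {ℓ base : ℕ} {W₀ W₁ W₀' W₁' : ℕ → ℝ} {u : Fin (2 ^ ℓ) → ZMod 2} {out : ℕ → ℕ}
    (hu : ∀ k : Fin (2 ^ ℓ), out (base + k) = (u k).val)
    (h : ∀ t < 2 ^ ℓ, W₀' (2 ^ ℓ + t) =
          (if out (base + t) < 1 then W₀ (2 * 2 ^ ℓ + t) else W₁ (2 * 2 ^ ℓ + t)) *
            W₀ (2 * 2 ^ ℓ + t + 2 ^ ℓ) ∧
        W₁' (2 ^ ℓ + t) =
          (if out (base + t) < 1 then W₁ (2 * 2 ^ ℓ + t) else W₀ (2 * 2 ^ ℓ + t)) *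
            W₁ (2 * 2 ^ ℓ + t + 2 ^ ℓ)) :
    blockW ℓ W₀' W₁' = plusW (blockW (ℓ + 1) W₀ W₁) u := by
  funext k b
  have hk := h k k.isLt
  rw [hu] at hk
  have e1 : 2 ^ (ℓ + 1) + (lo k).val = 2 * 2 ^ ℓ + k := by rw [lo_val, pow_succ']
  have e2 : 2 ^ (ℓ + 1) + (hi k).val = 2 * 2 ^ ℓ + k + 2 ^ ℓ := by rw [hi_val, pow_succ']; ring
  have v0 : ((0 : ZMod 2)).val < 1 := by decide
  have v1 : ¬ ((1 : ZMod 2)).val < 1 := by decide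
  rcases zmod_two_cases (u k) with hu | hu <;> rcases zmod_two_cases b with rfl | rfl <;>
    simp only [hu, v0, v1, if_true, if_false] at hk <;>
    simp only [plusW, blockW, e1, e2, hu, SideSource.zmod_two_one_add_one, zero_add, add_zero,
      if_true, one_ne_zero, if_false]
  exacts [hk.1, hk.2, hk.1, hk.2]

lemma writeBits_combine {ℓ base : ℕ} (u v : Fin (2 ^ ℓ) → ZMod 2) (out : ℕ → ℕ) :
    (fun j => if base ≤ j ∧ j < base + 2 ^ ℓ then
      writeBits (base + 2 ^ ℓ) v (writeBits base u out) j -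
        writeBits (base + 2 ^ ℓ) v (writeBits base u out) (j + 2 ^ ℓ) +
        (writeBits (base + 2 ^ ℓ) v (writeBits base u out) (j + 2 ^ ℓ) -
        writeBits (base + 2 ^ ℓ) v (writeBits base u out) j)
      else writeBits (base + 2 ^ ℓ) v (writeBits base u out) j) =
    writeBits base (glue (fun k => u k + v k) v) out := by
  funext j
  have hp : 2 ^ (ℓ + 1) = 2 ^ ℓ + 2 ^ ℓ := by rw [pow_succ]; ring
  by_cases h1 : base ≤ j ∧ j < base + 2 ^ ℓ
  · obtain ⟨t, rfl⟩ := Nat.exists_eq_add_of_le h1.1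
    set k : Fin (2 ^ ℓ) := ⟨t, by omega⟩ with hk
    rw [if_pos h1]
    have e1 : writeBits (base + 2 ^ ℓ) v (writeBits base u out) (base + t) = (u k).val := by
      rw [writeBits_of_not _ _ (by omega)]
      exact writeBits_apply u out k
    have e2 : writeBits (base + 2 ^ ℓ) v (writeBits base u out) (base + t + 2 ^ ℓ) = (v k).val := by
      rw [show base + t + 2 ^ ℓ = base + 2 ^ ℓ + k.val by simp only [hk]; ring]
      exact writeBits_apply v _ k
    rw [e1, e2, zmod_two_xor]
    have := writeBits_apply (base := base) (glue (fun k => u k + v k) v) out (lo k)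
    rw [lo_val, glue_lo] at this
    exact this.symm
  · rw [if_neg h1]
    by_cases h2 : base + 2 ^ ℓ ≤ j ∧ j < base + 2 ^ ℓ + 2 ^ ℓ
    · obtain ⟨t, rfl⟩ := Nat.exists_eq_add_of_le h2.1
      set k : Fin (2 ^ ℓ) := ⟨t, by omega⟩ with hk
      have := writeBits_apply (base := base) (glue (fun k => u k + v k) v) out (hi k)
      rw [hi_val, glue_hi, ← add_assoc] at this
      exact (writeBits_apply v _ k).trans this.symm
    · rw [writeBits_of_not _ _ h2, writeBits_of_not _ _ h1, writeBits_of_not _ _ (by omega)]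

/-! ### The decoder loop carries out the recursion -/

section Steps

variable {B n ℓ : ℕ} {kn : ℕ → ℕ} {base : ℕ} {out st : ℕ → ℕ} {W₀ W₁ : ℕ → ℝ} {s : State}

/-- Descent to the first half. The half length comes from a table since the machine has no division,
and cell `2 ^ (ℓ + 1)` of array `5` records that the first half is being visited. -/
lemma run_step_split (hB : 4 * 2 ^ n + 8 ≤ B) (hℓ : ℓ + 1 ≤ n)
    (hs : DecoderState B n kn (2 ^ (ℓ + 1)) base 0 out st W₀ W₁ s) :
    Run B decodeStep s (2 ^ ℓ * 18 + 10) fun s' => ∃ W₀' W₁',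
      DecoderState B n kn (2 ^ ℓ) base 0 out (Function.update st (2 ^ (ℓ + 1)) 0) W₀' W₁' s' ∧
      (∀ j ≥ 2 ^ (ℓ + 1), W₀' j = W₀ j ∧ W₁' j = W₁ j) ∧
      blockW ℓ W₀' W₁' = minusW (blockW (ℓ + 1) W₀ W₁) := by
  have hp : 2 ^ (ℓ + 1) = 2 * 2 ^ ℓ := pow_succ' 2 ℓ
  have hpos : 0 < 2 ^ ℓ := by positivity
  have hle : 2 * 2 ^ ℓ ≤ 2 ^ n := by rw [← hp]; exact Nat.pow_le_pow_right (by norm_num) hℓ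
  have hhalf : s.arr 6 (2 ^ (ℓ + 1)) = 2 ^ ℓ := hs.half ℓ hℓ
  refine Run.le (Run.branch (T := 2 ^ ℓ * 18 + 9) (fun _ => ?_) fun hc => ?_) (by omega)
  swap
  · simp [hs.r4] at hc
  refine Run.branch (T := 2 ^ ℓ * 18 + 8) (fun _ => ?_) fun hc => ?_
  swap
  · simp only [Test.holds, Operand.eval, hs.r2] at hc; omega
  refine Run.le (Run.seq' (T := 2) (T' := 2 ^ ℓ * 18 + 3 + 3)
    (run_block hs.bdd (by simp) fun ub => ?_)) (by omega)
  refine Run.seq (run_minusProg (W₀ := W₀) (W₁ := W₁) (base := base) (mode := 0) (out := out)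
    (st := st) (kn := kn) hB hle ⟨ub, by simp [hs.r1],
    by simp [hs.r2, hp], by simp [hs.r3], by simp [hs.r4], by simp [hs.out], by simp [hs.kn],
    by simp [hs.st], by simpa using hs.half, by simp [hs.w0], by simp [hs.w1]⟩
    (by simp [hs.r2, hhalf])) ?_
  rintro u ⟨W₀', W₁', hu, u6, hfar, hnear⟩
  refine Run.le (run_block hu.bdd (by simp) fun vb => ?_) (by simp)
  rw [hp]
  exact ⟨W₀', W₁', ⟨vb, by simp [hu.r1], by simp [u6], by simp [hu.r3], by simp [hu.r4],
    by simp [hu.out], by simp [hu.kn], by simp [hu.st, hu.r2], by simpa using hu.half,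
    by simp [hu.w0], by simp [hu.w1]⟩, hfar, blockW_minus hnear⟩

lemma run_plus_descend (hB : 4 * 2 ^ n + 8 ≤ B) (hle : 2 * 2 ^ ℓ ≤ 2 ^ n)
    (hbase : base + 2 * 2 ^ ℓ ≤ 2 ^ n) {u : Fin (2 ^ ℓ) → ZMod 2}
    (hs : DecoderState B n kn (2 ^ ℓ) base 1 (writeBits base u out) st W₀ W₁ s)
    (h6 : s.reg 6 = 2 * 2 ^ ℓ) :
    Run B (.seq plusProg
      (block [.store 5 (.reg 6) (.const 1), .add 3 (.reg 3) (.reg 2), .set 4 (.const 0)])) s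
      (2 ^ ℓ * 20 + 3 + 4) fun s' => ∃ W₀' W₁',
      DecoderState B n kn (2 ^ ℓ) (base + 2 ^ ℓ) 0 (writeBits base u out)
        (Function.update st (2 * 2 ^ ℓ) 1) W₀' W₁' s' ∧
      (∀ j ≥ 2 * 2 ^ ℓ, W₀' j = W₀ j ∧ W₁' j = W₁ j) ∧
      blockW ℓ W₀' W₁' = plusW (blockW (ℓ + 1) W₀ W₁) u := by
  have hpos : 0 < 2 ^ ℓ := by positivity
  refine Run.seq (run_plusProg hB hle (by omega) hs h6) ?_
  rintro v ⟨W₀', W₁', hv, v6, hfar, hnear⟩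
  refine Run.le (run_block hv.bdd (by simp [hv.r3, hv.r2]; omega) fun wb => ?_) (by simp)
  exact ⟨W₀', W₁', ⟨wb, by simp [hv.r1], by simp [hv.r2], by simp [hv.r3, hv.r2], by simp,
    by simp [hv.out], by simp [hv.kn], by simp [hv.st, v6], by simpa using hv.half,
    by simp [hv.w0], by simp [hv.w1]⟩, hfar, blockW_plus (fun k => writeBits_apply u out k) hnear⟩

/-- Return from a first half, recognized by the mark `0` of the parent. The decoded word is exactly
the word of sums that `plusW` needs, so no transform has to be recomputed. -/
lemma run_step_second (hB : 4 * 2 ^ n + 8 ≤ B) (hℓ : ℓ + 1 ≤ n)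
    (hbase : base + 2 ^ (ℓ + 1) ≤ 2 ^ n) (hst : st (2 ^ (ℓ + 1)) = 0) {u : Fin (2 ^ ℓ) → ZMod 2}
    (hs : DecoderState B n kn (2 ^ ℓ) base 1 (writeBits base u out) st W₀ W₁ s) :
    Run B decodeStep s (2 ^ ℓ * 20 + 15) fun s' => ∃ W₀' W₁',
      DecoderState B n kn (2 ^ ℓ) (base + 2 ^ ℓ) 0 (writeBits base u out)
        (Function.update st (2 ^ (ℓ + 1)) 1) W₀' W₁' s' ∧
      (∀ j ≥ 2 ^ (ℓ + 1), W₀' j = W₀ j ∧ W₁' j = W₁ j) ∧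
      blockW ℓ W₀' W₁' = plusW (blockW (ℓ + 1) W₀ W₁) u := by
  have hp : 2 ^ (ℓ + 1) = 2 * 2 ^ ℓ := pow_succ' 2 ℓ
  have hpos : 0 < 2 ^ ℓ := by positivity
  have hle : 2 * 2 ^ ℓ ≤ 2 ^ n := by rw [← hp]; exact Nat.pow_le_pow_right (by norm_num) hℓ
  have h2 : 2 ^ ℓ + 2 ^ ℓ = 2 * 2 ^ ℓ := by ring
  rw [hp] at hst hbase ⊢
  refine Run.le (Run.branch (T := 2 ^ ℓ * 20 + 14) (fun hc => ?_) fun _ => ?_) (by omega)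
  · simp [hs.r4] at hc
  refine Run.branch (T := 2 ^ ℓ * 20 + 13) (fun _ => ?_) fun hc => ?_
  swap
  · simp only [Test.holds, Operand.eval, hs.r2, hs.r1] at hc; omega
  refine Run.le (Run.seq' (T := 3) (T' := 2 ^ ℓ * 20 + 3 + 4 + 1)
    (run_block hs.bdd (by simp [hs.r2]; omega) fun ub => ?_)) (by omega)
  refine Run.branch (fun _ => ?_) fun hc => ?_
  swap
  · simp [hs.r2, h2, hs.st, hst] at hc
  have h6 : (execList s [.add 6 (.reg 2) (.reg 2), .load 7 5 (.reg 6)]).reg 6 = 2 * 2 ^ ℓ := by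
    simp [hs.r2, h2]
  refine run_plus_descend hB hle hbase ?_ h6
  exact ⟨ub, by simp [hs.r1], by simp [hs.r2], by simp [hs.r3], by simp [hs.r4], by simp [hs.out],
    by simp [hs.kn], by simp [hs.st], by simpa using hs.half, by simp [hs.w0], by simp [hs.w1]⟩

/-- Return from a second half, recognized by the mark `1` of the parent. The parent's word is `(u +
v, v)`. -/
lemma run_step_combine (hB : 4 * 2 ^ n + 8 ≤ B) (hℓ : ℓ + 1 ≤ n)
    (hbase : base + 2 ^ (ℓ + 1) ≤ 2 ^ n) (hst : st (2 ^ (ℓ + 1)) = 1)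
    {u v : Fin (2 ^ ℓ) → ZMod 2}
    (hs : DecoderState B n kn (2 ^ ℓ) (base + 2 ^ ℓ) 1
      (writeBits (base + 2 ^ ℓ) v (writeBits base u out)) st W₀ W₁ s) :
    Run B decodeStep s (2 ^ ℓ * 12 + 15) fun s' =>
      DecoderState B n kn (2 ^ (ℓ + 1)) base 1
        (writeBits base (glue (fun k => u k + v k) v) out) st W₀ W₁ s' := by
  have hp : 2 ^ (ℓ + 1) = 2 * 2 ^ ℓ := pow_succ' 2 ℓ
  have hpos : 0 < 2 ^ ℓ := by positivity
  have hle : 2 * 2 ^ ℓ ≤ 2 ^ n := by rw [← hp]; exact Nat.pow_le_pow_right (by norm_num) hℓ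
  have h2 : 2 ^ ℓ + 2 ^ ℓ = 2 * 2 ^ ℓ := by ring
  rw [hp] at hst hbase
  refine Run.le (Run.branch (T := 2 ^ ℓ * 12 + 14) (fun hc => ?_) fun _ => ?_) (by omega)
  · simp [hs.r4] at hc
  refine Run.branch (T := 2 ^ ℓ * 12 + 13) (fun _ => ?_) fun hc => ?_
  swap
  · simp only [Test.holds, Operand.eval, hs.r2, hs.r1] at hc; omega
  refine Run.le (Run.seq' (T := 3) (T' := 2 + (2 ^ ℓ * 12 + 3 + 2) + 1)
    (run_block hs.bdd (by simp [hs.r2]; omega) fun ub => ?_)) (by omega)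
  refine Run.branch (fun hc => ?_) fun _ => ?_
  · simp [hs.r2, h2, hs.st, hst] at hc
  refine Run.seq' (run_block ub (by simp) fun vb => ?_)
  refine Run.seq (run_combineProg (h := 2 ^ ℓ) (W₀ := W₀) (W₁ := W₁) (base := base) (mode := 1)
    (out := writeBits (base + 2 ^ ℓ) v (writeBits base u out)) (st := st) (kn := kn) hB hbase
    ⟨vb, by simp [hs.r1],
    by simp [hs.r2], by simp [hs.r3, hs.r2], by simp [hs.r4], by simp [hs.out], by simp [hs.kn],
    by simp [hs.st], by simpa using hs.half, by simp [hs.w0], by simp [hs.w1]⟩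
    (by simp [hs.r2, h2])) ?_
  rintro w ⟨w6, hw⟩
  rw [writeBits_combine] at hw
  refine Run.le (run_block hw.bdd (by simp) fun xb => ?_) (by simp)
  exact ⟨xb, by simp [hw.r1], by simp [w6, hp], by simp [hw.r3], by simp [hw.r4],
    by simp [hw.out], by simp [hw.kn], by simp [hw.st], by simpa using hw.half,
    by simp [hw.w0], by simp [hw.w1]⟩

/-- A block of length `1` has its two masses in cell `1` of the real arrays. The code `2` stands for
an unknown bit, and the strict comparison returns `0` on ties. -/
lemma run_step_leaf (hB : 4 * 2 ^ n + 8 ≤ B)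
    (hs : DecoderState B n kn (2 ^ 0) base 0 out st W₀ W₁ s) :
    Run B decodeStep s 20 fun s' => DecoderState B n kn (2 ^ 0) base 1
      (writeBits base (cancelWord 0 (blockW 0 W₀ W₁) (blockKnown kn base 0)) out) st W₀ W₁ s' := by
  refine Run.le (Run.branch (T := 12) (fun _ => ?_) fun hc => ?_) (by omega)
  swap
  · simp [hs.r4] at hc
  refine Run.branch (T := 11) (fun hc => ?_) fun _ => ?_
  · simp [hs.r2] at hc
  have hwrite : ∀ b : ℕ, b = (decideBit (blockKnown kn base 0 0) (W₀ 1) (W₁ 1)).val →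
      writeBits base (cancelWord 0 (blockW 0 W₀ W₁) (blockKnown kn base 0)) out =
        Function.update out base b := by
    rintro b rfl
    funext j
    by_cases hj : j = base
    · subst hj
      rw [Function.update_self]
      exact writeBits_apply _ out 0
    · rw [Function.update_of_ne hj]
      exact writeBits_of_not _ _ (by rw [pow_zero]; omega)
  have hfin : ∀ (u : State) (e : Operand), e.eval u =
      (decideBit (blockKnown kn base 0 0) (W₀ 1) (W₁ 1)).val → e.ConstLe B →
      DecoderState B n kn (2 ^ 0) base 1 out st W₀ W₁ u →
      Run B (block [.store 3 (.reg 3) e]) u 2 fun s' => DecoderState B n kn (2 ^ 0) base 1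
        (writeBits base (cancelWord 0 (blockW 0 W₀ W₁) (blockKnown kn base 0)) out) st W₀ W₁ s' := by
    intro u e he hle hu
    refine run_block hu.bdd ⟨hle, trivial⟩ fun vb => ?_
    rw [hwrite _ he]
    exact ⟨vb, by simp [hu.r1], by simp [hu.r2], by simp [hu.r3], by simp [hu.r4],
      by simp [hu.out, hu.r3], by simp [hu.kn], by simp [hu.st], by simpa using hu.half,
      by simp [hu.w0], by simp [hu.w1]⟩
  refine Run.le (Run.seq' (T := 5) (T' := 5) (run_block hs.bdd (by simp; omega) fun ub => ?_))
    (by omega)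
  set u := execList s [.load 7 4 (.reg 3), .rload 2 0 (.const 1), .rload 3 1 (.const 1),
          .set 4 (.const 1)] with hu
  have hu' : DecoderState B n kn (2 ^ 0) base 1 out st W₀ W₁ u :=
    ⟨ub, by simp [hu, hs.r1], by simp [hu, hs.r2], by simp [hu, hs.r3], by simp [hu],
      by simp [hu, hs.out], by simp [hu, hs.kn], by simp [hu, hs.st], by simpa [hu] using hs.half,
      by simp [hu, hs.w0], by simp [hu, hs.w1]⟩
  have u7 : u.reg 7 = kn base := by simp [hu, hs.r3, hs.kn]
  have ur2 : u.rreg 2 = W₀ 1 := by simp [hu, hs.w0]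
  have ur3 : u.rreg 3 = W₁ 1 := by simp [hu, hs.w1]
  clear_value u
  refine Run.le (Run.branch (T := 3) (fun hc => ?_) fun hc => ?_) (by omega)
  · simp only [Test.holds, Operand.eval, u7] at hc
    refine Run.le (hfin u (.reg 7) ?_ trivial hu') (by omega)
    simp only [Operand.eval, u7, blockKnown, decideBit]
    simp [hc, ZMod.val_natCast, Nat.mod_eq_of_lt hc]
  · simp only [Test.holds, Operand.eval, u7] at hc
    have hk : blockKnown kn base 0 0 = none := by simp [blockKnown]; omega
    refine Run.branch (T := 2) (fun hc' => ?_) fun hc' => ?_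
    · simp only [Test.holds, ur2, ur3] at hc'
      refine hfin u (.const 1) ?_ (by simp; omega) hu'
      simp [hk, decideBit, likelyBit, hc']
      rfl
    · simp only [Test.holds, ur2, ur3] at hc'
      refine hfin u (.const 0) ?_ (by simp) hu'
      simp [hk, decideBit, likelyBit, hc']

lemma blockKnown_lo (kn : ℕ → ℕ) (base ℓ : ℕ) :
    (fun j => blockKnown kn base (ℓ + 1) (lo j)) = blockKnown kn base ℓ := by
  funext j; simp [blockKnown]

lemma blockKnown_hi (kn : ℕ → ℕ) (base ℓ : ℕ) :
    (fun j => blockKnown kn base (ℓ + 1) (hi j)) = blockKnown kn (base + 2 ^ ℓ) ℓ := by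
  funext j; simp [blockKnown, add_assoc]

lemma blockW_congr {W₀' W₁' : ℕ → ℝ} (h : ∀ j ≥ 2 ^ ℓ, W₀' j = W₀ j ∧ W₁' j = W₁ j) :
    blockW ℓ W₀' W₁' = blockW ℓ W₀ W₁ := by
  funext k b
  have := h (2 ^ ℓ + k) (by omega)
  simp only [blockW, this.1, this.2]

/-- The steps of the decoder between a visit of a block and the return from it. -/
lemma iter_decodeStep (hB : 4 * 2 ^ n + 8 ≤ B) (hℓ : ℓ ≤ n) (hbase : base + 2 ^ ℓ ≤ 2 ^ n)
    (hs : DecoderState B n kn (2 ^ ℓ) base 0 out st W₀ W₁ s) :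
    Iter B (.lt (.reg 4) (.const 2)) decodeStep s (100 * (2 ^ ℓ * (ℓ + 1))) fun s' =>
      ∃ st' W₀' W₁', DecoderState B n kn (2 ^ ℓ) base 1
        (writeBits base (cancelWord ℓ (blockW ℓ W₀ W₁) (blockKnown kn base ℓ)) out) st' W₀' W₁' s' ∧
        (∀ j > 2 ^ ℓ, st' j = st j) ∧ ∀ j ≥ 2 ^ (ℓ + 1), W₀' j = W₀ j ∧ W₁' j = W₁ j := by
  induction ℓ generalizing base out st W₀ W₁ s with
  | zero =>
    refine Iter.mono (Iter.one (by simp [hs.r4]) (run_step_leaf hB hs)) (by norm_num) ?_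
    intro s' hs'
    exact ⟨st, W₀, W₁, hs', fun _ _ => rfl, fun _ _ => ⟨rfl, rfl⟩⟩
  | succ ℓ ih =>
    have hp : 2 ^ (ℓ + 1) = 2 ^ ℓ + 2 ^ ℓ := by rw [pow_succ]; ring
    have hpos : 0 < 2 ^ ℓ := by positivity
    -- Two visits of half blocks plus at most `50 · 2 ^ ℓ + 43` steps of overhead. Increasing the
    -- level by one adds `200 · 2 ^ ℓ` to the budget, which covers the overhead.
    have hT : (2 ^ ℓ * 18 + 10 + 1) + (100 * (2 ^ ℓ * (ℓ + 1)) + ((2 ^ ℓ * 20 + 15 + 1) +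
        (100 * (2 ^ ℓ * (ℓ + 1)) + (2 ^ ℓ * 12 + 15 + 1)))) ≤
        100 * (2 ^ (ℓ + 1) * (ℓ + 1 + 1)) := by
      rw [hp]; nlinarith
    refine Iter.mono (Iter.trans (Iter.one (by simp [hs.r4]) (run_step_split hB hℓ hs)) ?_) hT
      fun _ h => h
    rintro s1 ⟨A₀, A₁, h1, hA, hAm⟩
    refine Iter.trans (ih (by omega) (by omega) h1) ?_
    rintro s2 ⟨st2, C₀, C₁, h2, hst2, hC⟩
    rw [hAm] at h2
    set u := cancelWord ℓ (minusW (blockW (ℓ + 1) W₀ W₁)) (blockKnown kn base ℓ) with hu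
    have hst2' : st2 (2 ^ (ℓ + 1)) = 0 := by
      rw [hst2 _ (by omega), Function.update_self]
    refine Iter.trans (Iter.one (by simp [h2.r4])
      (run_step_second hB hℓ hbase hst2' h2)) ?_
    rintro s3 ⟨D₀, D₁, h3, hD, hDp⟩
    -- The visit of the first half only changed cells below `2 ^ (ℓ + 1)`, so the parent's measures
    -- are still available for the second half.
    have hCW : blockW (ℓ + 1) C₀ C₁ = blockW (ℓ + 1) W₀ W₁ := blockW_congr fun j hj =>
      ⟨(hC j hj).1.trans (hA j hj).1, (hC j hj).2.trans (hA j hj).2⟩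
    refine Iter.trans (ih (by omega) (by omega) h3) ?_
    rintro s4 ⟨st4, E₀, E₁, h4, hst4, hE⟩
    rw [hDp, hCW] at h4
    set v := cancelWord ℓ (plusW (blockW (ℓ + 1) W₀ W₁) u) (blockKnown kn (base + 2 ^ ℓ) ℓ) with hv
    have hst4' : st4 (2 ^ (ℓ + 1)) = 1 := by
      rw [hst4 _ (by omega), Function.update_self]
    refine Iter.mono (Iter.one (by simp [h4.r4])
      (run_step_combine hB hℓ hbase hst4' h4)) le_rfl ?_
    intro s5 h5
    refine ⟨st4, E₀, E₁, ?_, fun j hj => ?_, fun j hj => ?_⟩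
    · have hcw : cancelWord (ℓ + 1) (blockW (ℓ + 1) W₀ W₁) (blockKnown kn base (ℓ + 1)) =
          glue (fun k => u k + v k) v := by
        simp only [cancelWord, blockKnown_lo, blockKnown_hi, hu, hv]
      rw [hcw]
      exact h5
    · rw [hst4 j (by omega), Function.update_of_ne (by omega), hst2 j (by omega),
        Function.update_of_ne (by omega)]
    · have hj' : j ≥ 2 ^ (ℓ + 1) := le_trans (Nat.pow_le_pow_right (by norm_num) (by omega)) hj
      have e1 := hE j hj'
      have e2 := hD j hj'
      have e3 := hC j hj'
      have e4 := hA j hj'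
      exact ⟨by rw [e1.1, e2.1, e3.1, e4.1], by rw [e1.2, e2.2, e3.2, e4.2]⟩

lemma run_decodeLoop (hB : 4 * 2 ^ n + 8 ≤ B)
    (hs : DecoderState B n kn (2 ^ n) 0 0 out st W₀ W₁ s) :
    Run B (.loop (.lt (.reg 4) (.const 2)) decodeStep) s (100 * (2 ^ n * (n + 1)) + 20) fun s' =>
      ∀ i : Fin (2 ^ n), s'.arr 3 i =
        (cancelWord n (blockW n W₀ W₁) (blockKnown kn 0 n) i).val := by
  -- One more iteration after the return from the whole block sets the mode to `2`, which ends the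
  -- loop.
  refine Run.le (Iter.run (T := 100 * (2 ^ n * (n + 1)) + (4 + 1)) (Q := fun s' => s'.reg 4 = 2 ∧
    ∀ i : Fin (2 ^ n), s'.arr 3 i =
        (cancelWord n (blockW n W₀ W₁) (blockKnown kn 0 n) i).val) ?_ ?_ |>.mono le_rfl
      fun s' h => h.2) (by omega)
  · refine Iter.trans (iter_decodeStep hB le_rfl (by omega) hs) ?_
    rintro u ⟨st', W₀', W₁', hu, -⟩
    refine Iter.one (by simp [hu.r4]) ?_
    refine Run.branch (T := 3) (fun hc => ?_) fun _ => ?_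
    · simp [hu.r4] at hc
    refine Run.branch (T := 2) (fun hc => ?_) fun _ => ?_
    · simp [hu.r2, hu.r1] at hc
    refine run_block hu.bdd (by simp; omega) fun vb => ⟨by simp, fun i => ?_⟩
    have := writeBits_apply (base := 0)
      (cancelWord n (blockW n W₀ W₁) (blockKnown kn 0 n)) out i
    rw [zero_add] at this
    simpa [hu.out] using this
  · rintro u ⟨hu, -⟩
    simp [hu]

end Steps

/-- Unpacks the bits that the receiver knows into array `4`; the entry `2` stands for an unknown
bit.  The cardinality of `𝒱_X` is in register `3`. -/
def knownProg : Prog :=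
  .seq (block [.set 2 (.const 0), .set 5 (.const 0), .set 6 (.const 0)])
    (.loop (.lt (.reg 2) (.reg 1))
      (.seq (block [.load 4 0 (.reg 2), .load 8 1 (.reg 3), .load 10 2 (.reg 6),
          .sub 11 (.reg 8) (.reg 10), .sub 12 (.reg 10) (.reg 8), .load 9 1 (.reg 5)])
        (.branch (.lt (.reg 4) (.const 1))
          (block [.store 4 (.reg 2) (.const 2), .add 2 (.reg 2) (.const 1)])
          (.branch (.lt (.reg 4) (.const 2))
            (block [.store 4 (.reg 2) (.reg 9), .add 5 (.reg 5) (.const 1),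
              .add 2 (.reg 2) (.const 1)])
            (block [.add 11 (.reg 11) (.reg 12), .store 4 (.reg 2) (.reg 11),
              .add 3 (.reg 3) (.const 1), .add 6 (.reg 6) (.const 1),
              .add 2 (.reg 2) (.const 1)])))))

section Known

variable {B : ℕ} {p : PMF (ZMod 2)} {β : ℝ} {n : ℕ}

/-- The state of the unpacking loop. -/
structure UnpackState (B : ℕ) (p : PMF (ZMod 2)) (β : ℝ) (n : ℕ) (a : ℕ → ℕ → ℕ) (w : ℕ → ℝ)
    (f : Fin (2 ^ n) → Option (ZMod 2)) (k : ℕ) (s : State) : Prop where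
  bdd : s.BoundedBy B
  r1 : s.reg 1 = 2 ^ n
  r2 : s.reg 2 = k
  r3 : s.reg 3 = #(veryHighSet p β n) + rank (padSet p β n) k
  r5 : s.reg 5 = rank (veryHighSet p β n) k
  r6 : s.reg 6 = rank (padSet p β n) k
  arr : ∀ i ≠ 4, s.arr i = a i
  rreg : s.rreg = w
  known : ∀ i : Fin (2 ^ n), i.val < k → s.arr 4 i = (f i).elim 2 ZMod.val

/-- The inverse of packing: the same running ranks locate the bits of the message and of the seed,
and adding the seed again removes the pad. -/
lemma run_knownProg (hB : 2 ^ n + 2 ≤ B) {s : State} (hs : s.BoundedBy B) (m : PolarMsg p β n)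
    (u : BitsOn (padSet p β n)) (h1 : s.reg 1 = 2 ^ n) (h3 : s.reg 3 = #(veryHighSet p β n))
    (a0 : s.arr 0 = indexTable p β n) (a1 : s.arr 1 = packMsg p β n m)
    (a2 : s.arr 2 = packBits (padSet p β n) u) :
    Run B knownProg s (20 * 2 ^ n + 10) fun s' => s'.BoundedBy B ∧ s'.reg 1 = 2 ^ n ∧
      s'.rreg = s.rreg ∧
      ∀ i : Fin (2 ^ n), s'.arr 4 i = (receivedBits p β n m u i).elim 2 ZMod.val := by
  refine Run.le (Run.seq' (T := 4) (T' := 2 ^ n * (19 + 1) + 1)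
    (run_block hs (by simp) fun hb => ?_)) (by omega)
  refine Run.mono (Run.for (UnpackState B p β n s.arr s.rreg (receivedBits p β n m u)) (2 ^ n) 19
    ?_ ?_ ?_) le_rfl ?_
  · exact ⟨hb, by simp [h1], by simp, by simp [h3, rank_zero], by simp [rank_zero],
      by simp [rank_zero], fun i _ => by simp, by simp, fun i hi => by omega⟩
  · intro k hk t ht
    refine ⟨by simp [ht.r1, ht.r2, hk], ?_⟩
    set i : Fin (2 ^ n) := ⟨k, hk⟩ with hi
    have hcard := card_add_card_le (p := p) (β := β) (n := n)
    have hr1 := rank_le (veryHighSet p β n) k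
    have hr2 := rank_le (padSet p β n) k
    have ta0 : t.arr 0 k = indexTable p β n i := by rw [ht.arr 0 (by norm_num), a0]
    have ta1 : t.arr 1 = packMsg p β n m := by rw [ht.arr 1 (by norm_num), a1]
    have ta2 : t.arr 2 = packBits (padSet p β n) u := by rw [ht.arr 2 (by norm_num), a2]
    have hne : ∀ j : Fin (2 ^ n), j.val < k + 1 → j ≠ i → j.val < k := fun j hj hji => by
      have : j.val ≠ k := fun h => hji (Fin.ext h)
      omega
    refine Run.le (Run.seq' (T := 7) (T' := 8) (run_block ht.bdd (by simp) fun ub => ?_))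
      (by omega)
    refine Run.le (Run.branch (T := 7) (fun hc => ?_) fun hc => ?_) (by omega)
    · simp [ht.r2, ta0] at hc
      have hv : i ∉ veryHighSet p β n := fun hv => by
        have := indexTable_veryHigh hv; omega
      have hp : i ∉ padSet p β n := fun hp => by
        have := indexTable_pad hp; omega
      have e1 := rank_succ_of_notMem hv
      have e2 := rank_succ_of_notMem hp
      simp only [hi] at e1 e2
      refine Run.le (run_block ub ?_ fun vb => ?_) (by simp)
      · simp [ht.r2]; omega
      refine ⟨vb, by simp [ht.r1], by simp [ht.r2], by simp [ht.r3, e2], by simp [ht.r5, e1],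
        by simp [ht.r6, e2], fun i hi => by simp [hi, ht.arr i hi], by simp [ht.rreg],
        fun j hj => ?_⟩
      by_cases hji : j = i
      · have e7 : receivedBits p β n m u i = none := by
          rw [receivedBits, dif_neg hv, dif_neg hp]
        rw [hji, e7]
        simp [hi, ht.r2]
      · have hjk := hne j hj hji
        simp [ht.r2, hjk.ne, ht.known j hjk]
    · simp [ht.r2, ta0] at hc
      refine Run.le (Run.branch (T := 6) (fun hc' => ?_) fun hc' => ?_) (by omega)
      · simp [ht.r2, ta0] at hc'
        have hv : i ∈ veryHighSet p β n := by
          by_contra hv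
          by_cases hp : i ∈ padSet p β n
          · have := indexTable_pad hp; omega
          · have := indexTable_other hv hp; omega
        have hp := notMem_padSet_of_mem hv
        have e1 := rank_succ_of_mem hv
        have e2 := rank_succ_of_notMem hp
        have e3 := packMsg_veryHigh m hv
        have e4 := rank_lt hv
        simp only [hi] at e1 e2 e3 e4
        refine Run.le (run_block ub ?_ fun vb => ?_) (by simp)
        · simp [ht.r2, ht.r5]; omega
        refine ⟨vb, by simp [ht.r1], by simp [ht.r2], by simp [ht.r3, e2], by simp [ht.r5, e1],
          by simp [ht.r6, e2], fun i hi => by simp [hi, ht.arr i hi], by simp [ht.rreg],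
          fun j hj => ?_⟩
        by_cases hji : j = i
        · have e7 : receivedBits p β n m u i = some (m.1 ⟨i, hv⟩) := by
            rw [receivedBits, dif_pos hv]
          rw [hji, e7]
          simp [hi, ht.r2, ht.r5, ta1, e3]
        · have hjk := hne j hj hji
          simp [ht.r2, hjk.ne, ht.known j hjk]
      · simp [ht.r2, ta0] at hc'
        have hp : i ∈ padSet p β n := by
          by_contra hp
          by_cases hv : i ∈ veryHighSet p β n
          · have := indexTable_veryHigh hv; omega
          · have := indexTable_other hv hp; omega
        have hv : i ∉ veryHighSet p β n := fun hv => notMem_padSet_of_mem hv hp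
        have e1 := rank_succ_of_notMem hv
        have e2 := rank_succ_of_mem hp
        have e3 := packMsg_pad m hp
        have e4 := rank_lt hp
        have e6 := packBits_rank u hp
        have hxor := zmod_two_xor (m.2 ⟨i, hp⟩) (u ⟨i, hp⟩)
        have hle := zmod_two_val_le (m.2 ⟨i, hp⟩ + u ⟨i, hp⟩)
        have e7 : receivedBits p β n m u i = some (m.2 ⟨i, hp⟩ + u ⟨i, hp⟩) := by
          rw [receivedBits, dif_neg hv, dif_pos hp]
        simp only [hi] at e1 e2 e3 e4 e6 hxor hle
        refine Run.le (run_block ub ?_ fun vb => ?_) (by simp)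
        · simp [ht.r2, ht.r3, ht.r6, ta1, ta2, e3, e6, hxor]; omega
        refine ⟨vb, by simp [ht.r1], by simp [ht.r2], by simp [ht.r3, e2, add_assoc],
          by simp [ht.r5, e1], by simp [ht.r6, e2], fun i hi => by simp [hi, ht.arr i hi],
          by simp [ht.rreg], fun j hj => ?_⟩
        by_cases hji : j = i
        · rw [hji, e7]
          simp [hi, ht.r2, ht.r3, ht.r6, ta1, ta2, e3, e6, hxor]
        · have hjk := hne j hj hji
          simp [ht.r2, hjk.ne, ht.known j hjk]
  · intro t ht
    simp [ht.r1, ht.r2]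
  · intro t ht
    exact ⟨ht.bdd, ht.r1, ht.rreg, fun i => ht.known i i.2⟩

end Known

/-- Prepares the arrays of the decoder: the halves of the powers of two, and the measures of the
symbols. -/
def setupProg : Prog :=
  .seq (block [.set 2 (.const 1)])
    (.seq (.loop (.lt (.reg 2) (.reg 1))
        (block [.add 5 (.reg 2) (.reg 2), .store 6 (.reg 5) (.reg 2), .set 2 (.reg 5)]))
      (.seq (block [.add 5 (.reg 1) (.reg 1), .set 3 (.reg 1)])
        (.seq (.loop (.lt (.reg 3) (.reg 5))
            (block [.rstore 0 (.reg 3) 0, .rstore 1 (.reg 3) 1, .add 3 (.reg 3) (.const 1)]))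
          (block [.set 3 (.const 0), .set 4 (.const 0)]))))

/-- Halves are tabulated at powers of two only, by repeated doubling. The source measures go to the
cells `N, …, 2 N - 1`, which belong to the block of full length. -/
lemma run_setupProg {B n : ℕ} (hB : 4 * 2 ^ n + 8 ≤ B) {s : State} (hs : s.BoundedBy B)
    (h1 : s.reg 1 = 2 ^ n) :
    Run B setupProg s (15 * 2 ^ n + 20) fun s' => ∃ out st W₀ W₁,
      DecoderState B n (s.arr 4) (2 ^ n) 0 0 out st W₀ W₁ s' ∧
      ∀ j < 2 ^ n, W₀ (2 ^ n + j) = s.rreg 0 ∧ W₁ (2 ^ n + j) = s.rreg 1 := by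
  have hn : n < 2 ^ n := Nat.lt_two_pow_self
  refine Run.le (Run.seq' (T := 2) (T' := (n * (4 + 1) + 1) + (3 + ((2 ^ n * (4 + 1) + 1) + 3)))
    (run_block hs (by simp; omega) fun hb => ?_)) (by omega)
  refine Run.seq (Run.for (fun k s' => s'.BoundedBy B ∧ s'.reg 1 = 2 ^ n ∧ s'.reg 2 = 2 ^ k ∧
    s'.arr 4 = s.arr 4 ∧ s'.rreg = s.rreg ∧ ∀ j < k, s'.arr 6 (2 ^ (j + 1)) = 2 ^ j)
    n 4 ?_ ?_ ?_) ?_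
  · exact ⟨hb, by simp [h1], by simp, by simp, by simp, fun j hj => by omega⟩
  · rintro k hk t ⟨tb, t1, t2, ta, tr, th⟩
    have hlt : 2 ^ k < 2 ^ n := Nat.pow_lt_pow_right (by norm_num) hk
    refine ⟨by simp [t1, t2, hlt], ?_⟩
    refine Run.le (run_block tb ?_ fun vb => ?_) (by simp)
    · simp [t2]; omega
    refine ⟨vb, by simp [t1], by simp [t2, pow_succ']; ring, by simp [ta], by simp [tr],
      fun j hj => ?_⟩
    have h2 : 2 ^ k + 2 ^ k = 2 ^ (k + 1) := by rw [pow_succ]; ring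
    by_cases hjk : j = k
    · simp [t2, h2, hjk]
    · have hne : 2 ^ (j + 1) ≠ 2 ^ (k + 1) := fun h => by
        have := Nat.pow_right_injective (le_refl 2) h
        omega
      simp [t2, h2, hjk, th j (by omega)]
  · rintro t ⟨tb, t1, t2, -⟩
    simp [t1, t2]
  · rintro t ⟨tb, t1, t2, ta, tr, th⟩
    refine Run.seq' (run_block tb (by simp [t1]; omega) fun ub => ?_)
    refine Run.seq (Run.for (fun k s' => s'.BoundedBy B ∧ s'.reg 1 = 2 ^ n ∧ s'.reg 2 = 2 ^ n ∧
      s'.reg 3 = 2 ^ n + k ∧ s'.reg 5 = 2 ^ n + 2 ^ n ∧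
      s'.arr 4 = s.arr 4 ∧ s'.rreg = s.rreg ∧ (∀ j < n, s'.arr 6 (2 ^ (j + 1)) = 2 ^ j) ∧
      ∀ j < k, s'.rarr 0 (2 ^ n + j) = s.rreg 0 ∧ s'.rarr 1 (2 ^ n + j) = s.rreg 1)
      (2 ^ n) 4 ?_ ?_ ?_) ?_
    · exact ⟨ub, by simp [t1], by simp [t2], by simp [t1], by simp [t1], by simp [ta],
        by simp [tr], by simpa using th, fun j hj => by omega⟩
    · rintro k hk u ⟨vb, u1, u2, u3, u5, ua, ur, uh, uw⟩
      refine ⟨by simp [u3, u5, hk], ?_⟩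
      refine Run.le (run_block vb ?_ fun wb => ?_) (by simp)
      · simp [u3]; omega
      refine ⟨wb, by simp [u1], by simp [u2], by simp [u3, add_assoc], by simp [u5], by simp [ua],
        by simp [ur], by simpa using uh, fun j hj => ?_⟩
      by_cases hjk : j = k
      · simp [u3, hjk, ur]
      · simp [u3, hjk, uw j (by omega)]
    · rintro u ⟨vb, u1, u2, u3, u5, -⟩
      simp [u3, u5]
    · rintro u ⟨vb, u1, u2, u3, u5, ua, ur, uh, uw⟩
      refine run_block vb (by simp) fun wb => ?_
      exact ⟨u.arr 3, u.arr 5, u.rarr 0, u.rarr 1, ⟨wb, by simp [u1], by simp [u2], by simp,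
        by simp, by simp, by simp [ua], by simp, by simpa using uh, by simp, by simp⟩, uw⟩

/-- The program of the decoder. -/
def decodeProg : Prog :=
  .seq countProg (.seq knownProg (.seq setupProg (.loop (.lt (.reg 4) (.const 2)) decodeStep)))

lemma decodesWithin_decodeProg {p : PMF (ZMod 2)} {β : ℝ} {n B T : ℕ} (hB : 4 * 2 ^ n + 8 ≤ B)
    (hT : 145 * 2 ^ n + 100 * (n * 2 ^ n) + 60 ≤ T) : DecodesWithin decodeProg p β n B T := by
  intro m u
  have hbdd : (inputState p β n (packMsg p β n m) u).BoundedBy B :=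
    inputState_boundedBy (by omega) (by omega) (packMsg_le m) u
  have hrun : Run B decodeProg (inputState p β n (packMsg p β n m) u)
      ((10 * 2 ^ n + 10) + ((20 * 2 ^ n + 10) + ((15 * 2 ^ n + 20) +
        (100 * (2 ^ n * (n + 1)) + 20)))) fun s' =>
      ∀ i : Fin (2 ^ n), s'.arr 3 i = (polarDec p β n m u i).val := by
    refine Run.seq (run_countProg (p := p) (β := β) (n := n) (by omega) hbdd (by simp [inputState])
      (by simp [inputState])) ?_
    rintro s1 ⟨b1, s1r1, s1r3, s1a, s1r, -⟩
    refine Run.seq (run_knownProg (by omega) b1 m u s1r1 s1r3 (by rw [s1a]; simp [inputState])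
      (by rw [s1a]; simp [inputState]) (by rw [s1a]; simp [inputState])) ?_
    rintro s2 ⟨b2, s2r1, s2r, s2k⟩
    refine Run.seq (run_setupProg hB b2 s2r1) ?_
    rintro s3 ⟨out, st, W₀, W₁, h3, hw⟩
    refine Run.mono (run_decodeLoop hB h3) le_rfl fun s4 h4 i => ?_
    rw [h4 i, polarDec, successiveCancellation_eq]
    congr 2
    · funext k b
      have e0 : s2.rreg 0 = (p 0).toReal := by rw [s2r, s1r]; simp [inputState]
      have e1 : s2.rreg 1 = (p 1).toReal := by rw [s2r, s1r]; simp [inputState]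
      obtain ⟨w0, w1⟩ := hw k k.2
      rw [blockW, w0, w1, e0, e1]
      obtain rfl | rfl : b = 0 ∨ b = 1 := by revert b; decide
      · simp
      · simp
    · funext k
      rw [blockKnown, zero_add, s2k k]
      rcases receivedBits p β n m u k with _ | b
      · simp
      · have hb := zmod_two_val_le b
        simp [show b.val < 2 by omega]
  obtain ⟨t, ht, s', he, hq⟩ := hrun
  refine ⟨t, ht.trans (le_trans ?_ hT), s', he, hq⟩
  nlinarith

end UniformCompression

end

theorem proposition4 :
    (∀ (p : PMF (ZMod 2)) (β : ℝ), 0 < β → β < 1 / 2 →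
      ∀ R : ℝ, UniformCompression.entropy p < R →
        UniformCompression.AchievesRate p R (fun n => 2 ^ n)
          (fun n => UniformCompression.polarCode p β n) ∧
        (fun n : ℕ => ((UniformCompression.padSet p β n).card : ℝ))
          =o[Filter.atTop] (fun n : ℕ => ((2 ^ n : ℕ) : ℝ))) ∧
    (∃ (E D : UniformCompression.Prog) (K : ℕ),
      ∀ (p : PMF (ZMod 2)) (β : ℝ), 0 < β → β < 1 / 2 → ∀ n : ℕ, 1 ≤ n →
        UniformCompression.EncodesWithin E p β n (K * 2 ^ n) (K * (2 ^ n * Nat.log 2 (2 ^ n))) ∧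
        UniformCompression.DecodesWithin D p β n (K * 2 ^ n) (K * (2 ^ n * Nat.log 2 (2 ^ n)))) := by
  refine ⟨fun p β hβ0 hβ R hR => ⟨UniformCompression.achievesRate_polarCode p hβ0 hβ hR,
    UniformCompression.card_padSet_isLittleO p hβ0 hβ⟩, UniformCompression.encodeProg,
    UniformCompression.decodeProg, 1000, fun p β _ _ n hn => ?_⟩
  -- Since `log₂ N = n ≥ 1`, both `N` and the additive constants are absorbed by `n N`. The constant
  -- `1000` generously covers the step count `145 N + 100 n N + 60` and the integer bound `4 N + 8`
  -- of the decoder, and the smaller ones of the encoder.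
  rw [Nat.log_pow (by norm_num)]
  have h2 : 2 ≤ 2 ^ n := by simpa using Nat.pow_le_pow_right (show 0 < 2 by norm_num) hn
  have hle : 2 ^ n ≤ n * 2 ^ n := Nat.le_mul_of_pos_left _ hn
  have hcomm : 2 ^ n * n = n * 2 ^ n := mul_comm _ _
  constructor
  · exact UniformCompression.encodesWithin_encodeProg (by omega) (by omega)
  · exact UniformCompression.decodesWithin_decodeProg (by omega) (by omega)
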